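/- Let $d\ge 1$ and let $R$ be a real symmetric $d\times d$ matrix with $R_{ij}\ge 0$ for all $i,j$ and $\sum_i R_{ij}>0$ for each $j$. Let $s_1,\dots,s_d>0$ be initial weights and $y_0\in\{1,\dots,d\}$ an initial state (for instance $s_i=1$ for all $i$ and $y_0=1$). Let $(Y_n)_{n\ge 0}$ be a random process on $\{1,\dots,d\}$ with $Y_0=y_0$ almost surely and $$\mathbf P(Y_{n+1}=j\mid Y_0,\dots,Y_n)=\frac{R_{Y_n,j}\,S_j(n)}{\sum_i R_{Y_n,i}\,S_i(n)},$$ where $S_i(0)=s_i$ and $S_i(n+1)=S_i(n)+\mathbf 1_{\{Y_{n+1}=i\}}$, and let $V(n)=S(n)/\sum_j S_j(n)$, an element of the simplex $\Delta=\{v\in\mathbb R^d: v_i\ge 0,\ \sum_i v_i=1\}$. Put $N_i(v)=\sum_j R_{ij}v_j$, $H(v)=\sum_i v_iN_i(v)$ and, where $H(v)\neq 0$, $\pi_i(v)=v_iN_i(v)/H(v)$. A critical point is a point $v\in\Delta$ with $H(v)>0$ and $\pi(v)=v$. Suppose that $R$ is nonsingular and that $p$ is a critical point in the interior of $\Delta$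 (all $p_i>0$). Then $p$ is the only critical point in the interior of $\Delta$, and if $p$ is not a maximum of $H$ on $\Delta$, then $\mathbf P(V(n)\to p)=0$. Moreover, $\pi-I$ is differentiable at $p$, its derivative $D_p(\pi-I)$ maps $W=\{w\in\mathbb R^d:\sum_i w_i=0\}$ (the linear span of $-p+\Delta$) into itself, and the following are equivalent: (a) $p$ is not a maximum of $H$ on $\Delta$; (b) $R$ has more than one positive eigenvalue, counted with multiplicity; (c) the linear operator $D_p(\pi-I)$ on $W$ has a positive eigenvalue. -/

import Mathlib

open scoped MeasureTheory ProbabilityTheory Topology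

noncomputable section

namespace VRRW

/-- `N_i(v) = ∑_j R_{ij} v_j`. -/
def N {d : ℕ} (R : Matrix (Fin d) (Fin d) ℝ) (v : Fin d → ℝ) (i : Fin d) : ℝ :=
  ∑ j, R i j * v j

/-- The quadratic form `H(v) = ∑_i v_i N_i(v) = ∑_{i,j} R_{ij} v_i v_j`. -/
def H {d : ℕ} (R : Matrix (Fin d) (Fin d) ℝ) (v : Fin d → ℝ) : ℝ :=
  ∑ i, v i * N R v i

/-- `π_i(v) = v_i N_i(v) / H(v)`, meaningful where `H(v) ≠ 0`. -/
def stat {d : ℕ} (R : Matrix (Fin d) (Fin d) ℝ) (v : Fin d → ℝ) : Fin d → ℝ :=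
  fun i => v i * N R v i / H R v

/-- The vector field `π - I`. -/
def drift {d : ℕ} (R : Matrix (Fin d) (Fin d) ℝ) (v : Fin d → ℝ) : Fin d → ℝ :=
  stat R v - v

/-- Critical points: `v` in the simplex with `H(v) > 0` and `π(v) = v`. -/
def IsCritical {d : ℕ} (R : Matrix (Fin d) (Fin d) ℝ) (v : Fin d → ℝ) : Prop :=
  v ∈ stdSimplex ℝ (Fin d) ∧ 0 < H R v ∧ stat R v = v

/-- Critical points in the (relative) interior of the simplex. -/
def IsInteriorCritical {d : ℕ} (R : Matrix (Fin d) (Fin d) ℝ) (v : Fin d → ℝ) : Prop :=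
  IsCritical R v ∧ ∀ i, 0 < v i

/-- The directions of the simplex: the linear span `{w : ∑ w_i = 0}` of `-p + Δ`, for `p`
interior to the simplex `Δ`. -/
def directions (d : ℕ) : Submodule ℝ (Fin d → ℝ) where
  carrier := {w | ∑ i, w i = 0}
  add_mem' := by
    intro a b ha hb
    simp only [Set.mem_ofPred_eq] at ha hb ⊢
    simp [Finset.sum_add_distrib, ha, hb]
  zero_mem' := by simp
  smul_mem' := by
    intro c a ha
    simp only [Set.mem_ofPred_eq] at ha ⊢
    simp [← Finset.mul_sum, ha]

/-- The number of positive eigenvalues of `R`, counted with multiplicity. -/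
def numPosEigenvalues {d : ℕ} (R : Matrix (Fin d) (Fin d) ℝ) : ℕ :=
  (R.charpoly.roots.filter (fun x => 0 < x)).card

/-- The weights `S(n)` along a path `y` with initial weights `s`: the starting state `y 0` is not
counted, and each later visit to `i` adds one to the weight of `i`. -/
def weight {d : ℕ} (s : Fin d → ℝ) (y : ℕ → Fin d) : ℕ → Fin d → ℝ
  | 0, i => s i
  | n + 1, i => weight s y n i + if y (n + 1) = i then 1 else 0

/-- The normalized occupation vector `V(n) = S(n) / ∑_j S_j(n)`. -/
def occupation {d : ℕ} (s : Fin d → ℝ) (y : ℕ → Fin d) (n : ℕ) : Fin d → ℝ :=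
  fun i => weight s y n i / ∑ j, weight s y n j

/-- The sigma-field generated by `Y_0, ..., Y_n`. -/
@[reducible] def history {d : ℕ} {Ω : Type*} (Y : ℕ → Ω → Fin d) (n : ℕ) : MeasurableSpace Ω :=
  ⨆ k : Fin (n + 1), MeasurableSpace.comap (Y k) inferInstance

/-- `Y` is the reinforced process with matrix `R`, initial weights `s` and initial state `y₀`:
given the past, the step from `Y_n` goes to `j` with probability
`R_{Y_n, j} S_j(n) / ∑_i R_{Y_n, i} S_i(n)`. -/
structure IsReinforcedProcess {d : ℕ} {Ω : Type*} [MeasurableSpace Ω]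
    (R : Matrix (Fin d) (Fin d) ℝ) (s : Fin d → ℝ) (y₀ : Fin d)
    (μ : MeasureTheory.Measure Ω) (Y : ℕ → Ω → Fin d) : Prop where
  measurable : ∀ n, Measurable (Y n)
  start : ∀ᵐ ω ∂μ, Y 0 ω = y₀
  step : ∀ (n : ℕ) (j : Fin d),
    μ[(Y (n + 1) ⁻¹' {j}).indicator (fun _ => (1 : ℝ)) | history Y n] =ᵐ[μ]
      fun ω => R (Y n ω) j * weight s (fun k => Y k ω) n j /
        ∑ i, R (Y n ω) i * weight s (fun k => Y k ω) n i

end VRRW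

end

/-!
If `q` is an interior critical point then `R q` is a multiple of the vector of ones, so `q` is the
normalization of `R⁻¹ 1`. In particular `H R (p + w) = H R p + H R w` for `w` in the directions of
the simplex, so `p` is not a maximum, equivalently `R` has a second positive eigenvalue, exactly
when `H R` is positive somewhere on the directions. With `D = diag p`, the derivative of the drift
at `p` is similar to the symmetric matrix `D^(1/2) R D^(1/2) / H R p - 2 √p √pᵀ`, hence
diagonalizable with real eigenvalues `κ j`: one is `-1`, and the others have the signs of `H R` on
the directions.

Suppose now that the occupation vector converges to `p` with positive probability, and consider the
chain with the weights frozen at `p`. If it is reducible, some state stops being visited, which is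
impossible as `p` is interior. Otherwise Lévy's zero-one law gives a late time and a history of
positive probability given which the occupation vector stays near `p` with conditional probability
close to one. Run two conditionally independent copies after this history and subtract them. After a
correction by a solution of the Poisson equation, the difference `w` follows the linearized flow,
perturbed by a small multiple of `w` and by martingale noise. As `w` is bounded and no `κ j`
vanishes, an `L²` estimate in the spirit of Perron bounds `w` by the size of the noise, and shows
that along an unstable direction the discounted noises of the two copies nearly cancel. But the
variance of each is bounded below, because a state with positive conditional variance is visited
often.
-/

namespace VRRW

open Filter Matrix MeasureTheory

section Eigenframe

variable {ι : Type*} [Fintype ι] {S : Matrix ι ι ℝ}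

theorem dotProduct_mulVec_comm (hS : S.IsSymm) (v w : ι → ℝ) : v ⬝ᵥ S *ᵥ w = w ⬝ᵥ S *ᵥ v := by
  rw [dotProduct_mulVec, ← mulVec_transpose, hS.eq, dotProduct_comm]

/-- The plane spanned by `v` and `w` meets the hyperplane `e ⬝ᵥ x = 0`, and there the form is
nonpositive. -/
theorem dotProduct_mulVec_nonpos_of_orthogonal (hS : S.IsSymm) {e v w : ι → ℝ}
    (hneg : ∀ x, e ⬝ᵥ x = 0 → x ⬝ᵥ S *ᵥ x ≤ 0) (hv : 0 < v ⬝ᵥ S *ᵥ v)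
    (horth : w ⬝ᵥ S *ᵥ v = 0) : w ⬝ᵥ S *ᵥ w ≤ 0 := by
  have hform := hneg ((e ⬝ᵥ w) • v - (e ⬝ᵥ v) • w) (by
    rw [dotProduct_sub, dotProduct_smul, dotProduct_smul, smul_eq_mul, smul_eq_mul, mul_comm,
      sub_self])
  simp only [mulVec_sub, mulVec_smul, dotProduct_sub, sub_dotProduct, smul_dotProduct,
    dotProduct_smul, smul_eq_mul, horth, dotProduct_mulVec_comm hS v w] at hform
  by_contra! hpos
  refine hpos.not_ge (hneg w ?_)
  by_contra hne
  have : 0 < (e ⬝ᵥ w) ^ 2 * (v ⬝ᵥ S *ᵥ v) := by positivity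
  have : 0 ≤ (e ⬝ᵥ v) ^ 2 * (w ⬝ᵥ S *ᵥ w) := by positivity
  linarith

variable [DecidableEq ι]

/-- Simultaneous diagonalization of the quadratic forms `w ↦ w ⬝ᵥ S *ᵥ w` and
`w ↦ ∑ i, w i ^ 2 / p i` by linear functionals `ℓ j`, with the eigenvalues `κ j`. The `ℓ j` are
then left eigenvectors of `diagonal p * S`, and the `p * ℓ j` the dual basis of right
eigenvectors. -/
structure IsEigenframe (S : Matrix ι ι ℝ) (p κ : ι → ℝ) (ℓ : ι → ι → ℝ) : Prop where
  mulVec_eq : ∀ j, S *ᵥ (p * ℓ j) = κ j • ℓ j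
  dual : ∀ i j, ℓ i ⬝ᵥ (p * ℓ j) = if i = j then 1 else 0
  sum_smul : ∀ w, ∑ j, (ℓ j ⬝ᵥ w) • (p * ℓ j) = w

theorem isEigenframe_eigenvectorBasis (hS : S.IsHermitian) :
    IsEigenframe S 1 hS.eigenvalues fun j => (hS.eigenvectorBasis j).ofLp where
  mulVec_eq j := by rw [one_mul]; exact hS.mulVec_eigenvectorBasis j
  dual i j := by
    rw [one_mul, ← hS.eigenvectorBasis.inner_eq_ite i j,
      EuclideanSpace.inner_eq_star_dotProduct, dotProduct_comm]
    rfl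
  sum_smul w := by
    have h := congrArg WithLp.ofLp (hS.eigenvectorBasis.sum_repr' (WithLp.toLp 2 w))
    rw [WithLp.ofLp_sum] at h
    refine Eq.trans (Finset.sum_congr rfl fun j _ => ?_) h
    rw [one_mul, EuclideanSpace.inner_eq_star_dotProduct, dotProduct_comm]
    rfl

namespace IsEigenframe

variable {p q κ : ι → ℝ} {ℓ e : ι → ι → ℝ}

theorem of_diagonal_mul_mul_diagonal (hq : ∀ i, q i ≠ 0)
    (h : IsEigenframe (diagonal q * S * diagonal q) 1 κ e) :
    IsEigenframe S (q ^ 2) κ fun j => e j / q := by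
  have hright : ∀ j, q ^ 2 * (e j / q) = q * e j := fun j => by
    ext i
    have := hq i
    simp only [Pi.mul_apply, Pi.pow_apply, Pi.div_apply]
    field_simp
  have hleft : ∀ j w, (e j / q) ⬝ᵥ w = e j ⬝ᵥ (w / q) := fun j w =>
    Finset.sum_congr rfl fun i _ => by simp only [Pi.div_apply]; ring
  have hcancel : ∀ w : ι → ℝ, q * w / q = w := fun w => by
    ext i
    exact mul_div_cancel_left₀ _ (hq i)
  refine ⟨fun j => ?_, fun i j => ?_, fun w => ?_⟩
  · have hj := h.mulVec_eq j
    rw [one_mul, mul_assoc, ← mulVec_mulVec, ← mulVec_mulVec] at hj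
    have hdiag : ∀ w : ι → ℝ, diagonal q *ᵥ w = q * w := fun w => funext fun i =>
      mulVec_diagonal q w i
    rw [hdiag, hdiag] at hj
    rw [hright, ← hcancel (S *ᵥ _), hj]
    ext i
    simp only [Pi.div_apply, Pi.smul_apply, smul_eq_mul, mul_div_assoc]
  · rw [hright, hleft, hcancel, ← h.dual i j, one_mul]
  · simp only [hleft, hright, ← mul_smul_comm, ← Finset.mul_sum]
    have hw := h.sum_smul (w / q)
    simp only [one_mul] at hw
    rw [hw, mul_div_assoc', hcancel]

theorem exists_of_pos (hS : S.IsSymm) (hp : ∀ i, 0 < p i) : ∃ κ ℓ, IsEigenframe S p κ ℓ := by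
  set q : ι → ℝ := fun i => √(p i)
  have hq2 : q ^ 2 = p := funext fun i => Real.sq_sqrt (hp i).le
  have hA : (diagonal q * S * diagonal q).IsHermitian := by
    rw [IsHermitian, conjTranspose_eq_transpose_of_trivial, transpose_mul, transpose_mul,
      diagonal_transpose, hS.eq, mul_assoc]
  have h := (isEigenframe_eigenvectorBasis hA).of_diagonal_mul_mul_diagonal
    fun i => (Real.sqrt_pos.2 (hp i)).ne'
  rw [hq2] at h
  exact ⟨_, _, h⟩

theorem sum_mul_sq (h : IsEigenframe S p κ ℓ) (j : ι) : ∑ i, p i * ℓ j i ^ 2 = 1 := by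
  rw [← (h.dual j j).trans (if_pos rfl)]
  exact Finset.sum_congr rfl fun i _ => by rw [Pi.mul_apply]; ring

theorem mul_ne_zero (h : IsEigenframe S p κ ℓ) (j : ι) : p * ℓ j ≠ 0 := fun h0 => by
  simpa [h0] using h.dual j j

theorem dotProduct_mulVec_eq_sum (h : IsEigenframe S p κ ℓ) (w : ι → ℝ) :
    w ⬝ᵥ S *ᵥ w = ∑ j, κ j * (ℓ j ⬝ᵥ w) ^ 2 := by
  conv_lhs => rw [← h.sum_smul w, mulVec_sum, dotProduct_sum]
  refine Finset.sum_congr rfl fun j _ => ?_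
  rw [h.sum_smul, mulVec_smul, h.mulVec_eq, dotProduct_smul, dotProduct_smul, dotProduct_comm w]
  simp only [smul_eq_mul]
  ring

theorem sum_sq_div_eq (h : IsEigenframe S p κ ℓ) (hp : ∀ i, p i ≠ 0) (w : ι → ℝ) :
    ∑ i, w i ^ 2 / p i = ∑ j, (ℓ j ⬝ᵥ w) ^ 2 := by
  have hexp : ∀ i, w i / p i = ∑ j, (ℓ j ⬝ᵥ w) * ℓ j i := fun i => by
    conv_lhs => rw [← h.sum_smul w]
    simp only [Finset.sum_apply, Pi.smul_apply, Pi.mul_apply, smul_eq_mul, mul_left_comm _ (p i),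
      ← Finset.mul_sum]
    exact mul_div_cancel_left₀ _ (hp i)
  simp only [sq, mul_div_assoc, hexp, Finset.mul_sum]
  rw [Finset.sum_comm]
  refine Finset.sum_congr rfl fun j _ => ?_
  conv_rhs => rw [dotProduct, Finset.mul_sum]
  exact Finset.sum_congr rfl fun i _ => by rw [dotProduct]; ring

theorem exists_dotProduct_eq_zero_of_pos_of_pos (h : IsEigenframe S p κ ℓ) {j k : ι} (hjk : j ≠ k)
    (hj : 0 < κ j) (hk : 0 < κ k) (u : ι → ℝ) : ∃ w, u ⬝ᵥ w = 0 ∧ 0 < w ⬝ᵥ S *ᵥ w := by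
  have hdual : ∀ i l, (p * ℓ i) ⬝ᵥ ℓ l = if l = i then 1 else 0 := fun i l => by
    rw [dotProduct_comm, h.dual]
  by_cases h0 : u ⬝ᵥ (p * ℓ j) = 0
  · refine ⟨p * ℓ j, h0, ?_⟩
    rw [h.mulVec_eq, dotProduct_smul, hdual, if_pos rfl, smul_eq_mul, mul_one]
    exact hj
  · set a := u ⬝ᵥ (p * ℓ k)
    set b := u ⬝ᵥ (p * ℓ j)
    refine ⟨a • (p * ℓ j) - b • (p * ℓ k), ?_, ?_⟩
    · rw [dotProduct_sub, dotProduct_smul, dotProduct_smul, smul_eq_mul, smul_eq_mul, mul_comm,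
        sub_self]
    · calc
        0 < κ j * a ^ 2 + κ k * b ^ 2 := by positivity
        _ = _ := by
          simp only [mulVec_sub, mulVec_smul, h.mulVec_eq, dotProduct_sub, sub_dotProduct,
            smul_dotProduct, dotProduct_smul, hdual, hjk, hjk.symm, if_true, if_false,
            smul_eq_mul]
          ring

theorem dotProduct_mulVec_nonpos (h : IsEigenframe S p κ ℓ) {j : ι} (hκ : ∀ k ≠ j, κ k ≤ 0)
    {w : ι → ℝ} (hw : ℓ j ⬝ᵥ w = 0) : w ⬝ᵥ S *ᵥ w ≤ 0 := by
  rw [h.dotProduct_mulVec_eq_sum]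
  refine Finset.sum_nonpos fun k _ => ?_
  rcases eq_or_ne k j with rfl | hk
  · rw [hw, zero_pow two_ne_zero, mul_zero]
  · exact mul_nonpos_of_nonpos_of_nonneg (hκ k hk) (sq_nonneg _)

theorem dotProduct_diagonal_mul_mulVec (hS : S.IsSymm) (h : IsEigenframe S p κ ℓ) (j : ι)
    (w : ι → ℝ) : ℓ j ⬝ᵥ (diagonal p * S) *ᵥ w = κ j * (ℓ j ⬝ᵥ w) := by
  have hmove : ℓ j ⬝ᵥ (diagonal p * S) *ᵥ w = (p * ℓ j) ⬝ᵥ S *ᵥ w := by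
    rw [← mulVec_mulVec]
    refine Finset.sum_congr rfl fun i _ => ?_
    rw [mulVec_diagonal, Pi.mul_apply]
    ring
  rw [hmove, dotProduct_mulVec_comm hS, h.mulVec_eq, dotProduct_smul, smul_eq_mul,
    dotProduct_comm]

theorem diagonal_mul_mulVec (h : IsEigenframe S p κ ℓ) (j : ι) :
    (diagonal p * S) *ᵥ (p * ℓ j) = κ j • (p * ℓ j) := by
  rw [← mulVec_mulVec, h.mulVec_eq, mulVec_smul]
  exact congrArg _ (funext fun i => mulVec_diagonal p (ℓ j) i)

end IsEigenframe

end Eigenframe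

section CriticalPoints

variable {d : ℕ} {R : Matrix (Fin d) (Fin d) ℝ}

theorem numPosEigenvalues_eq_card (hR : R.IsHermitian) :
    numPosEigenvalues R = (Finset.univ.filter fun j => 0 < hR.eigenvalues j).card := by
  rw [numPosEigenvalues, hR.roots_charpoly_eq_eigenvalues, Multiset.filter_map, Multiset.card_map]
  rfl

theorem mem_directions {w : Fin d → ℝ} : w ∈ directions d ↔ ∑ i, w i = 0 := Iff.rfl

/-- The quadratic form of `R` is positive at some direction of the simplex. All the conditions on an
interior critical point that the theorem compares are equivalent to this one. -/
def HasPositiveDirection (R : Matrix (Fin d) (Fin d) ℝ) : Prop :=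
  ∃ w ∈ directions d, 0 < w ⬝ᵥ R *ᵥ w

theorem hasPositiveDirection_of_one_lt_numPosEigenvalues (hsymm : R.IsSymm)
    (h : 1 < numPosEigenvalues R) : HasPositiveDirection R := by
  have hR : R.IsHermitian := (conjTranspose_eq_transpose_of_trivial R).trans hsymm
  rw [numPosEigenvalues_eq_card hR] at h
  obtain ⟨j, hj, k, hk, hjk⟩ := Finset.one_lt_card.1 h
  obtain ⟨w, hw, hpos⟩ :=
    (isEigenframe_eigenvectorBasis hR).exists_dotProduct_eq_zero_of_pos_of_pos hjk
      (Finset.mem_filter.1 hj).2 (Finset.mem_filter.1 hk).2 1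
  exact ⟨w, by rwa [one_dotProduct] at hw, hpos⟩

namespace IsInteriorCritical

variable {p : Fin d → ℝ}

theorem pos (hp : IsInteriorCritical R p) (i : Fin d) : 0 < p i := hp.2 i

theorem sum_eq_one (hp : IsInteriorCritical R p) : ∑ i, p i = 1 := hp.1.1.2

theorem le_one (hp : IsInteriorCritical R p) (i : Fin d) : p i ≤ 1 := by
  rw [← hp.sum_eq_one]
  exact Finset.single_le_sum (f := p) (fun j _ => (hp.pos j).le) (Finset.mem_univ i)

theorem H_pos (hp : IsInteriorCritical R p) : 0 < H R p := hp.1.2.1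

theorem N_eq (hp : IsInteriorCritical R p) (i : Fin d) : N R p i = H R p := by
  have h : p i * N R p i / H R p = p i := congrFun hp.1.2.2 i
  rw [div_eq_iff hp.H_pos.ne'] at h
  exact mul_left_cancel₀ (hp.pos i).ne' h

theorem N_ne_zero (hp : IsInteriorCritical R p) (i : Fin d) : N R p i ≠ 0 :=
  hp.N_eq i ▸ hp.H_pos.ne'

theorem mulVec_eq (hp : IsInteriorCritical R p) : R *ᵥ p = fun _ => H R p := funext hp.N_eq

theorem dotProduct_mulVec_self (hp : IsInteriorCritical R p) (w : Fin d → ℝ) :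
    w ⬝ᵥ R *ᵥ p = H R p * ∑ i, w i := by
  rw [hp.mulVec_eq, dotProduct, ← Finset.sum_mul, mul_comm]

theorem self_dotProduct_mulVec (hsymm : R.IsSymm) (hp : IsInteriorCritical R p) (w : Fin d → ℝ) :
    p ⬝ᵥ R *ᵥ w = H R p * ∑ i, w i := by
  rw [dotProduct_mulVec_comm hsymm, hp.dotProduct_mulVec_self]

theorem eq_of_det_ne_zero (hdet : R.det ≠ 0) {q : Fin d → ℝ} (hp : IsInteriorCritical R p)
    (hq : IsInteriorCritical R q) : q = p := by
  have hinj : Function.Injective R.mulVec :=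
    mulVec_injective_of_isUnit ((isUnit_iff_isUnit_det R).2 hdet.isUnit)
  have hprop : H R p • q = H R q • p := hinj <| by
    rw [mulVec_smul, mulVec_smul, hp.mulVec_eq, hq.mulVec_eq]
    exact funext fun _ => mul_comm _ _
  have hH : H R p = H R q := by
    simpa [← Finset.mul_sum, hp.sum_eq_one, hq.sum_eq_one] using
      congrArg (fun v : Fin d → ℝ => ∑ i, v i) hprop
  rw [hH] at hprop
  exact smul_right_injective _ hq.H_pos.ne' hprop

theorem H_eq_add (hsymm : R.IsSymm) (hp : IsInteriorCritical R p) {v : Fin d → ℝ}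
    (hv : ∑ i, v i = 1) : H R v = H R p + (v - p) ⬝ᵥ R *ᵥ (v - p) := by
  have hform : ∀ u, H R u = u ⬝ᵥ R *ᵥ u := fun _ => rfl
  have hcross := hp.dotProduct_mulVec_self v
  have hcross' := hp.self_dotProduct_mulVec hsymm v
  rw [hv, mul_one] at hcross hcross'
  simp only [mulVec_sub, dotProduct_sub, sub_dotProduct, hcross, hcross', hform]
  ring

theorem not_isMaxOn_of_hasPositiveDirection (hsymm : R.IsSymm) (hp : IsInteriorCritical R p)
    (h : HasPositiveDirection R) : ¬ IsMaxOn (H R) (stdSimplex ℝ (Fin d)) p := by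
  obtain ⟨w, hw, hpos⟩ := h
  intro hmax
  have hcoord : ∀ i, ∀ᶠ t : ℝ in 𝓝 0, 0 < p i + t * w i := fun i =>
    ContinuousAt.eventually_lt (f := fun _ => 0) (by fun_prop) (by fun_prop)
      (by simpa using hp.pos i)
  obtain ⟨t, ht, ht0⟩ := (((eventually_all.2 hcoord).filter_mono nhdsWithin_le_nhds).and
    (eventually_mem_nhdsWithin (s := Set.Ioi 0))).exists
  have hsum : ∑ i, (p + t • w) i = 1 := by
    simp [Finset.sum_add_distrib, ← Finset.mul_sum, mem_directions.1 hw, hp.sum_eq_one]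
  have hle : H R (p + t • w) ≤ H R p := hmax ⟨fun i => (ht i).le, hsum⟩
  rw [hp.H_eq_add hsymm hsum, add_sub_cancel_left, mulVec_smul, dotProduct_smul, smul_dotProduct,
    smul_eq_mul, smul_eq_mul] at hle
  have : 0 < t * (t * w ⬝ᵥ R *ᵥ w) := mul_pos ht0 (mul_pos ht0 hpos)
  linarith

theorem not_isMaxOn_iff (hsymm : R.IsSymm) (hp : IsInteriorCritical R p) :
    ¬ IsMaxOn (H R) (stdSimplex ℝ (Fin d)) p ↔ HasPositiveDirection R := by
  refine ⟨fun h => ?_, hp.not_isMaxOn_of_hasPositiveDirection hsymm⟩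
  simp only [IsMaxOn, IsMaxFilter, eventually_principal, not_forall, not_le] at h
  obtain ⟨v, hv, hlt⟩ := h
  refine ⟨v - p, ?_, ?_⟩
  · simp [mem_directions, Finset.sum_sub_distrib, hv.2, hp.sum_eq_one]
  · rw [hp.H_eq_add hsymm hv.2] at hlt
    linarith

theorem one_lt_numPosEigenvalues_iff (hsymm : R.IsSymm) (hp : IsInteriorCritical R p) :
    1 < numPosEigenvalues R ↔ HasPositiveDirection R := by
  refine ⟨hasPositiveDirection_of_one_lt_numPosEigenvalues hsymm, ?_⟩
  rintro ⟨w, hw, hpos⟩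
  have hR : R.IsHermitian := (conjTranspose_eq_transpose_of_trivial R).trans hsymm
  have hframe := isEigenframe_eigenvectorBasis hR
  by_contra hle
  rw [numPosEigenvalues_eq_card hR, not_lt] at hle
  obtain ⟨j, hj⟩ : ∃ j, 0 < hR.eigenvalues j := by
    by_contra! hn
    rw [hframe.dotProduct_mulVec_eq_sum] at hpos
    exact hpos.not_ge (Finset.sum_nonpos fun j _ =>
      mul_nonpos_of_nonpos_of_nonneg (hn j) (sq_nonneg _))
  have hother : ∀ k ≠ j, hR.eigenvalues k ≤ 0 := fun k hk => by
    by_contra! hk'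
    exact hk (Finset.card_le_one.1 hle k (by simp [hk']) j (by simp [hj]))
  refine hpos.not_ge (dotProduct_mulVec_nonpos_of_orthogonal hsymm
    (fun x => hframe.dotProduct_mulVec_nonpos hother) hp.H_pos ?_)
  rw [hp.dotProduct_mulVec_self, mem_directions.1 hw, mul_zero]

end IsInteriorCritical

end CriticalPoints

section Jacobian

variable {d : ℕ} {R : Matrix (Fin d) (Fin d) ℝ} {p : Fin d → ℝ}

/-- The symmetric matrix which, multiplied by `diagonal p`, gives the derivative of `π - I` at an
interior critical point `p`. On the directions of the simplex its quadratic form is that of `R` up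
to the factor `H R p`. -/
noncomputable def jacobianForm (R : Matrix (Fin d) (Fin d) ℝ) (p : Fin d → ℝ) :
    Matrix (Fin d) (Fin d) ℝ :=
  of fun i j => R i j / H R p - 2

/-- The derivative of `π - I` at an interior critical point `p`. -/
noncomputable def jacobian (R : Matrix (Fin d) (Fin d) ℝ) (p : Fin d → ℝ) :
    Matrix (Fin d) (Fin d) ℝ :=
  diagonal p * jacobianForm R p

theorem isSymm_jacobianForm (hsymm : R.IsSymm) : (jacobianForm R p).IsSymm :=
  IsSymm.ext fun i j => by simp only [jacobianForm, of_apply, hsymm.apply i j]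

theorem jacobianForm_mulVec (w : Fin d → ℝ) (i : Fin d) :
    (jacobianForm R p *ᵥ w) i = (R *ᵥ w) i / H R p - 2 * ∑ j, w j := by
  simp only [jacobianForm, mulVec, dotProduct, of_apply, Finset.mul_sum, Finset.sum_div,
    ← Finset.sum_sub_distrib]
  exact Finset.sum_congr rfl fun j _ => by ring

theorem jacobian_mulVec (w : Fin d → ℝ) (i : Fin d) :
    (jacobian R p *ᵥ w) i = p i * (jacobianForm R p *ᵥ w) i := by
  rw [jacobian, ← mulVec_mulVec, mulVec_diagonal]

theorem dotProduct_jacobianForm_mulVec {w : Fin d → ℝ} (hw : w ∈ directions d) :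
    w ⬝ᵥ jacobianForm R p *ᵥ w = w ⬝ᵥ R *ᵥ w / H R p := by
  simp only [dotProduct, jacobianForm_mulVec, mem_directions.1 hw, mul_zero, sub_zero,
    Finset.sum_div, mul_div_assoc]

namespace IsInteriorCritical

theorem hasStrictFDerivAt_drift (hsymm : R.IsSymm) (hp : IsInteriorCritical R p) :
    HasStrictFDerivAt (drift R) (mulVecLin (jacobian R p)).toContinuousLinearMap p := by
  have hproj : ∀ i, HasStrictFDerivAt (fun v : Fin d → ℝ => v i)
      (ContinuousLinearMap.proj (R := ℝ) (φ := fun _ : Fin d => ℝ) i) p := fun i =>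
    (ContinuousLinearMap.proj (R := ℝ) (φ := fun _ : Fin d => ℝ) i).hasStrictFDerivAt
  have hN : ∀ i, HasStrictFDerivAt (fun v => N R v i)
      ((ContinuousLinearMap.proj i).comp (mulVecLin R).toContinuousLinearMap) p := fun i =>
    ((ContinuousLinearMap.proj (R := ℝ) (φ := fun _ : Fin d => ℝ) i).comp
      (mulVecLin R).toContinuousLinearMap).hasStrictFDerivAt
  have hvN := fun i => (hproj i).mul (hN i)
  have hHinv := (hasStrictDerivAt_inv hp.H_pos.ne').comp_hasStrictFDerivAt p
    (HasStrictFDerivAt.fun_sum (u := Finset.univ) fun i _ => hvN i)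
  rw [hasStrictFDerivAt_pi']
  intro i
  refine HasStrictFDerivAt.congr_fderiv (((hvN i).mul hHinv).sub (hproj i)) ?_
  ext1 w
  have hpRw : ∑ j, p j * (R *ᵥ w) j = H R p * ∑ j, w j := hp.self_dotProduct_mulVec hsymm w
  have hH := hp.H_pos
  simp [jacobian_mulVec, jacobianForm_mulVec, hp.N_eq, Finset.sum_add_distrib, hpRw,
    ← Finset.mul_sum]
  field_simp
  ring

theorem sum_jacobian_mulVec (hsymm : R.IsSymm) (hp : IsInteriorCritical R p) (w : Fin d → ℝ) :
    ∑ i, (jacobian R p *ᵥ w) i = - ∑ i, w i := by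
  have hpRw : ∑ j, p j * (R *ᵥ w) j = H R p * ∑ j, w j := hp.self_dotProduct_mulVec hsymm w
  simp only [jacobian_mulVec, jacobianForm_mulVec, mul_sub, ← mul_div_assoc,
    Finset.sum_sub_distrib, ← Finset.sum_div, hpRw, ← Finset.sum_mul, hp.sum_eq_one]
  rw [mul_div_cancel_left₀ _ hp.H_pos.ne']
  ring

theorem eq_zero_of_jacobian_mulVec_eq_zero (hsymm : R.IsSymm) (hdet : R.det ≠ 0)
    (hp : IsInteriorCritical R p) {w : Fin d → ℝ} (hw : jacobian R p *ᵥ w = 0) : w = 0 := by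
  have hsum : ∑ i, w i = 0 := by
    simpa [hw] using (hp.sum_jacobian_mulVec hsymm w).symm
  refine eq_zero_of_mulVec_eq_zero hdet (funext fun i => ?_)
  have hi := congrFun hw i
  rw [jacobian_mulVec, jacobianForm_mulVec, hsum, mul_zero, sub_zero] at hi
  simpa [(hp.pos i).ne', hp.H_pos.ne'] using hi

theorem mem_directions_of_jacobian_mulVec_eq_smul (hsymm : R.IsSymm)
    (hp : IsInteriorCritical R p) {w : Fin d → ℝ} {c : ℝ} (hc : c ≠ -1)
    (h : jacobian R p *ᵥ w = c • w) : w ∈ directions d := by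
  have hsum := hp.sum_jacobian_mulVec hsymm w
  simp only [h, Pi.smul_apply, smul_eq_mul, ← Finset.mul_sum] at hsum
  have : (c + 1) * ∑ i, w i = 0 := by linarith
  exact (mul_eq_zero.1 this).resolve_left fun h0 => hc (by linarith)

theorem exists_isEigenframe (hsymm : R.IsSymm) (hp : IsInteriorCritical R p) :
    ∃ κ ℓ, IsEigenframe (jacobianForm R p) p κ ℓ :=
  IsEigenframe.exists_of_pos (isSymm_jacobianForm hsymm) hp.pos

theorem hasPositiveDirection_of_jacobian_mulVec_eq_smul (hp : IsInteriorCritical R p)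
    {w : Fin d → ℝ} (hw : w ∈ directions d) (hw0 : w ≠ 0) {c : ℝ} (hc : 0 < c)
    (h : jacobian R p *ᵥ w = c • w) : HasPositiveDirection R := by
  have hform : w ⬝ᵥ jacobianForm R p *ᵥ w = ∑ i, c * w i ^ 2 / p i :=
    Finset.sum_congr rfl fun i _ => by
      have hi := congrFun h i
      rw [jacobian_mulVec, Pi.smul_apply, smul_eq_mul, mul_comm,
        ← eq_div_iff (hp.pos i).ne'] at hi
      rw [hi]
      ring
  have hpos : 0 < ∑ i, c * w i ^ 2 / p i := by
    obtain ⟨i, hi⟩ := Function.ne_iff.1 hw0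
    have hsq : 0 < w i ^ 2 := sq_pos_of_ne_zero hi
    have hp0 := hp.pos
    exact Finset.sum_pos' (fun k _ => by have := hp0 k; positivity)
      ⟨i, Finset.mem_univ i, by have := hp0 i; positivity⟩
  rw [← hform, dotProduct_jacobianForm_mulVec hw, div_pos_iff_of_pos_right hp.H_pos] at hpos
  exact ⟨w, hw, hpos⟩

theorem fderiv_drift (hsymm : R.IsSymm) (hp : IsInteriorCritical R p) (w : Fin d → ℝ) :
    (fderiv ℝ (drift R) p).toLinearMap w = jacobian R p *ᵥ w := by
  rw [(hp.hasStrictFDerivAt_drift hsymm).hasFDerivAt.fderiv]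
  rfl

theorem fderiv_drift_mem_directions (hsymm : R.IsSymm) (hp : IsInteriorCritical R p)
    (w : Fin d → ℝ) (hw : w ∈ directions d) :
    (fderiv ℝ (drift R) p).toLinearMap w ∈ directions d := by
  rw [hp.fderiv_drift hsymm, mem_directions, hp.sum_jacobian_mulVec hsymm, mem_directions.1 hw,
    neg_zero]

end IsInteriorCritical

theorem HasPositiveDirection.exists_pos (h : HasPositiveDirection R)
    (hp : IsInteriorCritical R p) {κ : Fin d → ℝ} {ℓ : Fin d → Fin d → ℝ}
    (hℓ : IsEigenframe (jacobianForm R p) p κ ℓ) : ∃ j, 0 < κ j := by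
  obtain ⟨w, hw, hpos⟩ := h
  by_contra! hκ
  have hform := hℓ.dotProduct_mulVec_eq_sum w
  rw [dotProduct_jacobianForm_mulVec hw] at hform
  refine (div_pos hpos hp.H_pos).not_ge (hform ▸ Finset.sum_nonpos fun j _ => ?_)
  exact mul_nonpos_of_nonpos_of_nonneg (hκ j) (sq_nonneg _)

theorem IsInteriorCritical.hasPositiveDirection_iff_hasEigenvalue (hsymm : R.IsSymm)
    (hp : IsInteriorCritical R p)
    (hW : ∀ w ∈ directions d, (fderiv ℝ (drift R) p).toLinearMap w ∈ directions d) :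
    HasPositiveDirection R ↔ ∃ c : ℝ, 0 < c ∧
      Module.End.HasEigenvalue ((fderiv ℝ (drift R) p).toLinearMap.restrict hW) c := by
  constructor
  · intro h
    obtain ⟨κ, ℓ, hℓ⟩ := hp.exists_isEigenframe hsymm
    obtain ⟨j, hj⟩ := h.exists_pos hp hℓ
    have heig : jacobian R p *ᵥ (p * ℓ j) = κ j • (p * ℓ j) := hℓ.diagonal_mul_mulVec j
    have hmem := hp.mem_directions_of_jacobian_mulVec_eq_smul hsymm (by linarith) heig
    refine ⟨κ j, hj, Module.End.hasEigenvalue_of_hasEigenvector (x := ⟨_, hmem⟩)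
      ⟨Module.End.mem_eigenspace_iff.2 (Subtype.ext ?_), fun h0 =>
        hℓ.mul_ne_zero j (congrArg Subtype.val h0)⟩⟩
    rw [LinearMap.coe_restrict_apply, hp.fderiv_drift hsymm, heig]
    rfl
  · rintro ⟨c, hc, hev⟩
    obtain ⟨⟨w, hw⟩, hwe⟩ := hev.exists_hasEigenvector
    refine hp.hasPositiveDirection_of_jacobian_mulVec_eq_smul hw
      (fun h0 => hwe.2 (Subtype.ext h0)) hc ?_
    have heig := congrArg Subtype.val hwe.apply_eq_smul
    rwa [LinearMap.coe_restrict_apply, hp.fderiv_drift hsymm] at heig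

theorem IsEigenframe.ne_zero_of_det_ne_zero (hsymm : R.IsSymm) (hdet : R.det ≠ 0)
    (hp : IsInteriorCritical R p) {κ : Fin d → ℝ} {ℓ : Fin d → Fin d → ℝ}
    (hℓ : IsEigenframe (jacobianForm R p) p κ ℓ) (j : Fin d) : κ j ≠ 0 := fun h0 =>
  hℓ.mul_ne_zero j <| hp.eq_zero_of_jacobian_mulVec_eq_zero hsymm hdet <| by
    rw [jacobian, hℓ.diagonal_mul_mulVec, h0, zero_smul]

end Jacobian

section StationaryChain

variable {ι : Type*} [Fintype ι] {P : Matrix ι ι ℝ} {m g : ι → ℝ} {c : ℝ}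

/-- The variance of `g` after one step from `i` of a chain with transition matrix `P`. -/
def stepVariance (P : Matrix ι ι ℝ) (g : ι → ℝ) (i : ι) : ℝ :=
  (P *ᵥ g ^ 2) i - (P *ᵥ g) i ^ 2

theorem stepVariance_eq_sum {i : ι} (hP : ∑ j, P i j = 1) :
    stepVariance P g i = ∑ j, P i j * (g j - (P *ᵥ g) i) ^ 2 := by
  have hexpand : ∀ j, P i j * (g j - (P *ᵥ g) i) ^ 2 =
      P i j * g j ^ 2 - 2 * (P *ᵥ g) i * (P i j * g j) + (P *ᵥ g) i ^ 2 * P i j :=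
    fun j => by ring
  have hmean : ∑ j, P i j * g j = (P *ᵥ g) i := rfl
  have hsq : ∑ j, P i j * g j ^ 2 = (P *ᵥ g ^ 2) i := rfl
  simp only [hexpand, Finset.sum_add_distrib, Finset.sum_sub_distrib, ← Finset.mul_sum, hP, hmean,
    hsq, stepVariance]
  ring

theorem stepVariance_nonneg {i : ι} (hnonneg : ∀ j, 0 ≤ P i j) (hP : ∑ j, P i j = 1) :
    0 ≤ stepVariance P g i := by
  rw [stepVariance_eq_sum hP]
  exact Finset.sum_nonneg fun j _ => mul_nonneg (hnonneg j) (sq_nonneg _)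

theorem stepVariance_smul (c : ℝ) (i : ι) :
    stepVariance P (c • g) i = c ^ 2 * stepVariance P g i := by
  simp only [stepVariance, smul_pow, mulVec_smul, Pi.smul_apply, smul_eq_mul]
  ring

theorem dotProduct_stepVariance (hm : m ᵥ* P = m) (h : P *ᵥ g = c • g) :
    m ⬝ᵥ stepVariance P g = (1 - c ^ 2) * (m ⬝ᵥ g ^ 2) := by
  have hvar : stepVariance P g = P *ᵥ g ^ 2 - c ^ 2 • g ^ 2 := by
    ext i
    simp only [stepVariance, h, Pi.sub_apply, Pi.smul_apply, Pi.pow_apply, smul_eq_mul, mul_pow]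
  rw [hvar, dotProduct_sub, dotProduct_mulVec, hm, dotProduct_smul, smul_eq_mul]
  ring

theorem sq_le_one_of_mulVec_eq_smul (hnonneg : ∀ i j, 0 ≤ P i j) (hP : ∀ i, ∑ j, P i j = 1)
    (hm0 : 0 ≤ m) (hm : m ᵥ* P = m) (hg : 0 < m ⬝ᵥ g ^ 2) (h : P *ᵥ g = c • g) :
    c ^ 2 ≤ 1 := by
  have hvar : 0 ≤ m ⬝ᵥ stepVariance P g :=
    dotProduct_nonneg_of_nonneg hm0 fun i => stepVariance_nonneg (hnonneg i) (hP i)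
  rw [dotProduct_stepVariance hm h] at hvar
  linarith [nonneg_of_mul_nonneg_left hvar hg]

theorem exists_stepVariance_pos (hm0 : 0 ≤ m) (hm : m ᵥ* P = m) (hg : 0 < m ⬝ᵥ g ^ 2)
    (h : P *ᵥ g = c • g) (hc : c ^ 2 < 1) : ∃ i, 0 < stepVariance P g i := by
  by_contra! hle
  have hpos : 0 < m ⬝ᵥ stepVariance P g := by
    rw [dotProduct_stepVariance hm h]
    exact mul_pos (by linarith) hg
  exact hpos.not_ge <|
    Finset.sum_nonpos fun i _ => mul_nonpos_of_nonneg_of_nonpos (hm0 i) (hle i)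

theorem eq_of_mulVec_eq_self (hnonneg : ∀ i j, 0 ≤ P i j) (hP : ∀ i, ∑ j, P i j = 1)
    (hm0 : ∀ i, 0 < m i) (hm : m ᵥ* P = m) (h : P *ᵥ g = g) {i j : ι} (hij : P i j ≠ 0) :
    g i = g j := by
  have hvar : m ⬝ᵥ stepVariance P g = 0 := by
    rw [dotProduct_stepVariance hm (h.trans (one_smul ℝ g).symm)]
    ring
  have hi : stepVariance P g i = 0 := by
    have hterm := (Finset.sum_eq_zero_iff_of_nonneg fun i _ =>
      mul_nonneg (hm0 i).le (stepVariance_nonneg (hnonneg i) (hP i))).1 hvar i (Finset.mem_univ i)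
    exact (mul_eq_zero.1 hterm).resolve_left (hm0 i).ne'
  rw [stepVariance_eq_sum (hP i), h] at hi
  have hj := (Finset.sum_eq_zero_iff_of_nonneg fun j _ =>
    mul_nonneg (hnonneg i j) (sq_nonneg _)).1 hi j (Finset.mem_univ j)
  have hsub := pow_eq_zero_iff two_ne_zero |>.1 ((mul_eq_zero.1 hj).resolve_left hij)
  exact (sub_eq_zero.1 hsub).symm

theorem dotProduct_of_const (hm : ∑ i, m i = 1) (hg : ∀ i j, g i = g j) (i : ι) :
    m ⬝ᵥ g = g i := by
  simp only [dotProduct, fun j => hg j i, ← Finset.sum_mul, hm, one_mul]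

variable [DecidableEq ι] {p : ι → ℝ}

/-- The matrix `1 - P` made invertible by adding the rank-one matrix whose rows are all `p`; its
inverse is the fundamental matrix of a chain with transition matrix `P`. -/
def perturbedGenerator (P : Matrix ι ι ℝ) (p : ι → ℝ) : Matrix ι ι ℝ :=
  1 - P + of fun _ => p

/-- The fundamental matrix of a chain with transition matrix `P`, with reference vector `p`, which
need not be stationary for `P`. It solves the Poisson equation of the chain. -/
noncomputable def fundamentalMatrix (P : Matrix ι ι ℝ) (p : ι → ℝ) : Matrix ι ι ℝ :=
  (perturbedGenerator P p)⁻¹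

theorem perturbedGenerator_mulVec (x : ι → ℝ) :
    perturbedGenerator P p *ᵥ x = x - P *ᵥ x + fun _ => p ⬝ᵥ x := by
  rw [perturbedGenerator, add_mulVec, sub_mulVec, one_mulVec]
  rfl

theorem vecMul_perturbedGenerator (hm : m ᵥ* P = m) (hsum : ∑ i, m i = 1) :
    m ᵥ* perturbedGenerator P p = p := by
  rw [perturbedGenerator, vecMul_add, vecMul_sub, vecMul_one, hm, sub_self, zero_add]
  ext k
  simp only [vecMul, dotProduct, of_apply, ← Finset.sum_mul, hsum, one_mul]

theorem fundamentalMatrix_sub_mul (hm : m ᵥ* P = m) (hsum : ∑ i, m i = 1)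
    (hdet : (perturbedGenerator P p).det ≠ 0) :
    fundamentalMatrix P p - P * fundamentalMatrix P p = 1 - of fun _ => m := by
  have hinv : perturbedGenerator P p * fundamentalMatrix P p = 1 :=
    mul_nonsing_inv _ hdet.isUnit
  have hp : p ᵥ* fundamentalMatrix P p = m := by
    calc p ᵥ* fundamentalMatrix P p
        = m ᵥ* perturbedGenerator P p ᵥ* fundamentalMatrix P p := by
          rw [vecMul_perturbedGenerator hm hsum]
      _ = m := by rw [vecMul_vecMul, hinv, vecMul_one]
  have hrows : (of fun _ => p : Matrix ι ι ℝ) * fundamentalMatrix P p = of fun _ => m :=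
    ext fun _ j => congrFun hp j
  rw [perturbedGenerator, add_mul, sub_mul, one_mul, hrows] at hinv
  rw [← hinv, add_sub_cancel_right]

theorem det_perturbedGenerator_ne_zero (hp : p ᵥ* P = p) (hsum : ∑ i, p i = 1)
    (herg : ∀ x, P *ᵥ x = x → ∀ i j, x i = x j) : (perturbedGenerator P p).det ≠ 0 := by
  intro h0
  obtain ⟨x, hx, hPx⟩ := exists_mulVec_eq_zero_iff.2 h0
  have hpx : p ⬝ᵥ x = 0 := by
    have h := congrArg (p ⬝ᵥ ·) hPx
    simpa only [dotProduct_mulVec, vecMul_perturbedGenerator hp hsum, dotProduct_zero] using h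
  rw [perturbedGenerator_mulVec, hpx] at hPx
  have hfix : P *ᵥ x = x := (sub_eq_zero.1 ((add_zero _).symm.trans hPx)).symm
  exact hx <| funext fun i => by rw [← dotProduct_of_const hsum (herg x hfix) i, hpx, Pi.zero_apply]

theorem fundamentalMatrix_mulVec_of_mulVec_eq_smul (hdet : (perturbedGenerator P p).det ≠ 0)
    (h : P *ᵥ g = c • g) (hpg : p ⬝ᵥ g = 0) (hc : c ≠ 1) :
    fundamentalMatrix P p *ᵥ g = (1 - c)⁻¹ • g := by
  have hgen : perturbedGenerator P p *ᵥ g = (1 - c) • g := by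
    rw [perturbedGenerator_mulVec, h, hpg, sub_smul, one_smul]
    exact add_zero _
  have hinv : fundamentalMatrix P p *ᵥ (perturbedGenerator P p *ᵥ g) = g := by
    rw [mulVec_mulVec, fundamentalMatrix, nonsing_inv_mul _ hdet.isUnit, one_mulVec]
  rw [hgen, mulVec_smul] at hinv
  rw [eq_inv_smul_iff₀ (sub_ne_zero.2 hc.symm), hinv]

end StationaryChain

section MatrixCalculus

variable {ι E : Type*} [Fintype ι] [DecidableEq ι] [NormedAddCommGroup E] [NormedSpace ℝ E]
  {A : E → Matrix ι ι ℝ} {x : E} {n : WithTop ℕ∞}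

theorem contDiffAt_det (h : ∀ i j, ContDiffAt ℝ n (fun v => A v i j) x) :
    ContDiffAt ℝ n (fun v => (A v).det) x := by
  simp only [det_apply]
  exact ContDiffAt.sum fun σ _ => (contDiffAt_prod fun i _ => h _ _).const_smul _

theorem contDiffAt_inv_apply (h : ∀ i j, ContDiffAt ℝ n (fun v => A v i j) x)
    (hdet : (A x).det ≠ 0) (i j : ι) : ContDiffAt ℝ n (fun v => (A v)⁻¹ i j) x := by
  simp only [inv_def, Ring.inverse_eq_inv', Matrix.smul_apply, adjugate_apply, smul_eq_mul]
  refine ((contDiffAt_det h).inv hdet).mul (contDiffAt_det fun a b => ?_)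
  by_cases hab : a = j
  · subst hab
    simpa only [updateRow_self] using contDiffAt_const
  · simpa only [updateRow_ne hab] using h a b

end MatrixCalculus

section BoundedEntries

variable {ι E : Type*} [Finite ι] [NormedAddCommGroup E] [NormedSpace ℝ E]
  {A : E → ι → ι → ℝ} {x : E}

theorem exists_abs_le_of_contDiffAt (h : ∀ i j, ContDiffAt ℝ 1 (fun v => A v i j) x) :
    ∃ C, 0 < C ∧ ∀ᶠ v in 𝓝 x, ∀ i j, |A v i j| ≤ C := by
  cases nonempty_fintype ι
  have hA : ContDiffAt ℝ 1 A x := contDiffAt_pi.2 fun i => contDiffAt_pi.2 (h i)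
  refine ⟨‖A x‖ + 1, by positivity, ?_⟩
  filter_upwards [hA.continuousAt.norm.eventually_lt_const (lt_add_one ‖A x‖)] with v hv i j
  exact ((norm_le_pi_norm (A v i) j).trans (norm_le_pi_norm (A v) i)).trans hv.le

theorem exists_abs_sub_le_of_contDiffAt (h : ∀ i j, ContDiffAt ℝ 1 (fun v => A v i j) x) :
    ∃ C, 0 ≤ C ∧ ∃ t ∈ 𝓝 x, ∀ v ∈ t, ∀ v' ∈ t, ∀ i j,
      |A v i j - A v' i j| ≤ C * ‖v - v'‖ := by
  cases nonempty_fintype ι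
  have hA : ContDiffAt ℝ 1 A x := contDiffAt_pi.2 fun i => contDiffAt_pi.2 (h i)
  obtain ⟨K, t, ht, hK⟩ := hA.exists_lipschitzOnWith
  refine ⟨K, K.coe_nonneg, t, ht, fun v hv v' hv' i j => ?_⟩
  exact ((norm_le_pi_norm ((A v - A v') i) j).trans (norm_le_pi_norm (A v - A v') i)).trans
    (hK.norm_sub_le hv hv')

end BoundedEntries

section FrozenChain

variable {d : ℕ} {R : Matrix (Fin d) (Fin d) ℝ} {p v : Fin d → ℝ}

/-- The transition matrix of the process with its weights frozen at `v`. -/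
noncomputable def transition (R : Matrix (Fin d) (Fin d) ℝ) (v : Fin d → ℝ) :
    Matrix (Fin d) (Fin d) ℝ :=
  of fun i j => R i j * v j / N R v i

/-- The fundamental matrix of the chain frozen at `v`, with the reference vector `p` kept fixed as
`v` varies. -/
noncomputable def fundamental (R : Matrix (Fin d) (Fin d) ℝ) (p v : Fin d → ℝ) :
    Matrix (Fin d) (Fin d) ℝ :=
  fundamentalMatrix (transition R v) p

/-- The conditional expectation of the fundamental matrix after one step of the frozen chain. -/
noncomputable def fundamentalStep (R : Matrix (Fin d) (Fin d) ℝ) (p v : Fin d → ℝ) :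
    Matrix (Fin d) (Fin d) ℝ :=
  transition R v * fundamental R p v

/-- Ergodicity of the chain frozen at `p`: its harmonic functions are constant. -/
def IsErgodicAt (R : Matrix (Fin d) (Fin d) ℝ) (p : Fin d → ℝ) : Prop :=
  ∀ x : Fin d → ℝ, transition R p *ᵥ x = x → ∀ i j, x i = x j

theorem sum_transition {i : Fin d} (h : N R v i ≠ 0) : ∑ j, transition R v i j = 1 := by
  simp only [transition, of_apply, ← Finset.sum_div]
  exact div_self h

theorem stat_vecMul_transition (hsymm : R.IsSymm) (h : ∀ i, N R v i ≠ 0) :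
    stat R v ᵥ* transition R v = stat R v := by
  ext j
  have hbalance : ∀ i, stat R v i * transition R v i j = R j i * v i * (v j / H R v) := fun i => by
    have := h i
    simp only [stat, transition, of_apply, hsymm.apply j i]
    field_simp
  calc ∑ i, stat R v i * transition R v i j
      = N R v j * (v j / H R v) := by simp only [hbalance, ← Finset.sum_mul, N]
    _ = stat R v j := by rw [stat]; ring

theorem sum_stat (h : H R v ≠ 0) : ∑ j, stat R v j = 1 := by
  simp only [stat, ← Finset.sum_div]
  exact div_self h

theorem fundamental_sub_fundamentalStep (hsymm : R.IsSymm) (hN : ∀ i, N R v i ≠ 0)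
    (hH : H R v ≠ 0) (hdet : (perturbedGenerator (transition R v) p).det ≠ 0) (i j : Fin d) :
    fundamental R p v i j - fundamentalStep R p v i j = (if i = j then 1 else 0) - stat R v j :=
  congrFun (congrFun
    (fundamentalMatrix_sub_mul (stat_vecMul_transition hsymm hN) (sum_stat hH) hdet) i) j

theorem contDiff_N (R : Matrix (Fin d) (Fin d) ℝ) (i : Fin d) :
    ContDiff ℝ 1 (fun v => N R v i) := by
  unfold N
  fun_prop

theorem continuous_H (R : Matrix (Fin d) (Fin d) ℝ) : Continuous (H R) := by
  unfold H
  exact continuous_finsetSum _ fun i _ => (continuous_apply i).mul (contDiff_N R i).continuous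

namespace IsInteriorCritical

theorem contDiffAt_transition (hp : IsInteriorCritical R p) (i j : Fin d) :
    ContDiffAt ℝ 1 (fun v => transition R v i j) p := by
  simp only [transition, of_apply]
  refine ContDiffAt.div ?_ (contDiff_N R i).contDiffAt (hp.N_ne_zero i)
  fun_prop

theorem contDiffAt_perturbedGenerator (hp : IsInteriorCritical R p) (i j : Fin d) :
    ContDiffAt ℝ 1 (fun v => perturbedGenerator (transition R v) p i j) p := by
  simp only [perturbedGenerator, Matrix.add_apply, Matrix.sub_apply, of_apply]
  exact (contDiffAt_const.sub (hp.contDiffAt_transition i j)).add contDiffAt_const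

theorem vecMul_transition (hsymm : R.IsSymm) (hp : IsInteriorCritical R p) :
    p ᵥ* transition R p = p := by
  have h := stat_vecMul_transition hsymm hp.N_ne_zero
  rwa [hp.1.2.2] at h

theorem transition_nonneg (hnonneg : ∀ i j, 0 ≤ R i j) (hp : IsInteriorCritical R p)
    (i j : Fin d) : 0 ≤ transition R p i j := by
  rw [transition, of_apply, hp.N_eq]
  exact div_nonneg (mul_nonneg (hnonneg i j) (hp.pos j).le) hp.H_pos.le

theorem det_perturbedGenerator_ne_zero (hsymm : R.IsSymm) (hp : IsInteriorCritical R p)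
    (herg : IsErgodicAt R p) : (perturbedGenerator (transition R p) p).det ≠ 0 :=
  VRRW.det_perturbedGenerator_ne_zero (hp.vecMul_transition hsymm) hp.sum_eq_one herg

theorem contDiffAt_fundamental (hsymm : R.IsSymm) (hp : IsInteriorCritical R p)
    (herg : IsErgodicAt R p) (i j : Fin d) :
    ContDiffAt ℝ 1 (fun v => fundamental R p v i j) p :=
  contDiffAt_inv_apply hp.contDiffAt_perturbedGenerator
    (hp.det_perturbedGenerator_ne_zero hsymm herg) i j

theorem contDiffAt_fundamentalStep (hsymm : R.IsSymm) (hp : IsInteriorCritical R p)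
    (herg : IsErgodicAt R p) (i j : Fin d) :
    ContDiffAt ℝ 1 (fun v => fundamentalStep R p v i j) p := by
  simp only [fundamentalStep, mul_apply]
  exact ContDiffAt.sum fun k _ =>
    (hp.contDiffAt_transition i k).mul (hp.contDiffAt_fundamental hsymm herg k j)

theorem dotProduct_eigenframe_eq_zero (hsymm : R.IsSymm) (hp : IsInteriorCritical R p)
    {κ : Fin d → ℝ} {ℓ : Fin d → Fin d → ℝ} (hℓ : IsEigenframe (jacobianForm R p) p κ ℓ)
    {j : Fin d} (hj : κ j ≠ -1) : p ⬝ᵥ ℓ j = 0 :=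
  hp.mem_directions_of_jacobian_mulVec_eq_smul hsymm hj (hℓ.diagonal_mul_mulVec j)

theorem transition_mulVec_eigenframe (hsymm : R.IsSymm) (hp : IsInteriorCritical R p)
    {κ : Fin d → ℝ} {ℓ : Fin d → Fin d → ℝ} (hℓ : IsEigenframe (jacobianForm R p) p κ ℓ)
    {j : Fin d} (hj : κ j ≠ -1) : transition R p *ᵥ ℓ j = κ j • ℓ j := by
  ext i
  have hsum : ∑ k, (p * ℓ j) k = 0 := hp.dotProduct_eigenframe_eq_zero hsymm hℓ hj
  rw [← hℓ.mulVec_eq, jacobianForm_mulVec, hsum, mul_zero, sub_zero]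
  simp only [transition, mulVec, dotProduct, of_apply, Finset.sum_div, hp.N_eq, Pi.mul_apply]
  exact Finset.sum_congr rfl fun k _ => by ring

theorem exists_stepVariance_fundamental_pos (hsymm : R.IsSymm) (hnonneg : ∀ i j, 0 ≤ R i j)
    (hp : IsInteriorCritical R p) (herg : IsErgodicAt R p) {ℓ : Fin d → ℝ} {c : ℝ} (hc : 0 < c)
    (hsum : p ⬝ᵥ ℓ = 0) (hnorm : p ⬝ᵥ ℓ ^ 2 = 1) (h : transition R p *ᵥ ℓ = c • ℓ) :
    ∃ i, 0 < stepVariance (transition R p) (fundamental R p p *ᵥ ℓ) i := by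
  have hp0 : 0 ≤ p := fun i => (hp.pos i).le
  have hstat := hp.vecMul_transition hsymm
  have hpos : 0 < p ⬝ᵥ ℓ ^ 2 := hnorm ▸ one_pos
  have hle : c ^ 2 ≤ 1 := sq_le_one_of_mulVec_eq_smul (hp.transition_nonneg hnonneg)
    (fun i => sum_transition (hp.N_ne_zero i)) hp0 hstat hpos h
  have hne : c ≠ 1 := by
    rintro rfl
    have hconst := herg ℓ (by rwa [one_smul] at h)
    have hzero : ℓ = 0 := funext fun i =>
      (dotProduct_of_const hp.sum_eq_one hconst i).symm.trans hsum
    simp [hzero] at hnorm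
  have hlt : c ^ 2 < 1 := lt_of_le_of_ne hle fun h1 => hne (by nlinarith)
  obtain ⟨i, hi⟩ := exists_stepVariance_pos hp0 hstat hpos h hlt
  refine ⟨i, ?_⟩
  rw [fundamental, fundamentalMatrix_mulVec_of_mulVec_eq_smul
    (hp.det_perturbedGenerator_ne_zero hsymm herg) h hsum hne, stepVariance_smul]
  have := sub_ne_zero.2 hne.symm
  positivity

end IsInteriorCritical

end FrozenChain

section LocalEstimates

variable {d : ℕ} {R : Matrix (Fin d) (Fin d) ℝ} {p ℓ : Fin d → ℝ}

/-- What the frozen chains look like, uniformly for weights in the ball of radius `δ` about `p`: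
their fundamental matrices are bounded by `C` and solve the Poisson equation, the noise in the
direction `ℓ` has variance at least `σ` at the state `i₀`, and the drift is linear up to a relative
error `ε`. -/
structure LocalEstimates (R : Matrix (Fin d) (Fin d) ℝ) (p ℓ : Fin d → ℝ) (C σ : ℝ) (i₀ : Fin d)
    (ε δ : ℝ) : Prop where
  pos : 0 < δ
  le : δ ≤ p i₀ / 10
  abs_fundamental_le : ∀ v ∈ Metric.ball p δ, ∀ i j, |fundamental R p v i j| ≤ C
  abs_fundamentalStep_le : ∀ v ∈ Metric.ball p δ, ∀ i j, |fundamentalStep R p v i j| ≤ C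
  poisson : ∀ v ∈ Metric.ball p δ, ∀ i j,
    fundamental R p v i j - fundamentalStep R p v i j = (if i = j then 1 else 0) - stat R v j
  le_stepVariance : ∀ v ∈ Metric.ball p δ,
    σ ≤ stepVariance (transition R v) (fundamental R p v *ᵥ ℓ) i₀
  lipschitz : ∀ v ∈ Metric.ball p δ, ∀ v' ∈ Metric.ball p δ, ∀ i j,
    |fundamentalStep R p v i j - fundamentalStep R p v' i j| ≤ C * ‖v - v'‖
  linearize : ∀ v ∈ Metric.ball p δ, ∀ v' ∈ Metric.ball p δ,
    ‖drift R v - drift R v' - jacobian R p *ᵥ (v - v')‖ ≤ ε * ‖v - v'‖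

namespace IsInteriorCritical

theorem eventually_poisson (hsymm : R.IsSymm) (hp : IsInteriorCritical R p)
    (herg : IsErgodicAt R p) : ∀ᶠ v in 𝓝 p, ∀ i j,
      fundamental R p v i j - fundamentalStep R p v i j =
        (if i = j then 1 else 0) - stat R v j := by
  have hN : ∀ᶠ v in 𝓝 p, ∀ i, N R v i ≠ 0 := eventually_all.2 fun i =>
    (contDiff_N R i).continuous.continuousAt.eventually_ne (hp.N_ne_zero i)
  have hH : ∀ᶠ v in 𝓝 p, H R v ≠ 0 := (continuous_H R).continuousAt.eventually_ne hp.H_pos.ne'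
  have hdet : ∀ᶠ v in 𝓝 p, (perturbedGenerator (transition R v) p).det ≠ 0 :=
    (contDiffAt_det hp.contDiffAt_perturbedGenerator).continuousAt.eventually_ne
      (hp.det_perturbedGenerator_ne_zero hsymm herg)
  filter_upwards [hN, hH, hdet] with v hNv hHv hdetv
  exact fundamental_sub_fundamentalStep hsymm hNv hHv hdetv

theorem continuousAt_stepVariance_fundamental (hsymm : R.IsSymm) (hp : IsInteriorCritical R p)
    (herg : IsErgodicAt R p) (ℓ : Fin d → ℝ) (i : Fin d) :
    ContinuousAt (fun v => stepVariance (transition R v) (fundamental R p v *ᵥ ℓ) i) p := by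
  have hF : ∀ j k, ContinuousAt (fun v => fundamental R p v j k) p := fun j k =>
    (hp.contDiffAt_fundamental hsymm herg j k).continuousAt
  have hP : ∀ j, ContinuousAt (fun v => transition R v i j) p := fun j =>
    (hp.contDiffAt_transition i j).continuousAt
  simp only [stepVariance, mulVec, dotProduct, Pi.pow_apply]
  fun_prop

theorem exists_localEstimates (hsymm : R.IsSymm) (hp : IsInteriorCritical R p)
    (herg : IsErgodicAt R p) {i₀ : Fin d}
    (hvar : 0 < stepVariance (transition R p) (fundamental R p p *ᵥ ℓ) i₀) :
    ∃ C σ : ℝ, 0 < σ ∧ ∀ ε > 0, ∃ δ, LocalEstimates R p ℓ C σ i₀ ε δ := by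
  obtain ⟨C₁, hC₁, hfund⟩ := exists_abs_le_of_contDiffAt (hp.contDiffAt_fundamental hsymm herg)
  obtain ⟨C₂, hC₂, hstep⟩ := exists_abs_le_of_contDiffAt (hp.contDiffAt_fundamentalStep hsymm herg)
  obtain ⟨C₃, hC₃, t, ht, hlip⟩ :=
    exists_abs_sub_le_of_contDiffAt (hp.contDiffAt_fundamentalStep hsymm herg)
  have hvarv := (hp.continuousAt_stepVariance_fundamental hsymm herg ℓ i₀).eventually_const_lt
    (half_lt_self hvar)
  refine ⟨C₁ + C₂ + C₃, _, half_pos hvar, fun ε hε => ?_⟩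
  obtain ⟨u, hu, hlin⟩ := (hp.hasStrictFDerivAt_drift hsymm).approximates_deriv_on_nhds
    (c := ⟨ε, hε.le⟩) (Or.inr (by exact hε))
  obtain ⟨δ, hδ, hball⟩ := Metric.eventually_nhds_iff_ball.1
    ((hp.eventually_poisson hsymm herg).and <| hfund.and <| hstep.and <| hvarv.and <|
      Eventually.and ht hu)
  have hball' : ∀ v ∈ Metric.ball p (min δ (p i₀ / 10)), _ := fun v hv =>
    hball v (Metric.ball_subset_ball (min_le_left _ _) hv)
  exact ⟨min δ (p i₀ / 10),
    { pos := lt_min hδ (div_pos (hp.pos i₀) (by norm_num))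
      le := min_le_right _ _
      abs_fundamental_le := fun v hv i j => ((hball' v hv).2.1 i j).trans (by linarith)
      abs_fundamentalStep_le := fun v hv i j => ((hball' v hv).2.2.1 i j).trans (by linarith)
      poisson := fun v hv => (hball' v hv).1
      le_stepVariance := fun v hv => (hball' v hv).2.2.2.1.le
      lipschitz := fun v hv v' hv' i j =>
        (hlip v (hball' v hv).2.2.2.2.1 v' (hball' v' hv').2.2.2.2.1 i j).trans
          (mul_le_mul_of_nonneg_right (by linarith) (norm_nonneg _))
      linearize := fun v hv v' hv' => hlin v (hball' v hv).2.2.2.2.2 v' (hball' v' hv').2.2.2.2.2 }⟩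

end IsInteriorCritical

end LocalEstimates

section Perron

/-- The product of the growth factors `1 + κ γ_i` for `a ≤ i < b`. -/
noncomputable def growth (κ : ℝ) (γ : ℕ → ℝ) (a b : ℕ) : ℝ := ∏ i ∈ Finset.Ico a b, (1 + κ * γ i)

theorem growth_self (κ : ℝ) (γ : ℕ → ℝ) (a : ℕ) : growth κ γ a a = 1 := by simp [growth]

theorem growth_succ (κ : ℝ) (γ : ℕ → ℝ) {a b : ℕ} (h : a ≤ b) :
    growth κ γ a (b + 1) = growth κ γ a b * (1 + κ * γ b) :=
  Finset.prod_Ico_succ_top h _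

variable {κ : ℝ} {γ : ℕ → ℝ}

theorem eq_growth_mul_add_sum {w f : ℕ → ℝ} {n : ℕ}
    (h : ∀ k, n ≤ k → w (k + 1) = w k + γ k * (κ * w k + f k)) {k : ℕ} (hk : n ≤ k) :
    w k = growth κ γ n k * w n + ∑ l ∈ Finset.Ico n k, growth κ γ (l + 1) k * γ l * f l := by
  induction k, hk using Nat.le_induction with
  | base => simp [growth_self]
  | succ k hk ih =>
    have hfactor : ∑ l ∈ Finset.Ico n k, growth κ γ (l + 1) (k + 1) * γ l * f l
        = (1 + κ * γ k) * ∑ l ∈ Finset.Ico n k, growth κ γ (l + 1) k * γ l * f l := by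
      rw [Finset.mul_sum]
      refine Finset.sum_congr rfl fun l hl => ?_
      rw [growth_succ _ _ (Finset.mem_Ico.1 hl).2]
      ring
    rw [Finset.sum_Ico_succ_top hk, hfactor, growth_self, growth_succ _ _ hk, h k hk]
    linear_combination (1 + κ * γ k) * ih

theorem eq_inv_growth_mul_sub_sum {w f : ℕ → ℝ} {n : ℕ} (hpos : ∀ k, n ≤ k → 0 < 1 + κ * γ k)
    (h : ∀ k, n ≤ k → w (k + 1) = w k + γ k * (κ * w k + f k)) {m : ℕ} (hm : n ≤ m) :
    w n = (growth κ γ n m)⁻¹ * w m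
      - ∑ l ∈ Finset.Ico n m, (growth κ γ n (l + 1))⁻¹ * γ l * f l := by
  induction m, hm using Nat.le_induction with
  | base => simp [growth_self]
  | succ m hm ih =>
    have hm' := (hpos m hm).ne'
    rw [Finset.sum_Ico_succ_top hm, growth_succ _ _ hm, h m hm, mul_inv]
    have : (growth κ γ n m)⁻¹ * (1 + κ * γ m)⁻¹ * (w m + γ m * (κ * w m + f m))
        = (growth κ γ n m)⁻¹ * w m
          + (growth κ γ n m)⁻¹ * (1 + κ * γ m)⁻¹ * γ m * f m := by
      field_simp
      ring
    linear_combination ih - this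

theorem growth_pos {n : ℕ} (hpos : ∀ k, n ≤ k → 0 < 1 + κ * γ k) {a : ℕ} (ha : n ≤ a) (b : ℕ) :
    0 < growth κ γ a b :=
  Finset.prod_pos fun i hi => hpos i (ha.trans (Finset.mem_Ico.1 hi).1)

theorem growth_le_one {n : ℕ} (hκ : κ ≤ 0) (hγ : ∀ k, 0 ≤ γ k)
    (hpos : ∀ k, n ≤ k → 0 < 1 + κ * γ k) {a : ℕ} (ha : n ≤ a) (b : ℕ) : growth κ γ a b ≤ 1 :=
  Finset.prod_le_one (fun i hi => (hpos i (ha.trans (Finset.mem_Ico.1 hi).1)).le) fun i _ => by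
    nlinarith [hγ i]

theorem one_le_growth (hκ : 0 ≤ κ) (hγ : ∀ k, 0 ≤ γ k) (a b : ℕ) : 1 ≤ growth κ γ a b :=
  Finset.one_le_prod fun i _ => by nlinarith [mul_nonneg hκ (hγ i)]

theorem abs_mul_sum_growth_le {n : ℕ} (hκ : κ ≤ 0) (hpos : ∀ k, n ≤ k → 0 < 1 + κ * γ k)
    {k : ℕ} (hk : n ≤ k) : |κ| * ∑ l ∈ Finset.Ico n k, growth κ γ (l + 1) k * γ l ≤ 1 := by
  induction k, hk using Nat.le_induction with
  | base => simp
  | succ k hk ih =>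
    have hfactor : ∑ l ∈ Finset.Ico n k, growth κ γ (l + 1) (k + 1) * γ l
        = (1 + κ * γ k) * ∑ l ∈ Finset.Ico n k, growth κ γ (l + 1) k * γ l := by
      rw [Finset.mul_sum]
      refine Finset.sum_congr rfl fun l hl => ?_
      rw [growth_succ _ _ (Finset.mem_Ico.1 hl).2]
      ring
    rw [Finset.sum_Ico_succ_top hk, hfactor, growth_self]
    have hfac_pos := hpos k hk
    have hscaled := mul_le_mul_of_nonneg_left ih hfac_pos.le
    rw [abs_of_nonpos hκ] at hscaled ⊢
    linarith

theorem mul_sum_inv_growth_le {n : ℕ} (hκ : 0 ≤ κ) (hγ : ∀ k, 0 ≤ γ k) {m : ℕ} (hm : n ≤ m) :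
    κ * ∑ l ∈ Finset.Ico n m, (growth κ γ n (l + 1))⁻¹ * γ l ≤ 1 := by
  have hpos : ∀ k, n ≤ k → 0 < 1 + κ * γ k := fun k _ => by nlinarith [hγ k]
  have hP : 0 < growth κ γ n m := growth_pos hpos le_rfl m
  have h : κ * ∑ l ∈ Finset.Ico n m, (growth κ γ n (l + 1))⁻¹ * γ l
      = 1 - (growth κ γ n m)⁻¹ := by
    have := eq_inv_growth_mul_sub_sum (w := fun _ => 1) (f := fun _ => -κ) hpos
      (fun k _ => by ring) hm
    rw [← Finset.sum_mul] at this
    linarith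
  rw [h]
  have := inv_pos.2 hP
  linarith

theorem one_add_sum_le_growth (hκ : 0 ≤ κ) (hγ : ∀ k, 0 ≤ γ k) (n m : ℕ) :
    1 + κ * ∑ l ∈ Finset.Ico n m, γ l ≤ growth κ γ n m := by
  rcases le_or_gt n m with h | h
  · induction m, h using Nat.le_induction with
    | base => simp [growth_self]
    | succ m h ih =>
      rw [Finset.sum_Ico_succ_top h, growth_succ _ _ h]
      nlinarith [mul_nonneg hκ (hγ m), one_le_growth hκ hγ n m]
  · simp [growth, Finset.Ico_eq_empty_of_le h.le]

theorem tendsto_inv_growth {n : ℕ} (hκ : 0 < κ) (hγ : ∀ k, 0 ≤ γ k)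
    (hdiv : Tendsto (fun m => ∑ l ∈ Finset.Ico n m, γ l) atTop atTop) :
    Tendsto (fun m => (growth κ γ n m)⁻¹) atTop (𝓝 0) := by
  refine Tendsto.inv_tendsto_atTop ?_
  refine tendsto_atTop_mono (one_add_sum_le_growth hκ.le hγ n) ?_
  exact tendsto_atTop_add_const_left _ _ (hdiv.const_mul_atTop hκ)

variable {Ω : Type*} [MeasurableSpace Ω] {ν : Measure Ω}

theorem integral_add_sq_le {f g : Ω → ℝ} (hf : MemLp f 2 ν) (hg : MemLp g 2 ν) :
    ∫ ω, (f ω + g ω) ^ 2 ∂ν ≤ 2 * ∫ ω, f ω ^ 2 ∂ν + 2 * ∫ ω, g ω ^ 2 ∂ν := by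
  rw [← integral_const_mul, ← integral_const_mul,
    ← integral_add (hf.integrable_sq.const_mul 2) (hg.integrable_sq.const_mul 2)]
  refine integral_mono (hf.add hg).integrable_sq
    ((hf.integrable_sq.const_mul 2).add (hg.integrable_sq.const_mul 2)) fun ω => ?_
  simp only
  nlinarith [sq_nonneg (f ω - g ω)]

theorem memLp_weighted_sum {ι : Type*} {s : Finset ι} {α : ι → ℝ} {f : ι → Ω → ℝ}
    (hf : ∀ l, MemLp (f l) 2 ν) :
    MemLp (fun ω => ∑ l ∈ s, α l * f l ω) 2 ν :=
  memLp_finsetSum s fun l _ => (hf l).const_mul (α l)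

theorem integral_sq_weighted_sum_le {ι : Type*} {s : Finset ι} {α : ι → ℝ} (hα : ∀ l ∈ s, 0 ≤ α l)
    {L : ℝ} (hL : ∑ l ∈ s, α l ≤ L) {r : ι → Ω → ℝ} (hr : ∀ l, MemLp (r l) 2 ν) {ρ : ℝ} (hρ : 0 ≤ ρ)
    (hrρ : ∀ l ∈ s, ∫ ω, r l ω ^ 2 ∂ν ≤ ρ) :
    ∫ ω, (∑ l ∈ s, α l * r l ω) ^ 2 ∂ν ≤ L ^ 2 * ρ := by
  have hL0 : 0 ≤ ∑ l ∈ s, α l := Finset.sum_nonneg hα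
  have hint : ∀ l ∈ s, Integrable (fun ω => α l * r l ω ^ 2) ν := fun l _ =>
    (hr l).integrable_sq.const_mul _
  calc ∫ ω, (∑ l ∈ s, α l * r l ω) ^ 2 ∂ν
      ≤ ∫ ω, (∑ l ∈ s, α l) * ∑ l ∈ s, α l * r l ω ^ 2 ∂ν := by
        refine integral_mono ?_ ((integrable_finsetSum s hint).const_mul _) fun ω => ?_
        · exact (memLp_weighted_sum hr).integrable_sq
        · exact Finset.sum_sq_le_sum_mul_sum_of_sq_le_mul s hα
            (fun l hl => mul_nonneg (hα l hl) (sq_nonneg _)) fun l _ => le_of_eq (by ring)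
    _ = (∑ l ∈ s, α l) * ∑ l ∈ s, α l * ∫ ω, r l ω ^ 2 ∂ν := by
        rw [integral_const_mul, integral_finsetSum s hint]
        simp only [integral_const_mul]
    _ ≤ (∑ l ∈ s, α l) * ∑ l ∈ s, α l * ρ :=
        mul_le_mul_of_nonneg_left (Finset.sum_le_sum fun l hl =>
          mul_le_mul_of_nonneg_left (hrρ l hl) (hα l hl)) hL0
    _ = (∑ l ∈ s, α l) ^ 2 * ρ := by rw [← Finset.sum_mul]; ring
    _ ≤ L ^ 2 * ρ := by gcongr

/-- A family of scalar linear recursions with small coupling `r` and noise `ξ`, started from `0`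
and bounded in `L²`. -/
structure PerronSystem {ι : Type*} [Fintype ι] (ν : Measure Ω) (n : ℕ) (γ : ℕ → ℝ) (κ : ι → ℝ)
    (L ε a b : ℝ) (w r ξ : ι → ℕ → Ω → ℝ) : Prop where
  step_pos : ∀ k, 0 < γ k
  diverges : ∀ k, Tendsto (fun m => ∑ i ∈ Finset.Ico k m, γ i) atTop atTop
  le_rate : ∀ j, 1 ≤ L * |κ j|
  factor_pos : ∀ j k, n ≤ k → 0 < 1 + κ j * γ k
  coupling_nonneg : 0 ≤ ε
  error_nonneg : 0 ≤ a
  memLp : ∀ j k, MemLp (w j k) 2 ν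
  memLp_noise : ∀ j k, MemLp (ξ j k) 2 ν
  memLp_rest : ∀ j k, MemLp (r j k) 2 ν
  bounded : ∃ S, ∀ j k, n ≤ k → ∫ ω, w j k ω ^ 2 ∂ν ≤ S
  start : ∀ j, ∀ᵐ ω ∂ν, w j n ω = 0
  recursion : ∀ᵐ ω ∂ν, ∀ j k, n ≤ k →
    w j (k + 1) ω = w j k ω + γ k * (κ j * w j k ω + (r j k ω + ξ j k ω))
  rest_le : ∀ j k, n ≤ k →
    ∫ ω, r j k ω ^ 2 ∂ν ≤ ε * ∑ i, ∫ ω, w i k ω ^ 2 ∂ν + a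
  noise_le : ∀ j (c : ℕ → ℝ) (k m : ℕ), n ≤ k → (∀ l ∈ Finset.Ico k m, |c l| ≤ 1) →
    ∫ ω, (∑ l ∈ Finset.Ico k m, c l * γ l * ξ j l ω) ^ 2 ∂ν ≤ b

namespace PerronSystem

variable {ι : Type*} [Fintype ι] {n : ℕ} {κ : ι → ℝ} {L ε a b : ℝ} {w r ξ : ι → ℕ → Ω → ℝ}

theorem le_of_abs_mul_le (hS : PerronSystem ν n γ κ L ε a b w r ξ) (j : ι) {t : ℝ}
    (h : |κ j| * t ≤ 1) : t ≤ L := by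
  have hrate := hS.le_rate j
  have hκ : 0 < |κ j| := by
    by_contra! hnonpos
    have hzero := le_antisymm hnonpos (abs_nonneg _)
    rw [hzero, mul_zero] at hrate
    linarith
  by_contra! hlt
  nlinarith

theorem error_bound_nonneg (hS : PerronSystem ν n γ κ L ε a b w r ξ) {s : ℝ} (hs0 : 0 ≤ s) :
    0 ≤ ε * (Fintype.card ι * s) + a := by
  have := hS.coupling_nonneg
  have := hS.error_nonneg
  positivity

theorem integral_rest_sq_le (hS : PerronSystem ν n γ κ L ε a b w r ξ) {s : ℝ}
    (hs : ∀ j k, n ≤ k → ∫ ω, w j k ω ^ 2 ∂ν ≤ s) (j : ι) {k : ℕ} (hk : n ≤ k) :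
    ∫ ω, r j k ω ^ 2 ∂ν ≤ ε * (Fintype.card ι * s) + a := by
  refine (hS.rest_le j k hk).trans ?_
  have hsum : ∑ i, ∫ ω, w i k ω ^ 2 ∂ν ≤ ∑ _i : ι, s := Finset.sum_le_sum fun i _ => hs i k hk
  rw [Finset.sum_const, Finset.card_univ, nsmul_eq_mul] at hsum
  have := mul_le_mul_of_nonneg_left hsum hS.coupling_nonneg
  linarith

theorem integral_sq_le_of_nonpos (hS : PerronSystem ν n γ κ L ε a b w r ξ) {s : ℝ} (hs0 : 0 ≤ s)
    (hs : ∀ j k, n ≤ k → ∫ ω, w j k ω ^ 2 ∂ν ≤ s) {j : ι} (hj : κ j ≤ 0) {k : ℕ} (hk : n ≤ k) :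
    ∫ ω, w j k ω ^ 2 ∂ν ≤ 2 * (L ^ 2 * (ε * (Fintype.card ι * s) + a)) + 2 * b := by
  have hpos := hS.factor_pos j
  have hγ : ∀ k, 0 ≤ γ k := fun k => (hS.step_pos k).le
  have hsol : ∀ᵐ ω ∂ν, w j k ω ^ 2
      = (∑ l ∈ Finset.Ico n k, growth (κ j) γ (l + 1) k * γ l * r j l ω
        + ∑ l ∈ Finset.Ico n k, growth (κ j) γ (l + 1) k * γ l * ξ j l ω) ^ 2 := by
    filter_upwards [hS.start j, hS.recursion] with ω hω hrec
    have hsol := eq_growth_mul_add_sum (w := fun k => w j k ω) (f := fun k => r j k ω + ξ j k ω)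
      (κ := κ j) (hrec j) hk
    simp only [hω, mul_zero, zero_add, mul_add, Finset.sum_add_distrib] at hsol
    rw [hsol]
  rw [integral_congr_ae hsol]
  refine (integral_add_sq_le (memLp_weighted_sum (hS.memLp_rest j))
    (memLp_weighted_sum (hS.memLp_noise j))).trans ?_
  have hrest := integral_sq_weighted_sum_le (s := Finset.Ico n k) (r := r j) (ν := ν)
    (α := fun l => growth (κ j) γ (l + 1) k * γ l) (L := L)
    (fun l hl => mul_nonneg (growth_pos hpos ((Finset.mem_Ico.1 hl).1.trans (Nat.le_succ l)) k).le
      (hγ l)) (hS.le_of_abs_mul_le j (abs_mul_sum_growth_le hj hpos hk))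
    (hS.memLp_rest j) (hS.error_bound_nonneg hs0)
    (fun l hl => hS.integral_rest_sq_le hs j (Finset.mem_Ico.1 hl).1)
  have hnoise := hS.noise_le j (fun l => growth (κ j) γ (l + 1) k) n k le_rfl (fun l hl => by
    have hl' := (Finset.mem_Ico.1 hl).1.trans (Nat.le_succ l)
    rw [abs_of_pos (growth_pos hpos hl' k)]
    exact growth_le_one hj hγ hpos hl' k)
  linarith

theorem integral_sum_rest_sq_le (hS : PerronSystem ν n γ κ L ε a b w r ξ) {s : ℝ} (hs0 : 0 ≤ s)
    (hs : ∀ j k, n ≤ k → ∫ ω, w j k ω ^ 2 ∂ν ≤ s) {j : ι} (hj : 0 < κ j) {k m : ℕ} (hk : n ≤ k)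
    (hm : k ≤ m) :
    ∫ ω, (∑ l ∈ Finset.Ico k m, (growth (κ j) γ k (l + 1))⁻¹ * γ l * r j l ω) ^ 2 ∂ν
      ≤ L ^ 2 * (ε * (Fintype.card ι * s) + a) := by
  have hγ : ∀ k, 0 ≤ γ k := fun k => (hS.step_pos k).le
  have hpos : ∀ l, k ≤ l → 0 < 1 + κ j * γ l := fun l hl => hS.factor_pos j l (hk.trans hl)
  refine integral_sq_weighted_sum_le (α := fun l => (growth (κ j) γ k (l + 1))⁻¹ * γ l)
    (fun l _ => mul_nonneg (inv_nonneg.2 (growth_pos hpos le_rfl _).le) (hγ l))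
    (hS.le_of_abs_mul_le j ?_) (hS.memLp_rest j) (hS.error_bound_nonneg hs0)
    (fun l hl => hS.integral_rest_sq_le hs j (hk.trans (Finset.mem_Ico.1 hl).1))
  rw [abs_of_pos hj]
  exact mul_sum_inv_growth_le hj.le hγ hm

theorem ae_eq_of_horizon (hS : PerronSystem ν n γ κ L ε a b w r ξ) (j : ι) {k m : ℕ} (hk : n ≤ k)
    (hm : k ≤ m) : ∀ᵐ ω ∂ν, w j k ω = (growth (κ j) γ k m)⁻¹ * w j m ω
      + (-1) * (∑ l ∈ Finset.Ico k m, (growth (κ j) γ k (l + 1))⁻¹ * γ l * r j l ω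
        + ∑ l ∈ Finset.Ico k m, (growth (κ j) γ k (l + 1))⁻¹ * γ l * ξ j l ω) := by
  filter_upwards [hS.recursion] with ω hrec
  have hsol := eq_inv_growth_mul_sub_sum (w := fun k => w j k ω)
    (f := fun k => r j k ω + ξ j k ω) (κ := κ j)
    (fun l hl => hS.factor_pos j l (hk.trans hl)) (fun l hl => hrec j l (hk.trans hl)) hm
  simp only [mul_add, Finset.sum_add_distrib] at hsol
  rw [hsol]
  ring

theorem integral_sq_le_of_horizon (hS : PerronSystem ν n γ κ L ε a b w r ξ) {s : ℝ} (hs0 : 0 ≤ s)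
    (hs : ∀ j k, n ≤ k → ∫ ω, w j k ω ^ 2 ∂ν ≤ s) {j : ι} (hj : 0 < κ j) {k m : ℕ} (hk : n ≤ k)
    (hm : k ≤ m) :
    ∫ ω, w j k ω ^ 2 ∂ν ≤ 2 * ((growth (κ j) γ k m)⁻¹ ^ 2 * s)
      + (4 * (L ^ 2 * (ε * (Fintype.card ι * s) + a)) + 4 * b) := by
  have hγ : ∀ k, 0 ≤ γ k := fun k => (hS.step_pos k).le
  have hpos : ∀ l, k ≤ l → 0 < 1 + κ j * γ l := fun l hl => hS.factor_pos j l (hk.trans hl)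
  have hA := memLp_weighted_sum (s := Finset.Ico k m)
    (α := fun l => (growth (κ j) γ k (l + 1))⁻¹ * γ l) (hS.memLp_rest j)
  have hB := memLp_weighted_sum (s := Finset.Ico k m)
    (α := fun l => (growth (κ j) γ k (l + 1))⁻¹ * γ l) (hS.memLp_noise j)
  rw [integral_congr_ae ((hS.ae_eq_of_horizon j hk hm).mono fun ω hω => by rw [hω])]
  refine (integral_add_sq_le ((hS.memLp j m).const_mul _) ((hA.add hB).const_mul _)).trans ?_
  have hsplit := integral_add_sq_le hA hB
  have hrest := hS.integral_sum_rest_sq_le hs0 hs hj hk hm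
  have hnoise := hS.noise_le j (fun l => (growth (κ j) γ k (l + 1))⁻¹) k m hk fun l _ => by
    rw [abs_of_pos (inv_pos.2 (growth_pos hpos le_rfl _))]
    exact inv_le_one_of_one_le₀ (one_le_growth hj.le hγ _ _)
  have hend := mul_le_mul_of_nonneg_left (hs j m (hk.trans hm))
    (sq_nonneg (growth (κ j) γ k m)⁻¹)
  simp only [mul_pow, Pi.add_apply, integral_const_mul]
  linarith

theorem tendsto_inv_growth_sq_mul (hS : PerronSystem ν n γ κ L ε a b w r ξ) {j : ι} (hj : 0 < κ j)
    (k : ℕ) (s : ℝ) : Tendsto (fun m => 2 * ((growth (κ j) γ k m)⁻¹ ^ 2 * s)) atTop (𝓝 0) := by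
  have h := tendsto_inv_growth hj (fun i => (hS.step_pos i).le) (hS.diverges k)
  simpa using ((h.pow 2).mul_const s).const_mul 2

theorem integral_sq_le_of_pos (hS : PerronSystem ν n γ κ L ε a b w r ξ) {s : ℝ} (hs0 : 0 ≤ s)
    (hs : ∀ j k, n ≤ k → ∫ ω, w j k ω ^ 2 ∂ν ≤ s) {j : ι} (hj : 0 < κ j) {k : ℕ} (hk : n ≤ k) :
    ∫ ω, w j k ω ^ 2 ∂ν ≤ 4 * (L ^ 2 * (ε * (Fintype.card ι * s) + a)) + 4 * b := by
  have hlim := (hS.tendsto_inv_growth_sq_mul hj k s).add_const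
    (4 * (L ^ 2 * (ε * (Fintype.card ι * s) + a)) + 4 * b)
  rw [zero_add] at hlim
  exact ge_of_tendsto hlim <| (eventually_ge_atTop k).mono fun m hm =>
    hS.integral_sq_le_of_horizon hs0 hs hj hk hm

theorem integral_sq_le (hS : PerronSystem ν n γ κ L ε a b w r ξ) (hb : 0 ≤ b)
    (hε : 8 * (L ^ 2 * (ε * Fintype.card ι)) ≤ 1) (j : ι) {k : ℕ} (hk : n ≤ k) :
    ∫ ω, w j k ω ^ 2 ∂ν ≤ 8 * (L ^ 2 * a + b) := by
  obtain ⟨S, hSb⟩ := hS.bounded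
  let f : ι × {k // n ≤ k} → ℝ := fun x => ∫ ω, w x.1 x.2 ω ^ 2 ∂ν
  have hbdd : BddAbove (Set.range f) := ⟨S, by rintro _ ⟨x, rfl⟩; exact hSb x.1 x.2 x.2.2⟩
  have hle : ∀ j k, n ≤ k → ∫ ω, w j k ω ^ 2 ∂ν ≤ iSup f := fun j k hk =>
    le_ciSup hbdd (⟨j, ⟨k, hk⟩⟩ : ι × {k // n ≤ k})
  have hsup_nonneg : 0 ≤ iSup f := (integral_nonneg fun ω => sq_nonneg _).trans (hle j n le_rfl)
  have hne : Nonempty (ι × {k // n ≤ k}) := ⟨⟨j, ⟨n, le_rfl⟩⟩⟩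
  have hρ : 0 ≤ L ^ 2 * (ε * (Fintype.card ι * iSup f) + a) :=
    mul_nonneg (sq_nonneg L) (hS.error_bound_nonneg hsup_nonneg)
  have hsup : iSup f ≤ 4 * (L ^ 2 * (ε * (Fintype.card ι * iSup f) + a)) + 4 * b := by
    refine ciSup_le fun x => ?_
    rcases le_or_gt (κ x.1) 0 with h | h
    · refine (hS.integral_sq_le_of_nonpos hsup_nonneg hle h x.2.2).trans ?_
      linarith
    · exact hS.integral_sq_le_of_pos hsup_nonneg hle h x.2.2
  have hcouple := mul_le_mul_of_nonneg_right hε hsup_nonneg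
  have hk_le := hle j k hk
  linarith

theorem eventually_noise_le (hS : PerronSystem ν n γ κ L ε a b w r ξ) (hb : 0 ≤ b)
    (hε : 8 * (L ^ 2 * (ε * Fintype.card ι)) ≤ 1) {j : ι} (hj : 0 < κ j) {η : ℝ} (hη : 0 < η) :
    ∀ᶠ m in atTop,
      ∫ ω, (∑ l ∈ Finset.Ico n m, (growth (κ j) γ n (l + 1))⁻¹ * γ l * ξ j l ω) ^ 2 ∂ν ≤
        η + 2 * (L ^ 2 * (ε * (Fintype.card ι * (8 * (L ^ 2 * a + b))) + a)) := by
  have hs : ∀ j k, n ≤ k → ∫ ω, w j k ω ^ 2 ∂ν ≤ 8 * (L ^ 2 * a + b) := fun j k hk =>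
    hS.integral_sq_le hb hε j hk
  have hs0 : 0 ≤ 8 * (L ^ 2 * a + b) := by
    have := hS.error_nonneg
    positivity
  filter_upwards [(hS.tendsto_inv_growth_sq_mul hj n (8 * (L ^ 2 * a + b))).eventually_lt_const hη,
    eventually_ge_atTop n] with m hm hnm
  have hsol : ∀ᵐ ω ∂ν, (∑ l ∈ Finset.Ico n m, (growth (κ j) γ n (l + 1))⁻¹ * γ l * ξ j l ω) ^ 2
      = ((growth (κ j) γ n m)⁻¹ * w j m ω
        + (-1) * ∑ l ∈ Finset.Ico n m, (growth (κ j) γ n (l + 1))⁻¹ * γ l * r j l ω) ^ 2 := by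
    filter_upwards [hS.start j, hS.ae_eq_of_horizon j le_rfl hnm] with ω hω h
    rw [hω] at h
    congr 1
    linarith
  rw [integral_congr_ae hsol]
  refine (integral_add_sq_le ((hS.memLp j m).const_mul _)
    ((memLp_weighted_sum (hS.memLp_rest j)).const_mul _)).trans ?_
  have hrest := hS.integral_sum_rest_sq_le hs0 hs hj le_rfl hnm
  have hend := mul_le_mul_of_nonneg_left (hs j m hnm) (sq_nonneg (growth (κ j) γ n m)⁻¹)
  simp only [mul_pow, integral_const_mul]
  linarith

end PerronSystem

end Perron

section Path

variable {d : ℕ} {s : Fin d → ℝ} {y : ℕ → Fin d}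

theorem weight_succ (s : Fin d → ℝ) (y : ℕ → Fin d) (n : ℕ) (i : Fin d) :
    weight s y (n + 1) i = weight s y n i + if y (n + 1) = i then 1 else 0 := rfl

theorem sum_weight (s : Fin d → ℝ) (y : ℕ → Fin d) (n : ℕ) :
    ∑ j, weight s y n j = ∑ j, s j + n := by
  induction n with
  | zero => simp [weight]
  | succ n ih =>
    simp only [weight_succ, Finset.sum_add_distrib, ih, Finset.sum_ite_eq, Finset.mem_univ,
      if_true]
    push_cast
    ring

theorem weight_pos (hs : ∀ i, 0 < s i) (n : ℕ) (i : Fin d) : 0 < weight s y n i := by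
  induction n with
  | zero => exact hs i
  | succ n ih =>
    rw [weight_succ]
    split_ifs <;> linarith

theorem weight_congr {y' : ℕ → Fin d} {n : ℕ} (h : ∀ k ≤ n, y k = y' k) (i : Fin d) :
    weight s y n i = weight s y' n i := by
  induction n with
  | zero => rfl
  | succ n ih =>
    rw [weight_succ, weight_succ, ih fun k hk => h k (hk.trans (Nat.le_succ n)), h _ le_rfl]

theorem occupation_congr {y' : ℕ → Fin d} {n : ℕ} (h : ∀ k ≤ n, y k = y' k) :
    occupation s y n = occupation s y' n := by
  ext i
  simp only [occupation, weight_congr h]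

theorem occupation_eq (s : Fin d → ℝ) (y : ℕ → Fin d) (n : ℕ) (i : Fin d) :
    occupation s y n i = weight s y n i / (∑ j, s j + n) := by
  rw [occupation, sum_weight]

theorem sum_pos_of_pos (hs : ∀ i, 0 < s i) (i : Fin d) : 0 < ∑ j, s j :=
  Finset.sum_pos (fun j _ => hs j) ⟨i, Finset.mem_univ i⟩

theorem occupation_succ_sub (hs : ∀ i, 0 < s i) (n : ℕ) (i : Fin d) :
    occupation s y (n + 1) i - occupation s y n i
      = ((if y (n + 1) = i then 1 else 0) - occupation s y n i) / (∑ j, s j + (n + 1)) := by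
  have hs_pos := sum_pos_of_pos hs i
  have htotal : (∑ j, s j + n) ≠ 0 := by positivity
  have htotal_succ : (∑ j, s j + (n + 1)) ≠ 0 := by positivity
  rw [occupation_eq, occupation_eq, weight_succ]
  push_cast
  field_simp
  ring

theorem occupation_pos (hs : ∀ i, 0 < s i) (n : ℕ) (i : Fin d) : 0 < occupation s y n i := by
  have hs_pos := sum_pos_of_pos hs i
  have := weight_pos (y := y) hs n i
  rw [occupation_eq]
  positivity

theorem occupation_le_one (hs : ∀ i, 0 < s i) (n : ℕ) (i : Fin d) : occupation s y n i ≤ 1 := by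
  have hs_pos := sum_pos_of_pos hs i
  rw [occupation_eq, div_le_one (by positivity), ← sum_weight s y n]
  exact Finset.single_le_sum (f := fun i => weight s y n i) (fun j _ => (weight_pos hs n j).le)
    (Finset.mem_univ i)

theorem abs_occupation_succ_sub_le (hs : ∀ i, 0 < s i) (n : ℕ) (i : Fin d) :
    |occupation s y (n + 1) i - occupation s y n i| ≤ 1 / (∑ j, s j + (n + 1)) := by
  have hs_pos := sum_pos_of_pos hs i
  rw [occupation_succ_sub hs, abs_div, abs_of_pos (show 0 < ∑ j, s j + (n + 1 : ℝ) by positivity)]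
  refine div_le_div_of_nonneg_right ?_ (by positivity)
  have hnonneg := (occupation_pos (y := y) hs n i).le
  have hle := occupation_le_one (y := y) hs n i
  rw [abs_le]
  split_ifs <;> constructor <;> linarith

theorem step_eq_transition {R : Matrix (Fin d) (Fin d) ℝ} (hs : ∀ i, 0 < s i) (n : ℕ)
    (i j : Fin d) :
    R i j * weight s y n j / ∑ k, R i k * weight s y n k = transition R (occupation s y n) i j := by
  have hs_pos := sum_pos_of_pos hs i
  have htotal : (∑ j, s j + n) ≠ 0 := by positivity
  simp only [transition, Matrix.of_apply, N, occupation_eq, ← mul_div_assoc, ← Finset.sum_div]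
  rw [div_div_div_cancel_right₀ htotal]

theorem N_pos {R : Matrix (Fin d) (Fin d) ℝ} {v : Fin d → ℝ} (hsymm : R.IsSymm)
    (hnonneg : ∀ i j, 0 ≤ R i j) (hcol : ∀ j, 0 < ∑ i, R i j) (hv : ∀ i, 0 < v i) (i : Fin d) :
    0 < N R v i := by
  have hrow : ∃ j ∈ Finset.univ, 0 < R i j := by
    apply Finset.exists_lt_of_sum_lt (f := fun _ => (0 : ℝ))
    rw [Finset.sum_const_zero]
    exact (hcol i).trans_eq (Finset.sum_congr rfl fun j _ => hsymm.apply i j)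
  obtain ⟨j, hj, hRj⟩ := hrow
  exact Finset.sum_pos' (fun k _ => mul_nonneg (hnonneg i k) (hv k).le)
    ⟨j, hj, mul_pos hRj (hv j)⟩

theorem sum_transition_occupation {R : Matrix (Fin d) (Fin d) ℝ} (hsymm : R.IsSymm)
    (hnonneg : ∀ i j, 0 ≤ R i j) (hcol : ∀ j, 0 < ∑ i, R i j) (hs : ∀ i, 0 < s i) (n : ℕ)
    (i : Fin d) : ∑ j, transition R (occupation s y n) i j = 1 :=
  sum_transition (N_pos hsymm hnonneg hcol (occupation_pos hs n) i).ne'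

theorem transition_nonneg {R : Matrix (Fin d) (Fin d) ℝ} {v : Fin d → ℝ}
    (hnonneg : ∀ i j, 0 ≤ R i j) (hv : ∀ i, 0 ≤ v i) (i j : Fin d) : 0 ≤ transition R v i j :=
  div_nonneg (mul_nonneg (hnonneg i j) (hv j))
    (Finset.sum_nonneg fun k _ => mul_nonneg (hnonneg i k) (hv k))

end Path

section Past

variable {E Ω : Type*}

/-- `G` is a function of `Y_0, …, Y_k`; no measurability is asked for. -/
def DependsOnPast {α : Type*} (Y : ℕ → Ω → E) (k : ℕ) (G : Ω → α) : Prop :=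
  ∀ ω ω', (∀ i ≤ k, Y i ω = Y i ω') → G ω = G ω'

namespace DependsOnPast

variable {α : Type*} {Y : ℕ → Ω → E} {k : ℕ}

theorem mono {G : Ω → α} (h : DependsOnPast Y k G) {l : ℕ} (hkl : k ≤ l) : DependsOnPast Y l G :=
  fun ω ω' hω => h ω ω' fun i hi => hω i (hi.trans hkl)

theorem comp₂ {β δ : Type*} {F : Ω → α} {G : Ω → β} (hF : DependsOnPast Y k F)
    (hG : DependsOnPast Y k G) (f : α → β → δ) : DependsOnPast Y k (fun ω => f (F ω) (G ω)) :=
  fun ω ω' hω => by simp only [hF ω ω' hω, hG ω ω' hω]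

theorem comp {β : Type*} {F : Ω → α} (hF : DependsOnPast Y k F) (f : α → β) :
    DependsOnPast Y k (fun ω => f (F ω)) :=
  fun ω ω' hω => by simp only [hF ω ω' hω]

theorem mul {F G : Ω → ℝ} (hF : DependsOnPast Y k F) (hG : DependsOnPast Y k G) :
    DependsOnPast Y k (fun ω => F ω * G ω) := hF.comp₂ hG _

theorem sum {ι : Type*} {t : Finset ι} {F : ι → Ω → ℝ} (hF : ∀ i ∈ t, DependsOnPast Y k (F i)) :
    DependsOnPast Y k (fun ω => ∑ i ∈ t, F i ω) :=
  fun ω ω' hω => Finset.sum_congr rfl fun i hi => hF i hi ω ω' hω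

theorem self {i : ℕ} (hi : i ≤ k) : DependsOnPast Y k (Y i) := fun _ _ hω => hω i hi

/-- The vector of the first `k + 1` states. -/
def past (Y : ℕ → Ω → E) (k : ℕ) (ω : Ω) : Fin (k + 1) → E := fun i => Y i ω

theorem exists_eq_comp_past {G : Ω → ℝ} (h : DependsOnPast Y k G) :
    ∃ g : (Fin (k + 1) → E) → ℝ, G = g ∘ past Y k := by
  have hf : Function.FactorsThrough G (past Y k) := fun ω ω' hω =>
    h ω ω' fun i hi => congrFun hω ⟨i, Nat.lt_succ_of_le hi⟩
  exact ⟨Function.extend (past Y k) G fun _ => 0, (hf.extend_comp _).symm⟩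

theorem exists_abs_le [Finite E] {G : Ω → ℝ} (h : DependsOnPast Y k G) :
    ∃ C, ∀ ω, |G ω| ≤ C := by
  obtain ⟨g, rfl⟩ := h.exists_eq_comp_past
  cases nonempty_fintype E
  refine ⟨∑ x, |g x|, fun ω => ?_⟩
  exact Finset.single_le_sum (f := fun x => |g x|) (fun x _ => abs_nonneg _)
    (Finset.mem_univ (past Y k ω))

end DependsOnPast

variable {d : ℕ}

theorem dependsOnPast_occupation (s : Fin d → ℝ) (Y : ℕ → Ω → Fin d) (k : ℕ) :
    DependsOnPast Y k (fun ω => occupation s (fun n => Y n ω) k) :=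
  fun _ _ hω => occupation_congr hω

theorem dependsOnPast_indicator (Y : ℕ → Ω → Fin d) (k : ℕ) (j : Fin d) :
    DependsOnPast Y k ((Y k ⁻¹' {j}).indicator fun _ => (1 : ℝ)) := fun ω ω' hω => by
  simp only [Set.indicator, Set.mem_preimage, Set.mem_singleton_iff, hω k le_rfl]

theorem dependsOnPast_transition (R : Matrix (Fin d) (Fin d) ℝ) (s : Fin d → ℝ)
    (Y : ℕ → Ω → Fin d) (k : ℕ) (j : Fin d) : DependsOnPast Y k
      (fun ω => transition R (occupation s (fun n => Y n ω) k) (Y k ω) j) :=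
  (dependsOnPast_occupation s Y k).comp₂ (DependsOnPast.self le_rfl) fun v i => transition R v i j

theorem history_le [mΩ : MeasurableSpace Ω] {Y : ℕ → Ω → Fin d} (hY : ∀ n, Measurable (Y n))
    (k : ℕ) : history Y k ≤ mΩ :=
  iSup_le fun i => (hY i).comap_le

namespace DependsOnPast

variable {Y : ℕ → Ω → Fin d} {k : ℕ}

theorem measurable_past_history (Y : ℕ → Ω → Fin d) (k : ℕ) :
    Measurable[history Y k] (past Y k) := by
  refine @measurable_pi_lambda _ _ _ (history Y k) _ _ fun i => ?_
  exact (comap_measurable (Y i)).mono (le_iSup (fun i : Fin (k + 1) =>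
    MeasurableSpace.comap (Y i) inferInstance) i) le_rfl

theorem measurable_history {G : Ω → ℝ} (h : DependsOnPast Y k G) : Measurable[history Y k] G := by
  obtain ⟨g, rfl⟩ := h.exists_eq_comp_past
  exact (measurable_of_finite g).comp (measurable_past_history Y k)

variable [mΩ : MeasurableSpace Ω] {μ : Measure Ω} [IsFiniteMeasure μ]

theorem measurable {G : Ω → ℝ} (h : DependsOnPast Y k G) (hY : ∀ n, Measurable (Y n)) :
    Measurable G :=
  h.measurable_history.mono (history_le hY k) le_rfl

theorem integrable {G : Ω → ℝ} (h : DependsOnPast Y k G) (hY : ∀ n, Measurable (Y n)) :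
    Integrable G μ := by
  obtain ⟨C, hC⟩ := h.exists_abs_le
  exact Integrable.of_bound (h.measurable hY).aestronglyMeasurable C
    (Eventually.of_forall fun ω => hC ω)

theorem memLp_two {G : Ω → ℝ} (h : DependsOnPast Y k G) (hY : ∀ n, Measurable (Y n)) :
    MemLp G 2 μ :=
  (memLp_two_iff_integrable_sq (h.measurable hY).aestronglyMeasurable).2
    ((h.comp fun x => x ^ 2).integrable hY)

end DependsOnPast

end Past

section OneStep

variable {d : ℕ} {Ω : Type*} [mΩ : MeasurableSpace Ω] {R : Matrix (Fin d) (Fin d) ℝ}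
  {s : Fin d → ℝ} {y₀ : Fin d} {μ : Measure Ω} [IsProbabilityMeasure μ] {Y : ℕ → Ω → Fin d}

namespace IsReinforcedProcess

theorem integral_mul_indicator (hY : IsReinforcedProcess R s y₀ μ Y) (hs : ∀ i, 0 < s i) {k : ℕ}
    {F : Ω → ℝ} (hF : DependsOnPast Y k F) (j : Fin d) :
    ∫ ω, F ω * (Y (k + 1) ⁻¹' {j}).indicator (fun _ => (1 : ℝ)) ω ∂μ
      = ∫ ω, transition R (occupation s (fun n => Y n ω) k) (Y k ω) j * F ω ∂μ := by
  have hind := dependsOnPast_indicator Y (k + 1) j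
  have hpull : μ[fun ω => F ω * (Y (k + 1) ⁻¹' {j}).indicator (fun _ => (1 : ℝ)) ω | history Y k]
      =ᵐ[μ] fun ω => F ω * (μ[(Y (k + 1) ⁻¹' {j}).indicator (fun _ => (1 : ℝ)) | history Y k]) ω :=
    condExp_mul_of_stronglyMeasurable_left hF.measurable_history.stronglyMeasurable
      (((hF.mono (Nat.le_succ k)).mul hind).integrable hY.measurable)
      (hind.integrable hY.measurable)
  rw [← integral_condExp (history_le hY.measurable k)]
  refine integral_congr_ae ?_
  filter_upwards [hpull, hY.step k j] with ω hω hstep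
  rw [hω, hstep, step_eq_transition hs, mul_comm]

theorem integral_step (hY : IsReinforcedProcess R s y₀ μ Y) (hs : ∀ i, 0 < s i) {k : ℕ}
    {F : Fin d → Ω → ℝ} (hF : ∀ j, DependsOnPast Y k (F j)) :
    ∫ ω, F (Y (k + 1) ω) ω ∂μ
      = ∫ ω, ∑ j, transition R (occupation s (fun n => Y n ω) k) (Y k ω) j * F j ω ∂μ := by
  have hsplit : ∀ ω, F (Y (k + 1) ω) ω
      = ∑ j, F j ω * (Y (k + 1) ⁻¹' {j}).indicator (fun _ => (1 : ℝ)) ω := fun ω => by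
    rw [Finset.sum_eq_single (Y (k + 1) ω) (fun j _ hj => by simp [Set.indicator, hj.symm])
      (by simp)]
    simp
  simp only [hsplit]
  rw [integral_finsetSum _ fun j _ => (((hF j).mono (Nat.le_succ k)).mul
      (dependsOnPast_indicator Y (k + 1) j)).integrable hY.measurable,
    integral_finsetSum _ fun j _ =>
      ((dependsOnPast_transition R s Y k j).mul (hF j)).integrable hY.measurable]
  exact Finset.sum_congr rfl fun j _ => hY.integral_mul_indicator hs (hF j) j

end IsReinforcedProcess

end OneStep

section Noise

theorem add_mul_pow_four_le (a c : ℝ) {x C : ℝ} (hx : x ^ 2 ≤ C ^ 2) :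
    (a + c * x) ^ 4 ≤
      a ^ 4 + 4 * c * a ^ 3 * x + (8 * C ^ 2 * c ^ 2 * a ^ 2 + 3 * C ^ 4 * c ^ 4) := by
  have hcube : (a + c * x) ^ 4 ≤
      a ^ 4 + 4 * c * a ^ 3 * x + (8 * (a * c) ^ 2 * x ^ 2 + 3 * c ^ 4 * (x ^ 2) ^ 2) := by
    nlinarith [mul_nonneg (sq_nonneg (c * x)) (sq_nonneg (a - c * x))]
  have hsq := mul_le_mul_of_nonneg_left hx (sq_nonneg (a * c))
  have hfour := mul_le_mul_of_nonneg_left (pow_le_pow_left₀ (sq_nonneg x) hx 2)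
    (show 0 ≤ c ^ 4 by positivity)
  linarith

variable {d : ℕ} {Ω : Type*} [mΩ : MeasurableSpace Ω]

/-- A bounded sequence of martingale differences, `ξ l` being revealed at time `l + 1`. -/
structure IsNoise (μ : Measure Ω) (Y : ℕ → Ω → Fin d) (ξ : ℕ → Ω → ℝ) (C : ℝ) : Prop where
  dep : ∀ l, DependsOnPast Y (l + 1) (ξ l)
  bound : ∀ l ω, |ξ l ω| ≤ C
  centered : ∀ l (G : Ω → ℝ), DependsOnPast Y l G → ∫ ω, G ω * ξ l ω ∂μ = 0

namespace IsNoise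

variable {μ : Measure Ω} {Y : ℕ → Ω → Fin d} {ξ : ℕ → Ω → ℝ} {C : ℝ} {n : ℕ} {I : Ω → ℝ}

theorem sq_le (hξ : IsNoise μ Y ξ C) (l : ℕ) (ω : Ω) : ξ l ω ^ 2 ≤ C ^ 2 := by
  have hbound := hξ.bound l ω
  rw [← sq_abs]
  gcongr

theorem dep_sum (hξ : IsNoise μ Y ξ C) (α : ℕ → ℝ) (k m : ℕ) :
    DependsOnPast Y m (fun ω => ∑ l ∈ Finset.Ico k m, α l * ξ l ω) :=
  DependsOnPast.sum fun l hl =>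
    ((hξ.dep l).mono (Finset.mem_Ico.1 hl).2).comp fun x => α l * x

variable [IsProbabilityMeasure μ]

theorem integral_sum (hξ : IsNoise μ Y ξ C) (hY : ∀ n, Measurable (Y n))
    (hI : DependsOnPast Y n I) (α : ℕ → ℝ) {k m : ℕ} (hk : n ≤ k) :
    ∫ ω, I ω * ∑ l ∈ Finset.Ico k m, α l * ξ l ω ∂μ = 0 := by
  simp only [Finset.mul_sum]
  rw [integral_finsetSum]
  · refine Finset.sum_eq_zero fun l hl => ?_
    have h := hξ.centered l (fun ω => I ω * α l)
      ((hI.mono (hk.trans (Finset.mem_Ico.1 hl).1)).comp fun x => x * α l)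
    simpa only [mul_assoc] using h
  · intro l hl
    exact ((hI.mono ((hk.trans (Finset.mem_Ico.1 hl).1).trans (Nat.le_succ l))).mul
      ((hξ.dep l).comp fun x => α l * x)).integrable hY

theorem integral_mul_add_sq (hξ : IsNoise μ Y ξ C) (hY : ∀ n, Measurable (Y n)) {M : Ω → ℝ} {m : ℕ}
    (hI : DependsOnPast Y m I) (hM : DependsOnPast Y m M) (c : ℝ) :
    ∫ ω, I ω * (M ω + c * ξ m ω) ^ 2 ∂μ
      = ∫ ω, I ω * M ω ^ 2 ∂μ + c ^ 2 * ∫ ω, I ω * ξ m ω ^ 2 ∂μ := by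
  have hI' := hI.mono (Nat.le_succ m)
  have hM' := hM.mono (Nat.le_succ m)
  have hexpand : ∀ ω, I ω * (M ω + c * ξ m ω) ^ 2
      = I ω * M ω ^ 2 + ((2 * c * (I ω * M ω)) * ξ m ω + c ^ 2 * (I ω * ξ m ω ^ 2)) :=
    fun ω => by ring
  have hcross := hξ.centered m (fun ω => 2 * c * (I ω * M ω)) ((hI.mul hM).comp _)
  have i1 : Integrable (fun ω => I ω * M ω ^ 2) μ :=
    (hI.comp₂ hM fun x y => x * y ^ 2).integrable hY
  have i2 : Integrable (fun ω => (2 * c * (I ω * M ω)) * ξ m ω) μ :=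
    (((hI'.mul hM').comp fun x => 2 * c * x).mul (hξ.dep m)).integrable hY
  have i3 : Integrable (fun ω => c ^ 2 * (I ω * ξ m ω ^ 2)) μ :=
    (hI'.comp₂ (hξ.dep m) fun x y => c ^ 2 * (x * y ^ 2)).integrable hY
  have i23 : Integrable
      (fun ω => (2 * c * (I ω * M ω)) * ξ m ω + c ^ 2 * (I ω * ξ m ω ^ 2)) μ := i2.add i3
  simp only [hexpand]
  rw [integral_add i1 i23, integral_add i2 i3, hcross, integral_const_mul, zero_add]

theorem integral_sum_sq (hξ : IsNoise μ Y ξ C) (hY : ∀ n, Measurable (Y n))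
    (hI : DependsOnPast Y n I) (α : ℕ → ℝ) {k m : ℕ} (hk : n ≤ k) (hm : k ≤ m) :
    ∫ ω, I ω * (∑ l ∈ Finset.Ico k m, α l * ξ l ω) ^ 2 ∂μ
      = ∑ l ∈ Finset.Ico k m, α l ^ 2 * ∫ ω, I ω * ξ l ω ^ 2 ∂μ := by
  induction m, hm using Nat.le_induction with
  | base => simp
  | succ m hm ih =>
    simp only [Finset.sum_Ico_succ_top hm]
    rw [hξ.integral_mul_add_sq hY (hI.mono (hk.trans hm)) (hξ.dep_sum α k m), ih]

theorem integral_sum_sq_le (hξ : IsNoise μ Y ξ C) (hY : ∀ n, Measurable (Y n))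
    (hI : DependsOnPast Y n I) (hI0 : ∀ ω, 0 ≤ I ω) (α : ℕ → ℝ) {k m : ℕ} (hk : n ≤ k)
    (hm : k ≤ m) :
    ∫ ω, I ω * (∑ l ∈ Finset.Ico k m, α l * ξ l ω) ^ 2 ∂μ
      ≤ C ^ 2 * (∑ l ∈ Finset.Ico k m, α l ^ 2) * ∫ ω, I ω ∂μ := by
  rw [hξ.integral_sum_sq hY hI α hk hm, Finset.mul_sum, Finset.sum_mul]
  refine Finset.sum_le_sum fun l hl => ?_
  have hIl := hI.mono ((hk.trans (Finset.mem_Ico.1 hl).1).trans (Nat.le_succ l))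
  have hterm : ∫ ω, I ω * ξ l ω ^ 2 ∂μ ≤ ∫ ω, C ^ 2 * I ω ∂μ := by
    refine integral_mono ((hIl.comp₂ (hξ.dep l) fun x y => x * y ^ 2).integrable hY)
      ((hI.integrable hY).const_mul _) fun ω => ?_
    simp only
    rw [mul_comm]
    exact mul_le_mul_of_nonneg_right (hξ.sq_le l ω) (hI0 ω)
  rw [integral_const_mul] at hterm
  nlinarith [sq_nonneg (α l)]

theorem integral_mul_add_pow_four_le (hξ : IsNoise μ Y ξ C) (hY : ∀ n, Measurable (Y n))
    {M : Ω → ℝ} {m : ℕ} (hI : DependsOnPast Y m I) (hI0 : ∀ ω, 0 ≤ I ω) (hM : DependsOnPast Y m M)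
    (c : ℝ) : ∫ ω, I ω * (M ω + c * ξ m ω) ^ 4 ∂μ
      ≤ ∫ ω, I ω * M ω ^ 4 ∂μ + (8 * C ^ 2 * c ^ 2 * ∫ ω, I ω * M ω ^ 2 ∂μ
        + 3 * C ^ 4 * c ^ 4 * ∫ ω, I ω ∂μ) := by
  have hI' := hI.mono (Nat.le_succ m)
  have hM' := hM.mono (Nat.le_succ m)
  have hcross := hξ.centered m (fun ω => 4 * c * (I ω * M ω ^ 3))
    (hI.comp₂ hM fun x y => 4 * c * (x * y ^ 3))
  have i1 : Integrable (fun ω => I ω * M ω ^ 4) μ :=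
    (hI.comp₂ hM fun x y => x * y ^ 4).integrable hY
  have i2 : Integrable (fun ω => (4 * c * (I ω * M ω ^ 3)) * ξ m ω) μ :=
    ((hI'.comp₂ hM' fun x y => 4 * c * (x * y ^ 3)).mul (hξ.dep m)).integrable hY
  have i3 : Integrable (fun ω => 8 * C ^ 2 * c ^ 2 * (I ω * M ω ^ 2)) μ :=
    (hI.comp₂ hM fun x y => 8 * C ^ 2 * c ^ 2 * (x * y ^ 2)).integrable hY
  have i4 : Integrable (fun ω => 3 * C ^ 4 * c ^ 4 * I ω) μ := (hI.integrable hY).const_mul _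
  have hpointwise : ∀ ω, I ω * (M ω + c * ξ m ω) ^ 4
      ≤ I ω * M ω ^ 4 + ((4 * c * (I ω * M ω ^ 3)) * ξ m ω
        + (8 * C ^ 2 * c ^ 2 * (I ω * M ω ^ 2) + 3 * C ^ 4 * c ^ 4 * I ω)) := fun ω => by
    have hle := mul_le_mul_of_nonneg_left (add_mul_pow_four_le (M ω) c (hξ.sq_le m ω)) (hI0 ω)
    linarith
  have hint := integral_mono
    ((hI'.comp₂ (hM'.comp₂ (hξ.dep m) fun x y => x + c * y) fun x y => x * y ^ 4).integrable hY)
    (i1.add (i2.add (i3.add i4))) hpointwise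
  rwa [integral_add' i1 (i2.add (i3.add i4)), integral_add' i2 (i3.add i4), integral_add' i3 i4,
    hcross, integral_const_mul, integral_const_mul, zero_add] at hint

theorem integral_sum_pow_four_le (hξ : IsNoise μ Y ξ C) (hY : ∀ n, Measurable (Y n))
    (hI : DependsOnPast Y n I) (hI0 : ∀ ω, 0 ≤ I ω) (α : ℕ → ℝ) {k m : ℕ} (hk : n ≤ k)
    (hm : k ≤ m) :
    ∫ ω, I ω * (∑ l ∈ Finset.Ico k m, α l * ξ l ω) ^ 4 ∂μ
      ≤ 11 * C ^ 4 * (∑ l ∈ Finset.Ico k m, α l ^ 2) ^ 2 * ∫ ω, I ω ∂μ := by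
  induction m, hm using Nat.le_induction with
  | base => simp
  | succ m hm ih =>
    have hsq := hξ.integral_sum_sq_le hY hI hI0 α hk hm
    have hstep := hξ.integral_mul_add_pow_four_le hY (hI.mono (hk.trans hm)) hI0
      (hξ.dep_sum α k m) (α m)
    simp only [Finset.sum_Ico_succ_top hm]
    refine hstep.trans ?_
    have hI' : 0 ≤ ∫ ω, I ω ∂μ := integral_nonneg hI0
    set A := ∑ l ∈ Finset.Ico k m, α l ^ 2
    have hcross := mul_le_mul_of_nonneg_left hsq (show 0 ≤ 8 * C ^ 2 * α m ^ 2 by positivity)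
    have hA2 : 0 ≤ C ^ 4 * (∫ ω, I ω ∂μ) * (A * α m ^ 2) := by
      have : 0 ≤ A := Finset.sum_nonneg fun l _ => sq_nonneg _
      positivity
    have hA4 : 0 ≤ C ^ 4 * (∫ ω, I ω ∂μ) * α m ^ 4 := by positivity
    nlinarith

end IsNoise

end Noise

section Levy

variable {d : ℕ} {Ω : Type*}

/-- The set of outcomes with the same first `n + 1` states as `ω₀`. -/
def atom (Y : ℕ → Ω → Fin d) (n : ℕ) (ω₀ : Ω) : Set Ω := {ω | ∀ i ≤ n, Y i ω₀ = Y i ω}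

theorem past_eq_past_iff {Y : ℕ → Ω → Fin d} {n : ℕ} {ω ω' : Ω} :
    DependsOnPast.past Y n ω = DependsOnPast.past Y n ω' ↔ ∀ i ≤ n, Y i ω = Y i ω' :=
  ⟨fun h i hi => congrFun h ⟨i, Nat.lt_succ_of_le hi⟩,
    fun h => funext fun i => h i (Nat.le_of_lt_succ i.2)⟩

theorem atom_eq_preimage (Y : ℕ → Ω → Fin d) (n : ℕ) (ω₀ : Ω) :
    atom Y n ω₀ = DependsOnPast.past Y n ⁻¹' {DependsOnPast.past Y n ω₀} :=
  Set.ext fun _ => past_eq_past_iff.symm.trans eq_comm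

theorem measurableSet_history_atom (Y : ℕ → Ω → Fin d) (n : ℕ) (ω₀ : Ω) :
    MeasurableSet[history Y n] (atom Y n ω₀) := by
  rw [atom_eq_preimage]
  exact DependsOnPast.measurable_past_history Y n (measurableSet_singleton _)

theorem history_mono (Y : ℕ → Ω → Fin d) : Monotone (history Y) := fun _ m hnm =>
  iSup_le fun i => le_iSup (fun i : Fin (m + 1) => MeasurableSpace.comap (Y i) inferInstance)
    (⟨i, i.2.trans_le (Nat.succ_le_succ hnm)⟩ : Fin (m + 1))

theorem dependsOnPast_of_measurable {Y : ℕ → Ω → Fin d} {n : ℕ} {f : Ω → ℝ}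
    (hf : Measurable[history Y n] f) : DependsOnPast Y n f := by
  intro ω ω' h
  have hle : history Y n ≤ MeasurableSpace.comap (DependsOnPast.past Y n) ⊤ := by
    refine iSup_le fun i => ?_
    rintro _ ⟨t, -, rfl⟩
    exact ⟨(fun x => x i) ⁻¹' t, trivial, rfl⟩
  obtain ⟨t, -, ht⟩ := hle _ (hf (measurableSet_singleton (f ω)))
  have hω : ω ∈ DependsOnPast.past Y n ⁻¹' t := by
    rw [ht]
    rfl
  have hω' : ω' ∈ DependsOnPast.past Y n ⁻¹' t := by
    rwa [Set.mem_preimage, ← past_eq_past_iff.2 h]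
  rw [ht] at hω'
  exact (Set.mem_singleton_iff.1 hω').symm

theorem dependsOnPast_indicator_atom (Y : ℕ → Ω → Fin d) (n : ℕ) (ω₀ : Ω) :
    DependsOnPast Y n ((atom Y n ω₀).indicator fun _ => (1 : ℝ)) :=
  dependsOnPast_of_measurable <|
    (@measurable_const _ _ _ (history Y n) (1 : ℝ)).indicator (measurableSet_history_atom Y n ω₀)

theorem indicator_atom_nonneg (Y : ℕ → Ω → Fin d) (n : ℕ) (ω₀ ω : Ω) :
    0 ≤ (atom Y n ω₀).indicator (fun _ => (1 : ℝ)) ω :=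
  Set.indicator_nonneg (fun _ _ => zero_le_one) ω

variable [mΩ : MeasurableSpace Ω] {μ : Measure Ω} {Y : ℕ → Ω → Fin d}

theorem measurableSet_atom (hY : ∀ n, Measurable (Y n)) (n : ℕ) (ω₀ : Ω) :
    MeasurableSet (atom Y n ω₀) :=
  history_le hY n _ (measurableSet_history_atom Y n ω₀)

theorem integral_indicator_atom (hY : ∀ n, Measurable (Y n)) (n : ℕ) (ω₀ : Ω) :
    ∫ ω, (atom Y n ω₀).indicator (fun _ => (1 : ℝ)) ω ∂μ = μ.real (atom Y n ω₀) := by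
  rw [integral_indicator (measurableSet_atom hY n ω₀), setIntegral_const, smul_eq_mul, mul_one]

theorem ae_atom_ne_zero (Y : ℕ → Ω → Fin d) (n : ℕ) : ∀ᵐ ω ∂μ, μ (atom Y n ω) ≠ 0 := by
  rw [ae_iff]
  have hsub : {ω | ¬ μ (atom Y n ω) ≠ 0} ⊆ ⋃ x ∈ {x : Fin (n + 1) → Fin d |
      μ (DependsOnPast.past Y n ⁻¹' {x}) = 0}, DependsOnPast.past Y n ⁻¹' {x} := by
    intro ω hω
    simp only [ne_eq, not_not, Set.mem_ofPred_eq, atom_eq_preimage] at hω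
    exact Set.mem_biUnion (x := DependsOnPast.past Y n ω) hω rfl
  refine measure_mono_null hsub ?_
  rw [measure_biUnion_null_iff (Set.to_countable _)]
  exact fun x hx => hx

variable [IsProbabilityMeasure μ]

theorem condExp_indicator_mul_measureReal_atom (hY : ∀ n, Measurable (Y n)) {A : Set Ω}
    (hA : MeasurableSet A) (n : ℕ) (ω₀ : Ω) :
    (μ[A.indicator (fun _ => (1 : ℝ)) | history Y n]) ω₀ * μ.real (atom Y n ω₀)
      = μ.real (atom Y n ω₀ ∩ A) := by
  set f : Ω → ℝ := A.indicator fun _ => 1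
  have hdep : DependsOnPast Y n (μ[f | history Y n]) :=
    dependsOnPast_of_measurable (stronglyMeasurable_condExp (m := history Y n)).measurable
  calc (μ[f | history Y n]) ω₀ * μ.real (atom Y n ω₀)
      = ∫ ω in atom Y n ω₀, (μ[f | history Y n]) ω ∂μ := by
        rw [setIntegral_congr_fun (measurableSet_atom hY n ω₀)
          (fun ω hω => (hdep ω₀ ω hω).symm), setIntegral_const, smul_eq_mul, mul_comm]
    _ = ∫ ω in atom Y n ω₀, f ω ∂μ :=
        setIntegral_condExp (history_le hY n) ((integrable_const 1).indicator hA)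
          (measurableSet_history_atom Y n ω₀)
    _ = μ.real (atom Y n ω₀ ∩ A) := by
        rw [setIntegral_indicator hA, setIntegral_const, smul_eq_mul, mul_one]

theorem exists_atom_measureReal_sdiff_le (hY : ∀ n, Measurable (Y n)) {A : Set Ω}
    (hA : MeasurableSet[⨆ n, history Y n] A) (hpos : μ A ≠ 0) {ε : ℝ} (hε : 0 < ε) (n₀ : ℕ) :
    ∃ n ≥ n₀, ∃ ω₀, 0 < μ.real (atom Y n ω₀) ∧
      μ.real (atom Y n ω₀ \ A) ≤ ε * μ.real (atom Y n ω₀) := by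
  let ℱ : Filtration ℕ mΩ := ⟨history Y, history_mono Y, history_le hY⟩
  have hAm : MeasurableSet A := (iSup_le (history_le hY)) A hA
  let f : Ω → ℝ := A.indicator fun _ => 1
  have hfi : Integrable f μ := (integrable_const 1).indicator hAm
  have hfm : StronglyMeasurable[⨆ n, history Y n] f :=
    (@stronglyMeasurable_const _ _ (⨆ n, history Y n) _ 1).indicator hA
  have levy : ∀ᵐ ω ∂μ, Tendsto (fun n => (μ[f | ℱ n]) ω) atTop (𝓝 (f ω)) :=
    hfi.tendsto_ae_condExp hfm
  have hatom : ∀ᵐ ω ∂μ, ∀ n, μ (atom Y n ω) ≠ 0 := ae_all_iff.2 fun n => ae_atom_ne_zero Y n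
  obtain ⟨ω₀, hω₀, hlim, hne⟩ :=
    ((frequently_ae_mem_iff.2 hpos).and_eventually (levy.and hatom)).exists
  rw [show f ω₀ = 1 from Set.indicator_of_mem hω₀ _] at hlim
  obtain ⟨n, hcond, hn⟩ := ((hlim.eventually (lt_mem_nhds (show 1 - ε < 1 by linarith))).and
    (eventually_ge_atTop n₀)).exists
  refine ⟨n, hn, ω₀, ENNReal.toReal_pos (hne n) (measure_ne_top _ _), ?_⟩
  have hinter := condExp_indicator_mul_measureReal_atom (μ := μ) hY hAm n ω₀
  have hsplit := measureReal_inter_add_sdiff (μ := μ) (s := atom Y n ω₀) hAm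
  have hmul := mul_le_mul_of_nonneg_right hcond.le (measureReal_nonneg (μ := μ) (s := atom Y n ω₀))
  change (1 - ε) * _ ≤ (μ[f | history Y n]) ω₀ * _ at hmul
  linarith

end Levy

section Reducible

variable {d : ℕ} {Ω : Type*} [mΩ : MeasurableSpace Ω] {R : Matrix (Fin d) (Fin d) ℝ}
  {s p x : Fin d → ℝ} {y₀ : Fin d} {μ : Measure Ω} [IsProbabilityMeasure μ] {Y : ℕ → Ω → Fin d}

theorem IsInteriorCritical.eq_of_harmonic (hsymm : R.IsSymm) (hnonneg : ∀ i j, 0 ≤ R i j)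
    (hp : IsInteriorCritical R p) (hx : transition R p *ᵥ x = x) {i j : Fin d}
    (hij : R i j ≠ 0) : x i = x j :=
  eq_of_mulVec_eq_self (hp.transition_nonneg hnonneg) (fun i => sum_transition (hp.N_ne_zero i))
    hp.pos (hp.vecMul_transition hsymm) hx
    (div_ne_zero (mul_ne_zero hij (hp.pos j).ne') (hp.N_ne_zero i))

theorem tendsto_occupation_zero_of_forall_ne {y : ℕ → Fin d} {i : Fin d}
    (h : ∀ k, y (k + 1) ≠ i) :
    Tendsto (fun n => occupation s y n i) atTop (𝓝 0) := by
  have hweight : ∀ n, weight s y n i = s i := fun n => by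
    induction n with
    | zero => rfl
    | succ n ih => rw [weight_succ, ih, if_neg (h n), add_zero]
  simp only [occupation_eq, hweight]
  exact Tendsto.const_div_atTop
    (tendsto_atTop_add_const_left _ _ tendsto_natCast_atTop_atTop) _

namespace IsReinforcedProcess

theorem ae_step_ne_zero (hY : IsReinforcedProcess R s y₀ μ Y)
    (hs : ∀ i, 0 < s i) (k : ℕ) : ∀ᵐ ω ∂μ, R (Y k ω) (Y (k + 1) ω) ≠ 0 := by
  let f : Fin d → Fin d → ℝ := fun i j => if R i j = 0 then 1 else 0
  have hzero : ∀ v i j, transition R v i j * f i j = 0 := fun v i j => by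
    by_cases hR : R i j = 0
    · simp [transition, hR]
    · simp [f, hR]
  have hint : ∫ ω, f (Y k ω) (Y (k + 1) ω) ∂μ = 0 := by
    have h := hY.integral_step hs (F := fun j ω => f (Y k ω) j) fun j =>
      (DependsOnPast.self le_rfl).comp fun i => f i j
    simpa only [hzero, Finset.sum_const_zero, integral_zero] using h
  have hdep : DependsOnPast Y (k + 1) (fun ω => f (Y k ω) (Y (k + 1) ω)) :=
    (DependsOnPast.self (Nat.le_succ k)).comp₂ (DependsOnPast.self le_rfl) f
  rw [integral_eq_zero_iff_of_nonneg (fun ω => by dsimp only [f, Pi.zero_apply]; positivity)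
    (hdep.integrable hY.measurable)] at hint
  filter_upwards [hint] with ω hω hR
  simp [f, hR] at hω

theorem ae_eq_start_of_harmonic (hsymm : R.IsSymm) (hnonneg : ∀ i j, 0 ≤ R i j)
    (hp : IsInteriorCritical R p) (hY : IsReinforcedProcess R s y₀ μ Y) (hs : ∀ i, 0 < s i)
    (hx : transition R p *ᵥ x = x) : ∀ᵐ ω ∂μ, ∀ n, x (Y n ω) = x y₀ := by
  filter_upwards [ae_all_iff.2 (hY.ae_step_ne_zero hs), hY.start] with ω hω hω₀ n
  induction n with
  | zero => rw [hω₀]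
  | succ n ih => rw [← hp.eq_of_harmonic hsymm hnonneg hx (hω n), ih]

theorem measure_tendsto_of_not_isErgodicAt (hsymm : R.IsSymm)
    (hnonneg : ∀ i j, 0 ≤ R i j) (hp : IsInteriorCritical R p)
    (hY : IsReinforcedProcess R s y₀ μ Y) (hs : ∀ i, 0 < s i) (herg : ¬ IsErgodicAt R p) :
    μ {ω | Tendsto (fun n => occupation s (fun k => Y k ω) n) atTop (𝓝 p)} = 0 := by
  simp only [IsErgodicAt, not_forall] at herg
  obtain ⟨x, hx, i, j, hij⟩ := herg
  obtain ⟨k, hk⟩ : ∃ k, x k ≠ x y₀ := by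
    by_contra! hall
    exact hij (by rw [hall i, hall j])
  have hae : ∀ᵐ ω ∂μ, ¬ Tendsto (fun n => occupation s (fun k => Y k ω) n)
      atTop (𝓝 p) := by
    filter_upwards [hY.ae_eq_start_of_harmonic hsymm hnonneg hp hs hx] with ω hω hlim
    have hnever : ∀ m, Y (m + 1) ω ≠ k := fun m hm => hk (by rw [← hm, hω])
    exact (hp.pos k).ne' (tendsto_nhds_unique (tendsto_pi_nhds.1 hlim k)
      (tendsto_occupation_zero_of_forall_ne hnever))
  simpa only [ae_iff, not_not] using hae

end IsReinforcedProcess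

end Reducible

section TwoCopies

variable {Ω : Type*} [MeasurableSpace Ω]

theorem integral_prod_sub_sq {ρ : Measure Ω} [IsFiniteMeasure ρ] {M : Ω → ℝ} (hM : MemLp M 2 ρ) :
    ∫ x, (M x.1 - M x.2) ^ 2 ∂(ρ.prod ρ)
      = 2 * ρ.real Set.univ * ∫ ω, M ω ^ 2 ∂ρ - 2 * (∫ ω, M ω ∂ρ) ^ 2 := by
  have hM1 : Integrable M ρ := hM.integrable one_le_two
  have hM2 := hM.integrable_sq
  have hfst : Integrable (fun x : Ω × Ω => M x.1 ^ 2) (ρ.prod ρ) := hM2.comp_fst ρ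
  have hsnd : Integrable (fun x : Ω × Ω => M x.2 ^ 2) (ρ.prod ρ) := hM2.comp_snd ρ
  have hmul : Integrable (fun x : Ω × Ω => 2 * (M x.1 * M x.2)) (ρ.prod ρ) :=
    (hM1.mul_prod hM1).const_mul 2
  have hsum : Integrable (fun x : Ω × Ω => M x.1 ^ 2 + M x.2 ^ 2) (ρ.prod ρ) := hfst.add hsnd
  have hexpand : ∀ x : Ω × Ω, (M x.1 - M x.2) ^ 2
      = M x.1 ^ 2 + M x.2 ^ 2 - 2 * (M x.1 * M x.2) := fun x => by ring
  simp only [hexpand]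
  rw [integral_sub hsum hmul, integral_add hfst hsnd, integral_const_mul, integral_prod_mul,
    integral_fun_fst (fun ω => M ω ^ 2), integral_fun_snd (fun ω => M ω ^ 2)]
  simp only [smul_eq_mul]
  ring

theorem integral_prod_sub_sq_le {ρ : Measure Ω} [IsFiniteMeasure ρ] {M : Ω → ℝ}
    (hM : MemLp M 2 ρ) :
    ∫ x, (M x.1 - M x.2) ^ 2 ∂(ρ.prod ρ) ≤ 2 * ρ.real Set.univ * ∫ ω, M ω ^ 2 ∂ρ := by
  rw [integral_prod_sub_sq hM]
  linarith [sq_nonneg (∫ ω, M ω ∂ρ)]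

theorem sq_integral_le {ρ : Measure Ω} [IsFiniteMeasure ρ] {M : Ω → ℝ} (hM : MemLp M 2 ρ) :
    (∫ ω, M ω ∂ρ) ^ 2 ≤ ρ.real Set.univ * ∫ ω, M ω ^ 2 ∂ρ := by
  have h : 0 ≤ ∫ x, (M x.1 - M x.2) ^ 2 ∂(ρ.prod ρ) := integral_nonneg fun x => sq_nonneg _
  rw [integral_prod_sub_sq hM] at h
  linarith

variable {μ : Measure Ω} {E F : Set Ω} {M : Ω → ℝ} {a b g t v : ℝ}

theorem setIntegral_eq_integral_indicator_mul (hE : MeasurableSet E) (f : Ω → ℝ) :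
    ∫ ω in E, f ω ∂μ = ∫ ω, E.indicator (fun _ => (1 : ℝ)) ω * f ω ∂μ := by
  rw [← integral_indicator hE]
  congr 1
  ext ω
  by_cases h : ω ∈ E <;> simp [h]

theorem setIntegral_add_setIntegral_sdiff {f : Ω → ℝ} (hE : MeasurableSet E)
    (hF : MeasurableSet F) (hFE : F ⊆ E) (hf : Integrable f μ) :
    ∫ ω in F, f ω ∂μ + ∫ ω in E \ F, f ω ∂μ = ∫ ω in E, f ω ∂μ := by
  rw [← setIntegral_union Set.disjoint_sdiff_right (hE.diff hF) hf.integrableOn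
    hf.integrableOn, Set.union_sdiff_cancel hFE]

theorem setIntegral_sdiff_le {f : Ω → ℝ} (hf : Integrable f μ) (hf0 : ∀ ω, 0 ≤ f ω)
    (E F : Set Ω) : ∫ ω in E \ F, f ω ∂μ ≤ ∫ ω in E, f ω ∂μ :=
  setIntegral_mono_set hf.integrableOn (Eventually.of_forall hf0)
    Set.sdiff_subset.eventuallyLE

variable [IsFiniteMeasure μ]

theorem setIntegral_sq_le (hM2 : Integrable (fun ω => M ω ^ 2) μ)
    (hM4 : Integrable (fun ω => M ω ^ 4) μ) (ht : 0 < t) (E : Set Ω) :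
    ∫ ω in E, M ω ^ 2 ∂μ ≤ t * μ.real E + (∫ ω in E, M ω ^ 4 ∂μ) / (4 * t) := by
  have hamgm : ∀ x : ℝ, x ^ 2 ≤ t + 1 / (4 * t) * x ^ 4 := fun x => by
    have hsq : t + 1 / (4 * t) * x ^ 4 - x ^ 2 = (x ^ 2 - 2 * t) ^ 2 / (4 * t) := by
      field_simp
      ring
    have : 0 ≤ (x ^ 2 - 2 * t) ^ 2 / (4 * t) := by positivity
    linarith
  calc ∫ ω in E, M ω ^ 2 ∂μ ≤ ∫ ω in E, (t + 1 / (4 * t) * M ω ^ 4) ∂μ :=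
        integral_mono hM2.integrableOn ((integrable_const t).add (hM4.integrableOn.const_mul _))
          fun ω => hamgm _
    _ = t * μ.real E + (∫ ω in E, M ω ^ 4 ∂μ) / (4 * t) := by
        rw [integral_add (integrable_const t) (hM4.integrableOn.const_mul _), integral_const,
          measureReal_restrict_apply_univ, smul_eq_mul, integral_const_mul]
        ring

theorem sq_setIntegral_le_of_setIntegral_eq_zero (hE : MeasurableSet E) (hF : MeasurableSet F)
    (hFE : F ⊆ E) (hM : MemLp M 2 μ) (hmean : ∫ ω in E, M ω ∂μ = 0) :
    (∫ ω in F, M ω ∂μ) ^ 2 ≤ μ.real (E \ F) * ∫ ω in E, M ω ^ 2 ∂μ := by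
  have hsplit := setIntegral_add_setIntegral_sdiff hE hF hFE (hM.integrable one_le_two)
  rw [hmean, add_eq_zero_iff_eq_neg] at hsplit
  have hcs := sq_integral_le (hM.restrict (E \ F))
  rw [measureReal_restrict_apply_univ] at hcs
  rw [hsplit, neg_sq]
  exact hcs.trans (mul_le_mul_of_nonneg_left
    (setIntegral_sdiff_le hM.integrable_sq (fun ω => sq_nonneg _) E F) measureReal_nonneg)

/- The fourth moment keeps the second moment of `M` from concentrating on `E \ F`. -/
theorem le_integral_prod_sub_sq (hE : MeasurableSet E) (hF : MeasurableSet F) (hFE : F ⊆ E)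
    (hM : MemLp M 2 μ) (hM4 : Integrable (fun ω => M ω ^ 4) μ) (ht : 0 < t)
    (hmean : ∫ ω in E, M ω ∂μ = 0) (hv : v ≤ ∫ ω in E, M ω ^ 2 ∂μ)
    (ha : ∫ ω in E, M ω ^ 2 ∂μ ≤ a) (hb : ∫ ω in E, M ω ^ 4 ∂μ ≤ b) (hg : μ.real (E \ F) ≤ g) :
    2 * μ.real F * (v - (t * g + b / (4 * t))) - 2 * (g * a)
      ≤ ∫ x, (M x.1 - M x.2) ^ 2 ∂((μ.restrict F).prod (μ.restrict F)) := by
  have hrest : ∫ ω in E \ F, M ω ^ 2 ∂μ ≤ t * g + b / (4 * t) := by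
    refine (setIntegral_sq_le hM.integrable_sq hM4 ht _).trans ?_
    gcongr
    exact (setIntegral_sdiff_le hM4 (fun ω => by positivity) E F).trans hb
  have hsplit := setIntegral_add_setIntegral_sdiff hE hF hFE hM.integrable_sq
  have hvar : v - (t * g + b / (4 * t)) ≤ ∫ ω in F, M ω ^ 2 ∂μ := by linarith
  have hcs : (∫ ω in F, M ω ∂μ) ^ 2 ≤ g * a :=
    (sq_setIntegral_le_of_setIntegral_eq_zero hE hF hFE hM hmean).trans
      (mul_le_mul hg ha (integral_nonneg fun ω => sq_nonneg _) (measureReal_nonneg.trans hg))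
  rw [integral_prod_sub_sq (hM.restrict F), measureReal_restrict_apply_univ]
  have hmul := mul_le_mul_of_nonneg_left hvar (measureReal_nonneg (μ := μ) (s := F))
  linarith

end TwoCopies

section NoiseLowerBound

variable {d : ℕ} {Ω : Type*} [mΩ : MeasurableSpace Ω] {μ : Measure Ω} [IsProbabilityMeasure μ]
  {Y : ℕ → Ω → Fin d} {ξ : ℕ → Ω → ℝ} {C : ℝ} {n m : ℕ} {α : ℕ → ℝ} {q : ℝ}

namespace IsNoise

theorem setIntegral_atom_sum (hξ : IsNoise μ Y ξ C) (hY : ∀ n, Measurable (Y n)) (ω₀ : Ω) :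
    ∫ ω in atom Y n ω₀, ∑ l ∈ Finset.Ico n m, α l * ξ l ω ∂μ = 0 := by
  rw [setIntegral_eq_integral_indicator_mul (measurableSet_atom hY n ω₀)]
  exact hξ.integral_sum hY (dependsOnPast_indicator_atom Y n ω₀) α le_rfl

theorem setIntegral_atom_sum_sq_le (hξ : IsNoise μ Y ξ C) (hY : ∀ n, Measurable (Y n)) {k : ℕ}
    (hk : n ≤ k) (hm : k ≤ m) (hq : ∑ l ∈ Finset.Ico k m, α l ^ 2 ≤ q) (ω₀ : Ω) :
    ∫ ω in atom Y n ω₀, (∑ l ∈ Finset.Ico k m, α l * ξ l ω) ^ 2 ∂μ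
      ≤ C ^ 2 * q * μ.real (atom Y n ω₀) := by
  rw [setIntegral_eq_integral_indicator_mul (measurableSet_atom hY n ω₀)]
  refine (hξ.integral_sum_sq_le hY (dependsOnPast_indicator_atom Y n ω₀)
    (indicator_atom_nonneg Y n ω₀) α hk hm).trans ?_
  rw [integral_indicator_atom hY]
  gcongr

theorem setIntegral_atom_sum_pow_four_le (hξ : IsNoise μ Y ξ C) (hY : ∀ n, Measurable (Y n))
    (hm : n ≤ m) (hq : ∑ l ∈ Finset.Ico n m, α l ^ 2 ≤ q) (ω₀ : Ω) :
    ∫ ω in atom Y n ω₀, (∑ l ∈ Finset.Ico n m, α l * ξ l ω) ^ 4 ∂μ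
      ≤ 11 * C ^ 4 * q ^ 2 * μ.real (atom Y n ω₀) := by
  rw [setIntegral_eq_integral_indicator_mul (measurableSet_atom hY n ω₀)]
  refine (hξ.integral_sum_pow_four_le hY (dependsOnPast_indicator_atom Y n ω₀)
    (indicator_atom_nonneg Y n ω₀) α le_rfl hm).trans ?_
  rw [integral_indicator_atom hY]
  have : 0 ≤ ∑ l ∈ Finset.Ico n m, α l ^ 2 := Finset.sum_nonneg fun l _ => sq_nonneg _
  gcongr

theorem le_integral_prod_sub_sq (hξ : IsNoise μ Y ξ C) (hY : ∀ n, Measurable (Y n))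
    {F : Set Ω} {ω₀ : Ω} (hF : MeasurableSet F) (hFE : F ⊆ atom Y n ω₀) (hm : n ≤ m)
    {t ε v : ℝ} (ht : 0 < t) (hq : ∑ l ∈ Finset.Ico n m, α l ^ 2 ≤ q)
    (hEF : μ.real (atom Y n ω₀ \ F) ≤ ε * μ.real (atom Y n ω₀))
    (hv : v ≤ ∫ ω in atom Y n ω₀, (∑ l ∈ Finset.Ico n m, α l * ξ l ω) ^ 2 ∂μ) :
    2 * μ.real F * (v - (t * ε + 11 * C ^ 4 * q ^ 2 / (4 * t)) * μ.real (atom Y n ω₀))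
      - 2 * (ε * (C ^ 2 * q)) * μ.real (atom Y n ω₀) ^ 2
      ≤ ∫ x, (∑ l ∈ Finset.Ico n m, α l * ξ l x.1 - ∑ l ∈ Finset.Ico n m, α l * ξ l x.2) ^ 2
          ∂((μ.restrict F).prod (μ.restrict F)) := by
  have hdep := hξ.dep_sum α n m
  refine le_trans (le_of_eq ?_) (VRRW.le_integral_prod_sub_sq (measurableSet_atom hY n ω₀) hF hFE
    (hdep.memLp_two hY) ((hdep.comp fun x => x ^ 4).integrable hY) ht
    (hξ.setIntegral_atom_sum hY ω₀) hv (hξ.setIntegral_atom_sum_sq_le hY le_rfl hm hq ω₀)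
    (hξ.setIntegral_atom_sum_pow_four_le hY hm hq ω₀) hEF)
  ring

end IsNoise

end NoiseLowerBound

section Corrected

variable {d : ℕ}

/-- The occupation vector, corrected so that its increments are drift plus martingale noise up to
an error of second order. -/
noncomputable def corrected (R : Matrix (Fin d) (Fin d) ℝ) (p s : Fin d → ℝ) (y : ℕ → Fin d)
    (k : ℕ) : Fin d → ℝ :=
  fun i => occupation s y k i + fundamentalStep R p (occupation s y k) (y k) i / (∑ j, s j + k)

/-- The second order error in the increments of `corrected`. -/
noncomputable def remainder (R : Matrix (Fin d) (Fin d) ℝ) (p s : Fin d → ℝ) (y : ℕ → Fin d)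
    (k : ℕ) : Fin d → ℝ :=
  fun i => fundamentalStep R p (occupation s y (k + 1)) (y (k + 1)) i
    - fundamentalStep R p (occupation s y k) (y (k + 1)) i
    - fundamentalStep R p (occupation s y k) (y k) i / (∑ j, s j + k)

/-- The step sizes of the occupation vector. -/
noncomputable def stepSize (s : Fin d → ℝ) (k : ℕ) : ℝ := 1 / (∑ j, s j + (k + 1))

/-- The increment of noise at a step from `i` to `j`, cut off outside a ball about `p`. -/
noncomputable def noiseAt (R : Matrix (Fin d) (Fin d) ℝ) (p : Fin d → ℝ) (δ : ℝ) (ℓ v : Fin d → ℝ)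
    (i j : Fin d) : ℝ :=
  (Metric.ball p δ).indicator
    (fun v => (fundamental R p v *ᵥ ℓ) j - (fundamentalStep R p v *ᵥ ℓ) i) v

/-- The martingale noise in the increments of `ℓ ⬝ᵥ corrected`. -/
noncomputable def noise (R : Matrix (Fin d) (Fin d) ℝ) (p s : Fin d → ℝ) (δ : ℝ) (ℓ : Fin d → ℝ)
    (y : ℕ → Fin d) (k : ℕ) : ℝ :=
  noiseAt R p δ ℓ (occupation s y k) (y k) (y (k + 1))

/-- What remains of the increments of `ℓ ⬝ᵥ corrected` after the noise and the linear drift of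
rate `κ` are removed. -/
noncomputable def rest (R : Matrix (Fin d) (Fin d) ℝ) (p s : Fin d → ℝ) (κ : ℝ) (ℓ : Fin d → ℝ)
    (y : ℕ → Fin d) (k : ℕ) : ℝ :=
  ℓ ⬝ᵥ drift R (occupation s y k) + ℓ ⬝ᵥ remainder R p s y k - κ * (ℓ ⬝ᵥ corrected R p s y k)

theorem abs_dotProduct_le {v w : Fin d → ℝ} {B c : ℝ} (hB : ∑ i, |v i| ≤ B) (hc : 0 ≤ c)
    (h : ∀ i, |w i| ≤ c) : |v ⬝ᵥ w| ≤ B * c :=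
  calc |v ⬝ᵥ w| ≤ ∑ i, |v i * w i| := Finset.abs_sum_le_sum_abs _ _
    _ ≤ ∑ i, |v i| * c := Finset.sum_le_sum fun i _ => by
        rw [abs_mul]
        exact mul_le_mul_of_nonneg_left (h i) (abs_nonneg _)
    _ = (∑ i, |v i|) * c := by rw [Finset.sum_mul]
    _ ≤ B * c := mul_le_mul_of_nonneg_right hB hc

theorem IsEigenframe.abs_apply_le_sqrt {S : Matrix (Fin d) (Fin d) ℝ} {p κ : Fin d → ℝ}
    {ℓ : Fin d → Fin d → ℝ} (hℓ : IsEigenframe S p κ ℓ) (hp : ∀ i, 0 < p i) (hp1 : ∀ i, p i ≤ 1)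
    (w : Fin d → ℝ) (i : Fin d) : |w i| ≤ √(∑ j, (ℓ j ⬝ᵥ w) ^ 2) := by
  rw [← Real.sqrt_sq_eq_abs, ← hℓ.sum_sq_div_eq (fun i => (hp i).ne') w]
  refine Real.sqrt_le_sqrt ((le_div_self (sq_nonneg _) (hp i) (hp1 i)).trans ?_)
  exact Finset.single_le_sum (f := fun i => w i ^ 2 / p i)
    (fun i _ => div_nonneg (sq_nonneg _) (hp i).le) (Finset.mem_univ i)

variable {R : Matrix (Fin d) (Fin d) ℝ} {p s ℓ : Fin d → ℝ} {y : ℕ → Fin d} {C σ ε δ : ℝ}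
  {i₀ : Fin d} {k : ℕ}

theorem noise_eq_dotProduct (hk : occupation s y k ∈ Metric.ball p δ) (ℓ : Fin d → ℝ) :
    noise R p s δ ℓ y k = ℓ ⬝ᵥ fun i => fundamental R p (occupation s y k) (y (k + 1)) i
      - fundamentalStep R p (occupation s y k) (y k) i := by
  rw [noise, noiseAt, Set.indicator_of_mem hk]
  simp only [mulVec, dotProduct, ← Finset.sum_sub_distrib]
  exact Finset.sum_congr rfl fun i _ => by ring

namespace LocalEstimates

theorem const_nonneg (hloc : LocalEstimates R p ℓ C σ i₀ ε δ) : 0 ≤ C :=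
  (abs_nonneg _).trans (hloc.abs_fundamental_le p (Metric.mem_ball_self hloc.pos) i₀ i₀)

theorem corrected_succ_sub (hs : ∀ i, 0 < s i) (hloc : LocalEstimates R p ℓ C σ i₀ ε δ)
    (hk : occupation s y k ∈ Metric.ball p δ) (i : Fin d) :
    corrected R p s y (k + 1) i - corrected R p s y k i = stepSize s k *
      (drift R (occupation s y k) i + remainder R p s y k i
        + (fundamental R p (occupation s y k) (y (k + 1)) i
          - fundamentalStep R p (occupation s y k) (y k) i)) := by
  have hs_pos := sum_pos_of_pos hs i
  have htotal : (∑ j, s j + (k : ℝ)) ≠ 0 := by positivity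
  have htotal_succ : (∑ j, s j + ((k : ℝ) + 1)) ≠ 0 := by positivity
  have hpoisson : (if y (k + 1) = i then (1 : ℝ) else 0)
      = fundamental R p (occupation s y k) (y (k + 1)) i
        - fundamentalStep R p (occupation s y k) (y (k + 1)) i + stat R (occupation s y k) i :=
    (eq_add_of_sub_eq (hloc.poisson _ hk (y (k + 1)) i).symm)
  have hocc := eq_add_of_sub_eq' (occupation_succ_sub (y := y) hs k i)
  rw [hpoisson] at hocc
  simp only [corrected, remainder, stepSize, drift, Pi.sub_apply]
  rw [hocc]
  push_cast
  field_simp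
  ring

theorem dotProduct_corrected_succ {ℓ' : Fin d → ℝ} (hs : ∀ i, 0 < s i)
    (hloc : LocalEstimates R p ℓ' C σ i₀ ε δ) (hk : occupation s y k ∈ Metric.ball p δ) (κ : ℝ)
    (ℓ : Fin d → ℝ) :
    ℓ ⬝ᵥ corrected R p s y (k + 1) = ℓ ⬝ᵥ corrected R p s y k + stepSize s k *
      (κ * (ℓ ⬝ᵥ corrected R p s y k) + (rest R p s κ ℓ y k + noise R p s δ ℓ y k)) := by
  have h : corrected R p s y (k + 1) = corrected R p s y k + stepSize s k •
      (drift R (occupation s y k) + remainder R p s y k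
        + fun i => fundamental R p (occupation s y k) (y (k + 1)) i
          - fundamentalStep R p (occupation s y k) (y k) i) :=
    funext fun i => eq_add_of_sub_eq' (hloc.corrected_succ_sub hs hk i)
  rw [h, dotProduct_add, dotProduct_smul, dotProduct_add, dotProduct_add,
    ← noise_eq_dotProduct hk, rest, smul_eq_mul]
  ring

theorem abs_remainder_le (hs : ∀ i, 0 < s i) (hloc : LocalEstimates R p ℓ C σ i₀ ε δ)
    (hk : occupation s y k ∈ Metric.ball p δ) (hk' : occupation s y (k + 1) ∈ Metric.ball p δ)
    (i : Fin d) : |remainder R p s y k i| ≤ 2 * (C / (∑ j, s j + k)) := by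
  have hC := hloc.const_nonneg
  have hs_pos := sum_pos_of_pos hs i
  have hT : 0 < ∑ j, s j + (k : ℝ) := by positivity
  have hnorm : ‖occupation s y (k + 1) - occupation s y k‖ ≤ 1 / (∑ j, s j + k) := by
    refine (pi_norm_le_iff_of_nonneg (by positivity)).2 fun j => ?_
    refine (abs_occupation_succ_sub_le hs k j).trans (one_div_le_one_div_of_le hT ?_)
    linarith
  have hmove : |fundamentalStep R p (occupation s y (k + 1)) (y (k + 1)) i
      - fundamentalStep R p (occupation s y k) (y (k + 1)) i| ≤ C / (∑ j, s j + k) := by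
    refine (hloc.lipschitz _ hk' _ hk (y (k + 1)) i).trans ?_
    rw [div_eq_mul_one_div C]
    gcongr
  have hlast : |fundamentalStep R p (occupation s y k) (y k) i / (∑ j, s j + k)|
      ≤ C / (∑ j, s j + k) := by
    rw [abs_div, abs_of_pos hT]
    have := hloc.abs_fundamentalStep_le _ hk (y k) i
    gcongr
  refine (abs_sub _ _).trans ?_
  linarith

theorem abs_corrected_sub_le (hs : ∀ i, 0 < s i) (hloc : LocalEstimates R p ℓ C σ i₀ ε δ)
    (hk : occupation s y k ∈ Metric.ball p δ) (i : Fin d) :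
    |corrected R p s y k i - occupation s y k i| ≤ C / (∑ j, s j + k) := by
  have hs_pos := sum_pos_of_pos hs i
  have hT : 0 < ∑ j, s j + (k : ℝ) := by positivity
  rw [corrected, add_sub_cancel_left, abs_div, abs_of_pos hT]
  have := hloc.abs_fundamentalStep_le _ hk (y k) i
  gcongr

theorem abs_noise_le {ℓ' : Fin d → ℝ} {B : ℝ} (hloc : LocalEstimates R p ℓ' C σ i₀ ε δ)
    (hB : ∑ i, |ℓ i| ≤ B) (y : ℕ → Fin d) (k : ℕ) : |noise R p s δ ℓ y k| ≤ 2 * C * B := by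
  have hC := hloc.const_nonneg
  have hB0 : 0 ≤ B := (Finset.sum_nonneg fun i _ => abs_nonneg _).trans hB
  by_cases hk : occupation s y k ∈ Metric.ball p δ
  · rw [noise_eq_dotProduct hk]
    refine (abs_dotProduct_le hB (by positivity) fun i => ?_).trans (mul_comm _ _).le
    have hnew := hloc.abs_fundamental_le _ hk (y (k + 1)) i
    have hold := hloc.abs_fundamentalStep_le _ hk (y k) i
    exact (abs_sub _ _).trans (by linarith)
  · rw [noise, noiseAt, Set.indicator_of_notMem hk, abs_zero]
    positivity

end LocalEstimates

section TwoPaths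

variable {ℓ' κ : Fin d → ℝ} {ℓ : Fin d → Fin d → ℝ} {y' : ℕ → Fin d} {B K : ℝ}

theorem LocalEstimates.norm_occupation_sub_le (hs : ∀ i, 0 < s i)
    (hloc : LocalEstimates R p ℓ' C σ i₀ ε δ) (hp : IsInteriorCritical R p)
    (hℓ : IsEigenframe (jacobianForm R p) p κ ℓ) (hk : occupation s y k ∈ Metric.ball p δ)
    (hk' : occupation s y' k ∈ Metric.ball p δ) :
    ‖occupation s y k - occupation s y' k‖ ≤
      √(∑ i, (ℓ i ⬝ᵥ corrected R p s y k - ℓ i ⬝ᵥ corrected R p s y' k) ^ 2)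
        + 2 * (C / (∑ j, s j + k)) := by
  have hC := hloc.const_nonneg
  have hs_pos := sum_pos_of_pos hs i₀
  refine (pi_norm_le_iff_of_nonneg (by positivity)).2 fun i => ?_
  have hframe := abs_le.1
    (hℓ.abs_apply_le_sqrt hp.pos hp.le_one (corrected R p s y k - corrected R p s y' k) i)
  have hcorr := abs_le.1 (hloc.abs_corrected_sub_le hs hk i)
  have hcorr' := abs_le.1 (hloc.abs_corrected_sub_le hs hk' i)
  simp only [dotProduct_sub, Pi.sub_apply] at hframe
  rw [Pi.sub_apply, Real.norm_eq_abs, abs_le]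
  constructor <;> linarith [hframe.1, hframe.2, hcorr.1, hcorr.2, hcorr'.1, hcorr'.2]

theorem LocalEstimates.abs_remainder_sub_corrected_le (hs : ∀ i, 0 < s i)
    (hloc : LocalEstimates R p ℓ' C σ i₀ ε δ) (hB : ∀ j, ∑ i, |ℓ j i| ≤ B) (hK : ∀ j, |κ j| ≤ K)
    (hk : occupation s y k ∈ Metric.ball p δ) (hk' : occupation s y (k + 1) ∈ Metric.ball p δ)
    (j : Fin d) :
    |ℓ j ⬝ᵥ remainder R p s y k - κ j * (ℓ j ⬝ᵥ (corrected R p s y k - occupation s y k))|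
      ≤ B * (2 + K) * (C / (∑ i, s i + k)) := by
  have hC := hloc.const_nonneg
  have hs_pos := sum_pos_of_pos hs i₀
  have hq : 0 ≤ C / (∑ i, s i + (k : ℝ)) := by positivity
  have hrem := abs_dotProduct_le (hB j) (by positivity) (hloc.abs_remainder_le hs hk hk')
  have hcorr := abs_dotProduct_le (hB j) hq (w := corrected R p s y k - occupation s y k)
    (hloc.abs_corrected_sub_le hs hk)
  have hscaled := mul_le_mul (hK j) hcorr (abs_nonneg _) ((abs_nonneg _).trans (hK j))
  refine (abs_sub _ _).trans ?_
  rw [abs_mul]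
  linarith

theorem rest_sub_rest {S : Matrix (Fin d) (Fin d) ℝ} {j : Fin d}
    (h : ∀ w, ℓ j ⬝ᵥ S *ᵥ w = κ j * (ℓ j ⬝ᵥ w)) (y y' : ℕ → Fin d) (k : ℕ) :
    rest R p s (κ j) (ℓ j) y k - rest R p s (κ j) (ℓ j) y' k =
      ℓ j ⬝ᵥ (drift R (occupation s y k) - drift R (occupation s y' k)
          - S *ᵥ (occupation s y k - occupation s y' k))
        + (ℓ j ⬝ᵥ remainder R p s y k
          - κ j * (ℓ j ⬝ᵥ (corrected R p s y k - occupation s y k)))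
        - (ℓ j ⬝ᵥ remainder R p s y' k
          - κ j * (ℓ j ⬝ᵥ (corrected R p s y' k - occupation s y' k))) := by
  simp only [rest, dotProduct_sub, h]
  ring

variable {τ : ℝ}

theorem LocalEstimates.abs_rest_sub_le (hs : ∀ i, 0 < s i)
    (hloc : LocalEstimates R p ℓ' C σ i₀ ε δ) (hε : 0 ≤ ε) (hε1 : ε ≤ 1) (hsymm : R.IsSymm)
    (hp : IsInteriorCritical R p) (hℓ : IsEigenframe (jacobianForm R p) p κ ℓ)
    (hB : ∀ j, ∑ i, |ℓ j i| ≤ B) (hK : ∀ j, |κ j| ≤ K)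
    (hy : ∀ m ∈ Set.Icc k (k + 1), occupation s y m ∈ Metric.ball p δ)
    (hy' : ∀ m ∈ Set.Icc k (k + 1), occupation s y' m ∈ Metric.ball p δ) (j : Fin d) :
    |rest R p s (κ j) (ℓ j) y k - rest R p s (κ j) (ℓ j) y' k| ≤
      B * ε * √(∑ i, (ℓ i ⬝ᵥ corrected R p s y k - ℓ i ⬝ᵥ corrected R p s y' k) ^ 2)
        + B * C * (6 + 2 * K) / (∑ i, s i + k) := by
  have hC := hloc.const_nonneg
  have hs_pos := sum_pos_of_pos hs i₀
  have hB0 : 0 ≤ B := (Finset.sum_nonneg fun i _ => abs_nonneg _).trans (hB j)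
  have hk := hy k ⟨le_rfl, k.le_succ⟩
  have hk' := hy' k ⟨le_rfl, k.le_succ⟩
  have hlin := abs_dotProduct_le (hB j) (by positivity) fun i =>
    ((norm_le_pi_norm _ i).trans (hloc.linearize _ hk _ hk')).trans
      (mul_le_mul_of_nonneg_left (hloc.norm_occupation_sub_le hs hp hℓ hk hk') hε)
  have hone := hloc.abs_remainder_sub_corrected_le hs hB hK hk (hy _ ⟨k.le_succ, le_rfl⟩) j
  have htwo := hloc.abs_remainder_sub_corrected_le hs hB hK hk' (hy' _ ⟨k.le_succ, le_rfl⟩) j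
  have hsmall : ε * (B * (2 * (C / (∑ i, s i + k)))) ≤ 1 * (B * (2 * (C / (∑ i, s i + k)))) := by
    gcongr
  rw [rest_sub_rest (hℓ.dotProduct_diagonal_mul_mulVec (isSymm_jacobianForm hsymm) j)]
  refine (abs_sub _ _).trans ((add_le_add_left (abs_add_le _ _) _).trans ?_)
  have hT : B * C * (6 + 2 * K) / (∑ i, s i + (k : ℝ))
      = (6 + 2 * K) * (B * (C / (∑ i, s i + k))) := by ring
  rw [hT]
  unfold jacobian at hlin
  linarith

theorem LocalEstimates.sq_rest_sub_le (hs : ∀ i, 0 < s i)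
    (hloc : LocalEstimates R p ℓ' C σ i₀ ε δ) (hε : 0 ≤ ε) (hε1 : ε ≤ 1) (hsymm : R.IsSymm)
    (hp : IsInteriorCritical R p) (hℓ : IsEigenframe (jacobianForm R p) p κ ℓ)
    (hB : ∀ j, ∑ i, |ℓ j i| ≤ B) (hK : ∀ j, |κ j| ≤ K) (hτ : 0 < τ) (hτk : τ ≤ ∑ j, s j + k)
    (hy : ∀ m ∈ Set.Icc k (k + 1), occupation s y m ∈ Metric.ball p δ)
    (hy' : ∀ m ∈ Set.Icc k (k + 1), occupation s y' m ∈ Metric.ball p δ) (j : Fin d) :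
    (rest R p s (κ j) (ℓ j) y k - rest R p s (κ j) (ℓ j) y' k) ^ 2 ≤
      2 * (B * ε) ^ 2 *
          ∑ i, (ℓ i ⬝ᵥ corrected R p s y k - ℓ i ⬝ᵥ corrected R p s y' k) ^ 2
        + 2 * (B * C * (6 + 2 * K)) ^ 2 / τ ^ 2 := by
  have hC := hloc.const_nonneg
  have hB0 : 0 ≤ B := (Finset.sum_nonneg fun i _ => abs_nonneg _).trans (hB j)
  have hK0 : 0 ≤ K := (abs_nonneg _).trans (hK j)
  set W := ∑ i, (ℓ i ⬝ᵥ corrected R p s y k - ℓ i ⬝ᵥ corrected R p s y' k) ^ 2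
  have habs : |rest R p s (κ j) (ℓ j) y k - rest R p s (κ j) (ℓ j) y' k|
      ≤ B * ε * √W + B * C * (6 + 2 * K) / τ :=
    (hloc.abs_rest_sub_le hs hε hε1 hsymm hp hℓ hB hK hy hy' j).trans (by gcongr)
  calc (rest R p s (κ j) (ℓ j) y k - rest R p s (κ j) (ℓ j) y' k) ^ 2
      ≤ (B * ε * √W + B * C * (6 + 2 * K) / τ) ^ 2 := sq_le_sq' (abs_le.1 habs).1 (abs_le.1 habs).2
    _ ≤ 2 * ((B * ε * √W) ^ 2 + (B * C * (6 + 2 * K) / τ) ^ 2) := add_sq_le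
    _ = 2 * (B * ε) ^ 2 * W + 2 * (B * C * (6 + 2 * K)) ^ 2 / τ ^ 2 := by
        rw [mul_pow (B * ε), Real.sq_sqrt (Finset.sum_nonneg fun i _ => sq_nonneg _), div_pow]
        ring

end TwoPaths

end Corrected

section ProcessNoise

variable {d : ℕ} {R : Matrix (Fin d) (Fin d) ℝ} {s p ℓ : Fin d → ℝ} {C σ ε δ : ℝ} {i₀ : Fin d}

theorem fundamentalStep_mulVec (R : Matrix (Fin d) (Fin d) ℝ) (p v ℓ : Fin d → ℝ) (i : Fin d) :
    (fundamentalStep R p v *ᵥ ℓ) i = ∑ j, transition R v i j * (fundamental R p v *ᵥ ℓ) j := by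
  rw [fundamentalStep, ← mulVec_mulVec]
  rfl

theorem sum_transition_mul_noiseAt {v : Fin d → ℝ} {i : Fin d}
    (hsum : ∑ j, transition R v i j = 1) (p ℓ : Fin d → ℝ) (δ : ℝ) :
    ∑ j, transition R v i j * noiseAt R p δ ℓ v i j = 0 := by
  unfold noiseAt
  by_cases hv : v ∈ Metric.ball p δ
  · simp only [Set.indicator_of_mem hv, mul_sub, Finset.sum_sub_distrib, ← Finset.sum_mul, hsum,
      ← fundamentalStep_mulVec, one_mul, sub_self]
  · simp only [Set.indicator_of_notMem hv, mul_zero, Finset.sum_const_zero]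

/-- The indicator of being in the state `i₀` while the occupation vector `v` is near `p`. -/
noncomputable def visit (p : Fin d → ℝ) (δ : ℝ) (i₀ : Fin d) (v : Fin d → ℝ) (i : Fin d) : ℝ :=
  (Metric.ball p δ).indicator (fun _ => if i = i₀ then (1 : ℝ) else 0) v

theorem visit_nonneg (p : Fin d → ℝ) (δ : ℝ) (i₀ : Fin d) (v : Fin d → ℝ) (i : Fin d) :
    0 ≤ visit p δ i₀ v i :=
  Set.indicator_nonneg (fun _ _ => by split_ifs <;> norm_num) v

theorem LocalEstimates.mul_visit_le (hloc : LocalEstimates R p ℓ C σ i₀ ε δ) {v : Fin d → ℝ}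
    {i : Fin d} (hnonneg : ∀ j, 0 ≤ transition R v i j) (hsum : ∑ j, transition R v i j = 1) :
    σ * visit p δ i₀ v i ≤ ∑ j, transition R v i j * noiseAt R p δ ℓ v i j ^ 2 := by
  unfold visit noiseAt
  by_cases hv : v ∈ Metric.ball p δ
  · simp only [Set.indicator_of_mem hv]
    split_ifs with hi
    · have hvar := hloc.le_stepVariance v hv
      rw [← hi, stepVariance_eq_sum hsum] at hvar
      rw [mul_one, fundamentalStep, ← mulVec_mulVec]
      exact hvar
    · rw [mul_zero]
      exact Finset.sum_nonneg fun j _ => mul_nonneg (hnonneg j) (sq_nonneg _)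
  · simp [Set.indicator_of_notMem hv]

variable {Ω : Type*} {Y : ℕ → Ω → Fin d}

theorem dependsOnPast_noiseAt (R : Matrix (Fin d) (Fin d) ℝ) (s p : Fin d → ℝ) (δ : ℝ)
    (ℓ : Fin d → ℝ) (Y : ℕ → Ω → Fin d) (k : ℕ) (j : Fin d) : DependsOnPast Y k
      (fun ω => noiseAt R p δ ℓ (occupation s (fun n => Y n ω) k) (Y k ω) j) :=
  (dependsOnPast_occupation s Y k).comp₂ (DependsOnPast.self le_rfl) fun v i =>
    noiseAt R p δ ℓ v i j

theorem dependsOnPast_noise (R : Matrix (Fin d) (Fin d) ℝ) (s p : Fin d → ℝ) (δ : ℝ)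
    (ℓ : Fin d → ℝ) (Y : ℕ → Ω → Fin d) (k : ℕ) : DependsOnPast Y (k + 1)
      (fun ω => noise R p s δ ℓ (fun n => Y n ω) k) :=
  (((dependsOnPast_occupation s Y k).comp₂ (DependsOnPast.self le_rfl) Prod.mk).mono
    k.le_succ).comp₂ (DependsOnPast.self le_rfl) fun x j => noiseAt R p δ ℓ x.1 x.2 j

theorem dependsOnPast_visit (s p : Fin d → ℝ) (δ : ℝ) (i₀ : Fin d) (Y : ℕ → Ω → Fin d) (k : ℕ) :
    DependsOnPast Y k (fun ω => visit p δ i₀ (occupation s (fun n => Y n ω) k) (Y k ω)) :=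
  (dependsOnPast_occupation s Y k).comp₂ (DependsOnPast.self le_rfl) (visit p δ i₀)

variable [mΩ : MeasurableSpace Ω] {μ : Measure Ω} [IsProbabilityMeasure μ] {y₀ : Fin d}

theorem IsReinforcedProcess.isNoise (hsymm : R.IsSymm) (hnonneg : ∀ i j, 0 ≤ R i j)
    (hcol : ∀ j, 0 < ∑ i, R i j) (hY : IsReinforcedProcess R s y₀ μ Y) (hs : ∀ i, 0 < s i)
    {ℓ' : Fin d → ℝ} (hloc : LocalEstimates R p ℓ' C σ i₀ ε δ) {B : ℝ} (hB : ∑ i, |ℓ i| ≤ B) :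
    IsNoise μ Y (fun k ω => noise R p s δ ℓ (fun n => Y n ω) k) (2 * C * B) where
  dep := dependsOnPast_noise R s p δ ℓ Y
  bound l ω := hloc.abs_noise_le hB _ l
  centered l G hG := by
    refine (hY.integral_step hs fun j =>
      hG.mul (dependsOnPast_noiseAt R s p δ ℓ Y l j)).trans ?_
    refine integral_eq_zero_of_ae (Eventually.of_forall fun ω => ?_)
    have hsum := sum_transition_occupation (y := fun n => Y n ω) hsymm hnonneg hcol hs l (Y l ω)
    simp only [mul_left_comm _ (G ω), ← Finset.mul_sum, sum_transition_mul_noiseAt hsum, mul_zero,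
      Pi.zero_apply]

theorem IsReinforcedProcess.le_integral_noise_sq (hsymm : R.IsSymm) (hnonneg : ∀ i j, 0 ≤ R i j)
    (hcol : ∀ j, 0 < ∑ i, R i j) (hY : IsReinforcedProcess R s y₀ μ Y) (hs : ∀ i, 0 < s i)
    (hloc : LocalEstimates R p ℓ C σ i₀ ε δ) {I : Ω → ℝ} {k : ℕ} (hI : DependsOnPast Y k I)
    (hI0 : ∀ ω, 0 ≤ I ω) :
    σ * ∫ ω, I ω * visit p δ i₀ (occupation s (fun n => Y n ω) k) (Y k ω) ∂μ
      ≤ ∫ ω, I ω * noise R p s δ ℓ (fun n => Y n ω) k ^ 2 ∂μ := by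
  have hF : ∀ j, DependsOnPast Y k
      (fun ω => I ω * noiseAt R p δ ℓ (occupation s (fun n => Y n ω) k) (Y k ω) j ^ 2) := fun j =>
    hI.comp₂ (dependsOnPast_noiseAt R s p δ ℓ Y k j) fun x y => x * y ^ 2
  refine le_of_le_of_eq ?_ (hY.integral_step hs hF).symm
  rw [← integral_const_mul]
  refine integral_mono
    (((hI.mul (dependsOnPast_visit s p δ i₀ Y k)).comp fun x => σ * x).integrable hY.measurable)
    ((DependsOnPast.sum fun j _ => (dependsOnPast_transition R s Y k j).mul (hF j)).integrable
      hY.measurable) fun ω => ?_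
  have hvisit := hloc.mul_visit_le
    (transition_nonneg hnonneg (fun i => (occupation_pos (y := fun n => Y n ω) hs k i).le) (Y k ω))
    (sum_transition_occupation hsymm hnonneg hcol hs k (Y k ω))
  simpa only [mul_left_comm _ (I ω), ← Finset.mul_sum] using
    mul_le_mul_of_nonneg_left hvisit (hI0 ω)

end ProcessNoise

section Steps

variable {d : ℕ} {s : Fin d → ℝ}

theorem stepSize_pos (hs : 0 < ∑ j, s j) (k : ℕ) : 0 < stepSize s k := by
  unfold stepSize
  positivity

theorem sq_stepSize_le (hs : 0 < ∑ j, s j) (k : ℕ) :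
    stepSize s k ^ 2 ≤ 1 / (∑ j, s j + k) - 1 / (∑ j, s j + (k + 1)) := by
  have hpos : 0 < ∑ j, s j + (k : ℝ) := by positivity
  have hpos_succ : 0 < ∑ j, s j + ((k : ℝ) + 1) := by positivity
  rw [div_sub_div _ _ hpos.ne' hpos_succ.ne', stepSize, div_pow, div_le_div_iff₀ (by positivity)
    (by positivity)]
  nlinarith

theorem sum_sq_stepSize_le (hs : 0 < ∑ j, s j) {n m : ℕ} (h : n ≤ m) :
    ∑ l ∈ Finset.Ico n m, stepSize s l ^ 2 ≤ 1 / (∑ j, s j + n) := by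
  have htel : ∑ l ∈ Finset.Ico n m, stepSize s l ^ 2
      ≤ 1 / (∑ j, s j + n) - 1 / (∑ j, s j + m) := by
    refine (Finset.sum_le_sum fun l _ => sq_stepSize_le hs l).trans_eq ?_
    have := Finset.sum_Ico_sub (fun l : ℕ => -(1 / (∑ j, s j + (l : ℝ)))) h
    push_cast at this
    simpa only [neg_sub_neg] using this
  exact htel.trans (sub_le_self _ (by positivity))

theorem tendsto_sum_stepSize (hs : 0 < ∑ j, s j) (k : ℕ) :
    Tendsto (fun m => ∑ i ∈ Finset.Ico k m, stepSize s i) atTop atTop := by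
  have hharm := (Real.tendsto_sum_range_one_div_nat_succ_atTop).const_mul_atTop
    (show 0 < 1 / (∑ j, s j + 1) by positivity)
  have hrange : Tendsto (fun m => ∑ i ∈ Finset.range m, stepSize s i)
      atTop atTop := by
    refine tendsto_atTop_mono (fun m => ?_) hharm
    rw [Finset.mul_sum]
    refine Finset.sum_le_sum fun i _ => ?_
    rw [stepSize, div_mul_div_comm, one_mul]
    refine one_div_le_one_div_of_le (by positivity) ?_
    nlinarith [Nat.cast_nonneg (α := ℝ) i]
  refine (tendsto_atTop_add_const_right _
    (-∑ i ∈ Finset.range k, stepSize s i) hrange).congr' ?_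
  filter_upwards [eventually_ge_atTop k] with m hm
  rw [Finset.sum_Ico_eq_sub _ hm, sub_eq_add_neg]

theorem growth_stepSize_le {κ : ℝ} (hκ : 0 ≤ κ) (hs : 0 < ∑ j, s j) {n m : ℕ} (hn : 1 ≤ n)
    (hm : m ≤ 2 * n + 1) : growth κ (stepSize s) n m ≤ Real.exp (2 * κ) := by
  have hn0 : (0 : ℝ) < n := by exact_mod_cast hn
  have hsum : ∑ i ∈ Finset.Ico n m, stepSize s i ≤ 2 := by
    refine (Finset.sum_le_card_nsmul _ _ (1 / (n : ℝ)) fun i hi => ?_).trans ?_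
    · have hi' : (n : ℝ) ≤ i := by exact_mod_cast (Finset.mem_Ico.1 hi).1
      exact one_div_le_one_div_of_le hn0 (by linarith)
    · rw [Nat.card_Ico, nsmul_eq_mul, mul_one_div, div_le_iff₀ hn0]
      exact_mod_cast show m - n ≤ 2 * n by lia
  calc growth κ (stepSize s) n m ≤ ∏ i ∈ Finset.Ico n m, Real.exp (κ * stepSize s i) := by
        refine Finset.prod_le_prod (fun i _ => ?_) fun i _ => ?_
        · have := (stepSize_pos hs i).le
          positivity
        · rw [add_comm]
          exact Real.add_one_le_exp _
    _ = Real.exp ((∑ i ∈ Finset.Ico n m, stepSize s i) * κ) := by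
        rw [← Real.exp_sum, ← Finset.mul_sum, mul_comm]
    _ ≤ Real.exp (2 * κ) := Real.exp_le_exp.2 (mul_le_mul_of_nonneg_right hsum hκ)

theorem le_inv_growth_mul_stepSize {κ : ℝ} (hκ : 0 ≤ κ) (hs : 0 < ∑ j, s j) {n l : ℕ} (hn : 1 ≤ n)
    (hl : l ≤ 2 * n) :
    (Real.exp (2 * κ))⁻¹ / (4 * (∑ j, s j + n))
      ≤ (growth κ (stepSize s) n (l + 1))⁻¹ * stepSize s l := by
  have hn1 : (1 : ℝ) ≤ n := by exact_mod_cast hn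
  have hl' : (l : ℝ) ≤ 2 * n := by exact_mod_cast hl
  have hgrowth : 0 < growth κ (stepSize s) n (l + 1) :=
    one_pos.trans_le (one_le_growth hκ (fun k => (stepSize_pos hs k).le) n _)
  have hstep : 1 / (4 * (∑ j, s j + n)) ≤ stepSize s l :=
    one_div_le_one_div_of_le (by positivity) (by linarith)
  rw [div_eq_mul_one_div]
  exact mul_le_mul (inv_anti₀ hgrowth (growth_stepSize_le hκ hs hn (by lia))) hstep
    (by positivity) (inv_nonneg.2 hgrowth.le)

theorem sum_visits (y : ℕ → Fin d) (i : Fin d) {n m : ℕ} (h : n ≤ m) :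
    ∑ l ∈ Finset.Ico (n + 1) (m + 1), (if y l = i then (1 : ℝ) else 0)
      = weight s y m i - weight s y n i := by
  rw [← Finset.sum_Ico_add' (fun l => if y l = i then (1 : ℝ) else 0),
    ← Finset.sum_Ico_sub (fun l => weight s y l i) h]
  exact Finset.sum_congr rfl fun l _ => by rw [weight_succ, add_sub_cancel_left]

theorem le_sum_visits {p : Fin d → ℝ} {y : ℕ → Fin d} {i : Fin d} {δ : ℝ} {n : ℕ}
    (hs : 0 < ∑ j, s j) (hn : ∑ j, s j ≤ n) (hδ : δ ≤ p i / 10)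
    (hn₁ : occupation s y n ∈ Metric.ball p δ) (hn₂ : occupation s y (2 * n) ∈ Metric.ball p δ) :
    p i * n / 2 ≤ ∑ l ∈ Finset.Ico (n + 1) (2 * n + 1), (if y l = i then (1 : ℝ) else 0) := by
  rw [sum_visits (s := s) y i (by lia)]
  have hweight : ∀ m, occupation s y m ∈ Metric.ball p δ →
      (p i - δ) * (∑ j, s j + m) ≤ weight s y m i ∧
        weight s y m i ≤ (p i + δ) * (∑ j, s j + m) := fun m hm => by
    have hclose := abs_lt.1 ((dist_le_pi_dist (occupation s y m) p i).trans_lt hm)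
    have hT : 0 < ∑ j, s j + (m : ℝ) := by positivity
    rw [← le_div_iff₀ hT, ← div_le_iff₀ hT, ← occupation_eq]
    constructor <;> linarith
  have hstart := (hweight n hn₁).2
  have hend := (hweight (2 * n) hn₂).1
  push_cast at hend
  have hδ0 : 0 < δ := Metric.pos_of_mem_ball hn₁
  nlinarith

end Steps

section MainEstimate

variable {d : ℕ} {Ω : Type*} [mΩ : MeasurableSpace Ω] {R : Matrix (Fin d) (Fin d) ℝ}
  {s p ℓ : Fin d → ℝ} {y₀ : Fin d} {μ : Measure Ω} [IsProbabilityMeasure μ] {Y : ℕ → Ω → Fin d}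
  {C σ ε δ : ℝ} {i₀ : Fin d} {n : ℕ} {I : Ω → ℝ} {F : Set Ω}

theorem LocalEstimates.le_sum_integral_visit (hloc : LocalEstimates R p ℓ C σ i₀ ε δ)
    (hs : ∀ i, 0 < s i) (hY : ∀ n, Measurable (Y n)) (hI : DependsOnPast Y n I)
    (hI0 : ∀ ω, 0 ≤ I ω) (hF : MeasurableSet F) (hIF : ∀ ω ∈ F, I ω = 1)
    (hstay : ∀ ω ∈ F, ∀ k, n ≤ k → occupation s (fun n => Y n ω) k ∈ Metric.ball p δ)
    (hns : ∑ j, s j ≤ n) :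
    p i₀ * n / 2 * μ.real F ≤ ∑ l ∈ Finset.Ico (n + 1) (2 * n + 1),
      ∫ ω, I ω * visit p δ i₀ (occupation s (fun n => Y n ω) l) (Y l ω) ∂μ := by
  have hint : ∀ l ∈ Finset.Ico (n + 1) (2 * n + 1), Integrable (fun ω =>
      I ω * visit p δ i₀ (occupation s (fun n => Y n ω) l) (Y l ω)) μ := fun l hl =>
    ((hI.mono (n.le_succ.trans (Finset.mem_Ico.1 hl).1)).mul
      (dependsOnPast_visit s p δ i₀ Y l)).integrable hY
  rw [mul_comm, ← smul_eq_mul, ← setIntegral_const, ← integral_indicator hF,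
    ← integral_finsetSum _ hint]
  refine integral_mono ((integrable_const _).indicator hF) (integrable_finsetSum _ hint) fun ω => ?_
  by_cases hω : ω ∈ F
  · rw [Set.indicator_of_mem hω]
    refine (le_sum_visits (sum_pos_of_pos hs i₀) hns hloc.le (hstay ω hω n le_rfl)
      (hstay ω hω (2 * n) (by lia))).trans_eq (Finset.sum_congr rfl fun l hl => ?_)
    rw [hIF ω hω, one_mul, visit,
      Set.indicator_of_mem (hstay ω hω l (n.le_succ.trans (Finset.mem_Ico.1 hl).1))]
  · rw [Set.indicator_of_notMem hω]
    exact Finset.sum_nonneg fun l _ => mul_nonneg (hI0 ω) (visit_nonneg ..)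

theorem IsReinforcedProcess.le_integral_sum_noise_sq (hsymm : R.IsSymm)
    (hnonneg : ∀ i j, 0 ≤ R i j) (hcol : ∀ j, 0 < ∑ i, R i j)
    (hY : IsReinforcedProcess R s y₀ μ Y) (hs : ∀ i, 0 < s i) {κ : ℝ} (hκ : 0 ≤ κ) (hσ : 0 ≤ σ)
    (hloc : LocalEstimates R p ℓ C σ i₀ ε δ) (hI : DependsOnPast Y n I) (hI0 : ∀ ω, 0 ≤ I ω)
    (hF : MeasurableSet F) (hIF : ∀ ω ∈ F, I ω = 1)
    (hstay : ∀ ω ∈ F, ∀ k, n ≤ k → occupation s (fun n => Y n ω) k ∈ Metric.ball p δ)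
    (hn : 1 ≤ n) (hns : ∑ j, s j ≤ n) {m : ℕ} (hm : 2 * n + 1 ≤ m) :
    (Real.exp (2 * κ))⁻¹ ^ 2 * σ * p i₀ / 64 * μ.real F / (∑ j, s j + n)
      ≤ ∫ ω, I ω * (∑ l ∈ Finset.Ico n m, (growth κ (stepSize s) n (l + 1))⁻¹ *
          stepSize s l * noise R p s δ ℓ (fun n => Y n ω) l) ^ 2 ∂μ := by
  have hT := sum_pos_of_pos hs i₀
  have hp : 0 < p i₀ := by linarith [hloc.pos.trans_le hloc.le]
  set τ : ℝ := ∑ j, s j + n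
  have hτ0 : 0 < τ := by positivity
  rw [(hY.isNoise hsymm hnonneg hcol hs hloc le_rfl).integral_sum_sq hY.measurable hI
    (fun l => (growth κ (stepSize s) n (l + 1))⁻¹ * stepSize s l) le_rfl (by lia)]
  calc (Real.exp (2 * κ))⁻¹ ^ 2 * σ * p i₀ / 64 * μ.real F / τ
      = ((Real.exp (2 * κ))⁻¹ / (4 * τ)) ^ 2 * (σ * (p i₀ * (τ / 2) / 2 * μ.real F)) := by
        field_simp
        ring
    _ ≤ ((Real.exp (2 * κ))⁻¹ / (4 * τ)) ^ 2 * (σ * (p i₀ * n / 2 * μ.real F)) := by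
        have : τ / 2 ≤ n := by linarith
        gcongr
    _ ≤ ((Real.exp (2 * κ))⁻¹ / (4 * τ)) ^ 2 * (σ * ∑ l ∈ Finset.Ico (n + 1) (2 * n + 1),
          ∫ ω, I ω * visit p δ i₀ (occupation s (fun n => Y n ω) l) (Y l ω) ∂μ) := by
        have := hloc.le_sum_integral_visit (μ := μ) hs hY.measurable hI hI0 hF hIF hstay hns
        gcongr
    _ ≤ ∑ l ∈ Finset.Ico (n + 1) (2 * n + 1), ((growth κ (stepSize s) n (l + 1))⁻¹ *
          stepSize s l) ^ 2 * ∫ ω, I ω * noise R p s δ ℓ (fun n => Y n ω) l ^ 2 ∂μ := by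
        rw [Finset.mul_sum, Finset.mul_sum]
        refine Finset.sum_le_sum fun l hl => ?_
        obtain ⟨hnl, hl2⟩ := Finset.mem_Ico.1 hl
        refine mul_le_mul (pow_le_pow_left₀ (by positivity)
          (le_inv_growth_mul_stepSize hκ hT hn (Nat.le_of_lt_succ hl2)) 2)
          (hY.le_integral_noise_sq hsymm hnonneg hcol hs hloc (hI.mono (n.le_succ.trans hnl)) hI0)
          (mul_nonneg hσ (integral_nonneg fun ω => ?_)) (sq_nonneg _)
        exact mul_nonneg (hI0 ω) (visit_nonneg ..)
    _ ≤ _ := Finset.sum_le_sum_of_subset_of_nonneg (Finset.Ico_subset_Ico n.le_succ hm)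
        fun l _ _ => mul_nonneg (sq_nonneg _)
          (integral_nonneg fun ω => mul_nonneg (hI0 ω) (sq_nonneg _))

end MainEstimate

section IndependentCopies

variable {d : ℕ} {Ω : Type*} [mΩ : MeasurableSpace Ω] {R : Matrix (Fin d) (Fin d) ℝ}
  {s p ℓ' κ : Fin d → ℝ} {ℓ : Fin d → Fin d → ℝ} {y₀ : Fin d} {μ : Measure Ω}
  [IsProbabilityMeasure μ] {Y : ℕ → Ω → Fin d} {C σ ε δ B K L : ℝ} {i₀ : Fin d} {n k : ℕ} {ω₀ : Ω}
  {F : Set Ω}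

theorem ae_prod_restrict_mem (hF : MeasurableSet F) :
    ∀ᵐ x ∂((μ.restrict F).prod (μ.restrict F)), x.1 ∈ F ∧ x.2 ∈ F := by
  rw [Measure.prod_restrict]
  exact ae_restrict_mem (hF.prod hF)

theorem measureReal_prod_restrict_univ (μ : Measure Ω) [IsProbabilityMeasure μ] (F : Set Ω) :
    ((μ.restrict F).prod (μ.restrict F)).real Set.univ = μ.real F ^ 2 := by
  rw [← Set.univ_prod_univ, measureReal_prod_prod, measureReal_restrict_apply_univ, sq]

theorem integral_le_of_ae_le {ν : Measure Ω} [IsFiniteMeasure ν] {f : Ω → ℝ} (hf : Integrable f ν)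
    {c : ℝ} (h : ∀ᵐ ω ∂ν, f ω ≤ c) : ∫ ω, f ω ∂ν ≤ c * ν.real Set.univ := by
  refine (integral_mono_ae hf (integrable_const c) h).trans_eq ?_
  rw [integral_const, smul_eq_mul, mul_comm]

theorem DependsOnPast.memLp_sub {G : Ω → ℝ} (hG : DependsOnPast Y k G)
    (hY : ∀ n, Measurable (Y n)) (F : Set Ω) :
    MemLp (fun x : Ω × Ω => G x.1 - G x.2) 2 ((μ.restrict F).prod (μ.restrict F)) :=
  have hF := (hG.memLp_two hY).restrict F
  (hF.comp_fst _).sub (hF.comp_snd _)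

theorem IsNoise.integral_prod_sum_sub_sq_le {ξ : ℕ → Ω → ℝ} (hξ : IsNoise μ Y ξ C)
    (hY : ∀ n, Measurable (Y n)) (hFE : F ⊆ atom Y n ω₀) {α : ℕ → ℝ} {q : ℝ} {m : ℕ} (hk : n ≤ k)
    (hm : k ≤ m) (hq : ∑ l ∈ Finset.Ico k m, α l ^ 2 ≤ q) :
    ∫ x, (∑ l ∈ Finset.Ico k m, α l * (ξ l x.1 - ξ l x.2)) ^ 2
      ∂((μ.restrict F).prod (μ.restrict F)) ≤ 2 * C ^ 2 * q * μ.real (atom Y n ω₀) ^ 2 := by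
  set e := μ.real (atom Y n ω₀)
  have he : μ.real F ≤ e := measureReal_mono hFE
  have hM := hξ.dep_sum α k m
  have hM2 := hM.memLp_two (μ := μ) hY
  simp only [mul_sub, Finset.sum_sub_distrib]
  calc ∫ x, (∑ l ∈ Finset.Ico k m, α l * ξ l x.1 - ∑ l ∈ Finset.Ico k m, α l * ξ l x.2) ^ 2
        ∂((μ.restrict F).prod (μ.restrict F))
      ≤ 2 * μ.real F * ∫ ω in F, (∑ l ∈ Finset.Ico k m, α l * ξ l ω) ^ 2 ∂μ := by
        simpa only [measureReal_restrict_apply_univ] using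
          integral_prod_sub_sq_le (hM2.restrict F)
    _ ≤ 2 * e * (C ^ 2 * q * e) := by
        gcongr
        exact (setIntegral_mono_set hM2.integrable_sq.integrableOn
          (Eventually.of_forall fun ω => sq_nonneg _) hFE.eventuallyLE).trans
          (hξ.setIntegral_atom_sum_sq_le hY hk hm hq ω₀)
    _ = 2 * C ^ 2 * q * e ^ 2 := by ring

theorem one_add_mul_stepSize_pos {κ : ℝ} (hs : 0 < ∑ j, s j) (hκ : |κ| < n) (hk : n ≤ k) :
    0 < 1 + κ * stepSize s k := by
  have hnk : (n : ℝ) ≤ k := Nat.cast_le.2 hk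
  have hden : 0 < ∑ j, s j + ((k : ℝ) + 1) := by positivity
  have hκk := neg_le_of_abs_le hκ.le
  rw [stepSize, mul_one_div, ← neg_lt_iff_pos_add', lt_div_iff₀ hden]
  linarith

theorem sum_sq_mul_stepSize_le (hs : 0 < ∑ j, s j) {c : ℕ → ℝ} {m : ℕ} (hkm : k ≤ m)
    (hc : ∀ l ∈ Finset.Ico k m, |c l| ≤ 1) :
    ∑ l ∈ Finset.Ico k m, (c l * stepSize s l) ^ 2 ≤ 1 / (∑ j, s j + k) := by
  refine le_trans (Finset.sum_le_sum fun l hl => ?_) (sum_sq_stepSize_le hs hkm)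
  rw [mul_pow]
  exact mul_le_of_le_one_left (sq_nonneg _) ((sq_le_one_iff_abs_le_one _).2 (hc l hl))

theorem dependsOnPast_corrected {Ω : Type*} (R : Matrix (Fin d) (Fin d) ℝ) (p s : Fin d → ℝ)
    (Y : ℕ → Ω → Fin d) (ℓ : Fin d → ℝ) (k : ℕ) :
    DependsOnPast Y k (fun ω => ℓ ⬝ᵥ corrected R p s (fun n => Y n ω) k) :=
  (dependsOnPast_occupation s Y k).comp₂ (DependsOnPast.self le_rfl) fun v i =>
    ℓ ⬝ᵥ fun j => v j + fundamentalStep R p v i j / (∑ j, s j + k)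

theorem dependsOnPast_rest {Ω : Type*} (R : Matrix (Fin d) (Fin d) ℝ) (p s : Fin d → ℝ)
    (Y : ℕ → Ω → Fin d) (κ : ℝ) (ℓ : Fin d → ℝ) (k : ℕ) :
    DependsOnPast Y (k + 1) (fun ω => rest R p s κ ℓ (fun n => Y n ω) k) := by
  intro ω ω' h
  have hpast : ∀ m ≤ k + 1,
      occupation s (fun n => Y n ω) m = occupation s (fun n => Y n ω') m := fun m hm =>
    occupation_congr fun i hi => h i (hi.trans hm)
  have hcorr : corrected R p s (fun n => Y n ω) k = corrected R p s (fun n => Y n ω') k := by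
    ext i
    simp only [corrected, hpast k k.le_succ, h k k.le_succ]
  have hrem : remainder R p s (fun n => Y n ω) k = remainder R p s (fun n => Y n ω') k := by
    ext i
    simp only [remainder, hpast k k.le_succ, hpast (k + 1) le_rfl, h k k.le_succ, h (k + 1) le_rfl]
  simp only [rest, hcorr, hrem, hpast k k.le_succ]

theorem ae_corrected_sub_eq_zero (hF : MeasurableSet F) (hFE : F ⊆ atom Y n ω₀) (ℓ : Fin d → ℝ) :
    ∀ᵐ x ∂((μ.restrict F).prod (μ.restrict F)), ℓ ⬝ᵥ corrected R p s (fun n => Y n x.1) n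
      - ℓ ⬝ᵥ corrected R p s (fun n => Y n x.2) n = 0 := by
  filter_upwards [ae_prod_restrict_mem hF] with x hx
  exact sub_eq_zero.2 (dependsOnPast_corrected R p s Y ℓ n x.1 x.2 fun i hi =>
    (hFE hx.1 i hi).symm.trans (hFE hx.2 i hi))

namespace LocalEstimates

theorem abs_dotProduct_corrected_le {ℓ : Fin d → ℝ} {y : ℕ → Fin d} (hs : ∀ i, 0 < s i)
    (hloc : LocalEstimates R p ℓ' C σ i₀ ε δ) (hB : ∑ i, |ℓ i| ≤ B)
    (hk : occupation s y k ∈ Metric.ball p δ) :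
    |ℓ ⬝ᵥ corrected R p s y k| ≤ B * (1 + C / ∑ j, s j) := by
  have hC := hloc.const_nonneg
  have hT := sum_pos_of_pos hs i₀
  refine abs_dotProduct_le hB (by positivity) fun i => ?_
  have hocc : |occupation s y k i| ≤ 1 := by
    rw [abs_of_pos (occupation_pos hs k i)]
    exact occupation_le_one hs k i
  have hcorr := hloc.abs_corrected_sub_le hs hk i
  have hmono : C / (∑ j, s j + (k : ℝ)) ≤ C / ∑ j, s j := by
    gcongr
    exact le_add_of_nonneg_right k.cast_nonneg
  linarith [abs_sub_abs_le_abs_sub (corrected R p s y k i) (occupation s y k i)]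

theorem integral_corrected_sub_sq_le {ℓ : Fin d → ℝ} (hs : ∀ i, 0 < s i)
    (hloc : LocalEstimates R p ℓ' C σ i₀ ε δ) (hY : ∀ n, Measurable (Y n)) (hB : ∑ i, |ℓ i| ≤ B)
    (hF : MeasurableSet F)
    (hstay : ∀ ω ∈ F, occupation s (fun n => Y n ω) k ∈ Metric.ball p δ) :
    ∫ x, (ℓ ⬝ᵥ corrected R p s (fun n => Y n x.1) k
        - ℓ ⬝ᵥ corrected R p s (fun n => Y n x.2) k) ^ 2 ∂((μ.restrict F).prod (μ.restrict F))
      ≤ (2 * (B * (1 + C / ∑ j, s j))) ^ 2 * μ.real F ^ 2 := by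
  rw [← measureReal_prod_restrict_univ]
  refine integral_le_of_ae_le
    ((dependsOnPast_corrected R p s Y ℓ k).memLp_sub hY F).integrable_sq ?_
  filter_upwards [ae_prod_restrict_mem hF] with x hx
  have hone := hloc.abs_dotProduct_corrected_le hs hB (hstay x.1 hx.1)
  have htwo := hloc.abs_dotProduct_corrected_le hs hB (hstay x.2 hx.2)
  rw [← sq_abs]
  exact pow_le_pow_left₀ (abs_nonneg _) ((abs_sub _ _).trans (by linarith)) 2

theorem ae_corrected_sub_succ (hs : ∀ i, 0 < s i) (hloc : LocalEstimates R p ℓ' C σ i₀ ε δ)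
    (hF : MeasurableSet F)
    (hstay : ∀ ω ∈ F, ∀ k, n ≤ k → occupation s (fun n => Y n ω) k ∈ Metric.ball p δ)
    (κ : Fin d → ℝ) (ℓ : Fin d → Fin d → ℝ) :
    ∀ᵐ x ∂((μ.restrict F).prod (μ.restrict F)), ∀ j k, n ≤ k →
      ℓ j ⬝ᵥ corrected R p s (fun n => Y n x.1) (k + 1)
          - ℓ j ⬝ᵥ corrected R p s (fun n => Y n x.2) (k + 1) =
        ℓ j ⬝ᵥ corrected R p s (fun n => Y n x.1) k
          - ℓ j ⬝ᵥ corrected R p s (fun n => Y n x.2) k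
          + stepSize s k * (κ j * (ℓ j ⬝ᵥ corrected R p s (fun n => Y n x.1) k
              - ℓ j ⬝ᵥ corrected R p s (fun n => Y n x.2) k)
            + (rest R p s (κ j) (ℓ j) (fun n => Y n x.1) k
                - rest R p s (κ j) (ℓ j) (fun n => Y n x.2) k
              + (noise R p s δ (ℓ j) (fun n => Y n x.1) k
                - noise R p s δ (ℓ j) (fun n => Y n x.2) k))) := by
  filter_upwards [ae_prod_restrict_mem hF] with x hx j k hk
  rw [hloc.dotProduct_corrected_succ hs (hstay x.1 hx.1 k hk) (κ j) (ℓ j),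
    hloc.dotProduct_corrected_succ hs (hstay x.2 hx.2 k hk) (κ j) (ℓ j)]
  ring

theorem integral_rest_sub_sq_le (hs : ∀ i, 0 < s i) (hloc : LocalEstimates R p ℓ' C σ i₀ ε δ)
    (hY : ∀ n, Measurable (Y n)) (hε : 0 ≤ ε) (hε1 : ε ≤ 1) (hsymm : R.IsSymm)
    (hp : IsInteriorCritical R p) (hℓ : IsEigenframe (jacobianForm R p) p κ ℓ)
    (hB : ∀ j, ∑ i, |ℓ j i| ≤ B) (hK : ∀ j, |κ j| ≤ K) (hF : MeasurableSet F)
    (hstay : ∀ ω ∈ F, ∀ k, n ≤ k → occupation s (fun n => Y n ω) k ∈ Metric.ball p δ)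
    (hk : n ≤ k) (j : Fin d) :
    ∫ x, (rest R p s (κ j) (ℓ j) (fun n => Y n x.1) k
        - rest R p s (κ j) (ℓ j) (fun n => Y n x.2) k) ^ 2 ∂((μ.restrict F).prod (μ.restrict F)) ≤
      2 * (B * ε) ^ 2 * ∑ i, ∫ x, (ℓ i ⬝ᵥ corrected R p s (fun n => Y n x.1) k
          - ℓ i ⬝ᵥ corrected R p s (fun n => Y n x.2) k) ^ 2 ∂((μ.restrict F).prod (μ.restrict F))
        + 2 * (B * C * (6 + 2 * K)) ^ 2 / (∑ j, s j + n) ^ 2 * μ.real F ^ 2 := by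
  have hT := sum_pos_of_pos hs i₀
  have hint : ∀ i, Integrable (fun x : Ω × Ω => (ℓ i ⬝ᵥ corrected R p s (fun n => Y n x.1) k
      - ℓ i ⬝ᵥ corrected R p s (fun n => Y n x.2) k) ^ 2)
      ((μ.restrict F).prod (μ.restrict F)) := fun i =>
    ((dependsOnPast_corrected R p s Y (ℓ i) k).memLp_sub hY F).integrable_sq
  have hsum := (integrable_finsetSum Finset.univ fun i _ => hint i).const_mul (2 * (B * ε) ^ 2)
  refine (integral_mono_of_nonneg (Eventually.of_forall fun x => sq_nonneg _)
    (hsum.add (integrable_const (2 * (B * C * (6 + 2 * K)) ^ 2 / (∑ j, s j + n) ^ 2))) ?_).trans_eq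
    ?_
  · filter_upwards [ae_prod_restrict_mem hF] with x hx
    exact hloc.sq_rest_sub_le hs hε hε1 hsymm hp hℓ hB hK (by positivity)
      (by gcongr) (fun m hm => hstay x.1 hx.1 m (hk.trans hm.1))
      (fun m hm => hstay x.2 hx.2 m (hk.trans hm.1)) j
  · simp only [Pi.add_apply]
    rw [integral_add hsum (integrable_const _), integral_const_mul,
      integral_finsetSum _ fun i _ => hint i, integral_const, smul_eq_mul,
      measureReal_prod_restrict_univ, mul_comm (μ.real F ^ 2)]

end LocalEstimates

theorem IsReinforcedProcess.integral_sum_noise_sub_sq_le (hsymm : R.IsSymm)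
    (hnonneg : ∀ i j, 0 ≤ R i j) (hcol : ∀ j, 0 < ∑ i, R i j)
    (hY : IsReinforcedProcess R s y₀ μ Y) (hs : ∀ i, 0 < s i)
    (hloc : LocalEstimates R p ℓ' C σ i₀ ε δ) {ℓ : Fin d → ℝ} (hB : ∑ i, |ℓ i| ≤ B)
    (hFE : F ⊆ atom Y n ω₀) {c : ℕ → ℝ} {m : ℕ} (hk : n ≤ k)
    (hc : ∀ l ∈ Finset.Ico k m, |c l| ≤ 1) :
    ∫ x, (∑ l ∈ Finset.Ico k m, c l * stepSize s l * (noise R p s δ ℓ (fun n => Y n x.1) l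
        - noise R p s δ ℓ (fun n => Y n x.2) l)) ^ 2 ∂((μ.restrict F).prod (μ.restrict F)) ≤
      2 * (2 * C * B) ^ 2 * μ.real (atom Y n ω₀) ^ 2 / (∑ j, s j + n) := by
  have hT := sum_pos_of_pos hs i₀
  rcases lt_or_ge m k with hmk | hkm
  · simp only [Finset.Ico_eq_empty_of_le hmk.le, Finset.sum_empty, ne_eq, OfNat.ofNat_ne_zero,
      not_false_eq_true, zero_pow, integral_zero]
    positivity
  have hq : ∑ l ∈ Finset.Ico k m, (c l * stepSize s l) ^ 2 ≤ 1 / (∑ j, s j + n) :=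
    (sum_sq_mul_stepSize_le hT hkm hc).trans (by gcongr)
  refine ((hY.isNoise hsymm hnonneg hcol hs hloc hB).integral_prod_sum_sub_sq_le hY.measurable hFE
    hk hkm hq).trans_eq ?_
  ring

theorem IsReinforcedProcess.perronSystem (hsymm : R.IsSymm) (hnonneg : ∀ i j, 0 ≤ R i j)
    (hcol : ∀ j, 0 < ∑ i, R i j) (hY : IsReinforcedProcess R s y₀ μ Y) (hs : ∀ i, 0 < s i)
    (hε : 0 ≤ ε) (hε1 : ε ≤ 1) (hloc : LocalEstimates R p ℓ' C σ i₀ ε δ)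
    (hp : IsInteriorCritical R p) (hℓ : IsEigenframe (jacobianForm R p) p κ ℓ)
    (hB : ∀ j, ∑ i, |ℓ j i| ≤ B) (hK : ∀ j, |κ j| ≤ K) (hL : ∀ j, 1 ≤ L * |κ j|)
    (hF : MeasurableSet F) (hFE : F ⊆ atom Y n ω₀)
    (hstay : ∀ ω ∈ F, ∀ k, n ≤ k → occupation s (fun n => Y n ω) k ∈ Metric.ball p δ)
    (hKn : K < n) :
    PerronSystem ((μ.restrict F).prod (μ.restrict F)) n (stepSize s) κ L (2 * (B * ε) ^ 2)
      (2 * (B * C * (6 + 2 * K)) ^ 2 / (∑ j, s j + n) ^ 2 * μ.real (atom Y n ω₀) ^ 2)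
      (2 * (2 * C * B) ^ 2 * μ.real (atom Y n ω₀) ^ 2 / (∑ j, s j + n))
      (fun j k x => ℓ j ⬝ᵥ corrected R p s (fun n => Y n x.1) k
        - ℓ j ⬝ᵥ corrected R p s (fun n => Y n x.2) k)
      (fun j k x => rest R p s (κ j) (ℓ j) (fun n => Y n x.1) k
        - rest R p s (κ j) (ℓ j) (fun n => Y n x.2) k)
      (fun j k x => noise R p s δ (ℓ j) (fun n => Y n x.1) k
        - noise R p s δ (ℓ j) (fun n => Y n x.2) k) where
  step_pos := stepSize_pos (sum_pos_of_pos hs i₀)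
  diverges := tendsto_sum_stepSize (sum_pos_of_pos hs i₀)
  le_rate := hL
  factor_pos j _ hk := one_add_mul_stepSize_pos (sum_pos_of_pos hs i₀) ((hK j).trans_lt hKn) hk
  coupling_nonneg := by positivity
  error_nonneg := by positivity
  memLp j k := (dependsOnPast_corrected R p s Y (ℓ j) k).memLp_sub hY.measurable F
  memLp_noise j k := (dependsOnPast_noise R s p δ (ℓ j) Y k).memLp_sub hY.measurable F
  memLp_rest j k := (dependsOnPast_rest R p s Y (κ j) (ℓ j) k).memLp_sub hY.measurable F
  bounded := ⟨_, fun j k hk => hloc.integral_corrected_sub_sq_le hs hY.measurable (hB j) hF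
    fun ω hω => hstay ω hω k hk⟩
  start j := ae_corrected_sub_eq_zero hF hFE (ℓ j)
  recursion := hloc.ae_corrected_sub_succ hs hF hstay κ ℓ
  rest_le j _ hk := (hloc.integral_rest_sub_sq_le hs hY.measurable hε hε1 hsymm hp hℓ hB hK hF hstay
    hk j).trans (add_le_add_right (mul_le_mul_of_nonneg_left
      (pow_le_pow_left₀ measureReal_nonneg (measureReal_mono hFE) 2) (by positivity)) _)
  noise_le j _ _ _ hk hc :=
    hY.integral_sum_noise_sub_sq_le hsymm hnonneg hcol hs hloc (hB j) hFE hk hc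

end IndependentCopies

section SecondMoment

theorem exists_small_coupling (B a b : ℝ) {c : ℝ} (hc : 0 < c) :
    ∃ ε, 0 < ε ∧ ε ≤ 1 ∧ 2 * (B * ε) ^ 2 * a ≤ 1 ∧ 2 * (B * ε) ^ 2 * b ≤ c := by
  have hlim (a : ℝ) :
      Tendsto (fun ε : ℝ => 2 * (B * ε) ^ 2 * a) (𝓝[>] 0) (𝓝 0) := by
    have hcont : Continuous fun ε : ℝ => 2 * (B * ε) ^ 2 * a := by fun_prop
    exact tendsto_nhdsWithin_of_tendsto_nhds (hcont.tendsto' 0 0 (by simp))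
  have hsmall := (((hlim a).eventually_le_const one_pos).and ((hlim b).eventually_le_const hc)).and
    (Ioc_mem_nhdsGT one_pos)
  obtain ⟨ε, ⟨ha, hb⟩, hε, hε1⟩ := hsmall.exists
  exact ⟨ε, hε, hε1, ha, hb⟩

theorem second_moment_error_le {c C T θ τ : ℝ} (hc : 0 < c) (hτ : 0 < τ)
    (hT : T = 44 * C ^ 4 / c + 1) (hθ : 0 ≤ θ) (hθT : θ * (16 * (T + C ^ 2)) ≤ c) :
    T / τ * θ + 11 * C ^ 4 * (1 / τ) ^ 2 / (4 * (T / τ)) ≤ c / 8 / τ := by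
  have hT0 : 0 < T := by rw [hT]; positivity
  have hfactor : T / τ * θ + 11 * C ^ 4 * (1 / τ) ^ 2 / (4 * (T / τ))
      = (T * θ + 11 * C ^ 4 / (4 * T)) / τ := by
    field_simp
  have hfourth : 11 * C ^ 4 / (4 * T) ≤ c / 16 := by
    rw [div_le_div_iff₀ (by positivity) (by positivity)]
    have hcT : c * T = 44 * C ^ 4 + c := by
      rw [hT]
      field_simp
    linarith
  have hθC : 0 ≤ θ * C ^ 2 := by positivity
  rw [hfactor]
  refine div_le_div_of_nonneg_right ?_ hτ.le
  linarith

theorem le_noise_lower_bound {c C θ τ e f X : ℝ} (hc : 0 < c) (hτ : 0 < τ) (he : 0 < e)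
    (hfe : 3 / 4 * e ≤ f) (hθC : θ * C ^ 2 ≤ c / 16) (hX : X ≤ c / 8 / τ) :
    c / 2 * (e ^ 2 / τ) ≤
      2 * f * (c * f / τ - X * e) - 2 * (θ * (C ^ 2 * (1 / τ))) * e ^ 2 := by
  have hf : 0 ≤ f := le_trans (by positivity) hfe
  have hpos : 0 < c * (e ^ 2 / τ) := by positivity
  have hprod : 3 / 4 * e * (5 / 8 * e) ≤ f * (f - e / 8) :=
    mul_le_mul hfe (by linarith) (by positivity) hf
  have hmain : 15 / 16 * (c * (e ^ 2 / τ)) ≤ 2 * f * (c * f / τ - X * e) := calc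
    _ = 2 * c * (3 / 4 * e * (5 / 8 * e)) / τ := by ring
    _ ≤ 2 * c * (f * (f - e / 8)) / τ := by gcongr
    _ = 2 * f * (c * f / τ - c / 8 / τ * e) := by ring
    _ ≤ 2 * f * (c * f / τ - X * e) := by gcongr
  have hcross : 2 * (θ * (C ^ 2 * (1 / τ))) * e ^ 2 ≤ 1 / 8 * (c * (e ^ 2 / τ)) := calc
    _ = 2 * (θ * C ^ 2) * (e ^ 2 / τ) := by ring
    _ ≤ 2 * (c / 16) * (e ^ 2 / τ) := by gcongr
    _ = 1 / 8 * (c * (e ^ 2 / τ)) := by ring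
  linarith

theorem noise_upper_bound_le {c C D L τ e ε N : ℝ} (hc : 0 < c) (hτ : 0 < τ) (hD : 0 ≤ D)
    (hτD : 64 * L ^ 2 * D / c ≤ τ) (hone : ε * (8 * (L ^ 2 * N)) ≤ 1)
    (hsmall : ε * (32 * (L ^ 2 * N) * C ^ 2) ≤ c / 16) :
    2 * (L ^ 2 * (ε * (N * (8 * (L ^ 2 * (D / τ ^ 2 * e ^ 2) + 2 * C ^ 2 * e ^ 2 / τ)))
      + D / τ ^ 2 * e ^ 2)) ≤ c / 8 * (e ^ 2 / τ) := by
  set a := D / τ ^ 2 * e ^ 2 with ha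
  have hLa : 0 ≤ L ^ 2 * a := by positivity
  have hbound : 4 * (L ^ 2 * a) ≤ c / 16 * (e ^ 2 / τ) := calc
    4 * (L ^ 2 * a) = 64 * L ^ 2 * D / τ / 16 * (e ^ 2 / τ) := by
      rw [ha]
      field_simp
      ring
    _ ≤ c / 16 * (e ^ 2 / τ) := by
      gcongr
      rwa [div_le_comm₀ hτ hc]
  calc 2 * (L ^ 2 * (ε * (N * (8 * (L ^ 2 * a + 2 * C ^ 2 * e ^ 2 / τ))) + a))
      = 2 * (ε * (8 * (L ^ 2 * N))) * (L ^ 2 * a)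
        + ε * (32 * (L ^ 2 * N) * C ^ 2) * (e ^ 2 / τ) + 2 * (L ^ 2 * a) := by ring
    _ ≤ 2 * 1 * (L ^ 2 * a) + c / 16 * (e ^ 2 / τ) + 2 * (L ^ 2 * a) := by
      gcongr ?_ + ?_ + _
      · exact mul_le_mul_of_nonneg_right (by linarith) hLa
      · exact mul_le_mul_of_nonneg_right hsmall (by positivity)
    _ ≤ c / 8 * (e ^ 2 / τ) := by linarith

end SecondMoment

section Nonconvergence

variable {d : ℕ} {Ω : Type*} [mΩ : MeasurableSpace Ω] {R : Matrix (Fin d) (Fin d) ℝ}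
  {s p κ : Fin d → ℝ} {ℓ : Fin d → Fin d → ℝ} {y₀ : Fin d} {μ : Measure Ω}
  [IsProbabilityMeasure μ] {Y : ℕ → Ω → Fin d} {B C K L c ε δ θ σ τ : ℝ} {i₀ j₀ : Fin d}
  {m n : ℕ} {ω₀ : Ω} {F : Set Ω}

/-- The event that the occupation vector stays within `δ` of `p` from time `n` on; convergence to
`p` forces it for every `δ` and some `n`. -/
def staysNear {Ω : Type*} (s p : Fin d → ℝ) (Y : ℕ → Ω → Fin d) (δ : ℝ) (n : ℕ) : Set Ω :=
  {ω | ∀ k, n ≤ k → occupation s (fun n => Y n ω) k ∈ Metric.ball p δ}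

theorem staysNear_mono {Ω : Type*} (s p : Fin d → ℝ) (Y : ℕ → Ω → Fin d) (δ : ℝ) :
    Monotone (staysNear s p Y δ) :=
  fun _ _ h _ hω k hk => hω k (h.trans hk)

theorem measurableSet_staysNear {Ω : Type*} (s p : Fin d → ℝ) (Y : ℕ → Ω → Fin d) (δ : ℝ)
    (n : ℕ) : MeasurableSet[⨆ n, history Y n] (staysNear s p Y δ n) := by
  have hball : ∀ k, MeasurableSet[⨆ n, history Y n]
      {ω | occupation s (fun n => Y n ω) k ∈ Metric.ball p δ} := by
    intro k
    have hind : DependsOnPast Y k (fun ω => (Metric.ball p δ).indicator (1 : (Fin d → ℝ) → ℝ)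
        (occupation s (fun n => Y n ω) k)) := (dependsOnPast_occupation s Y k).comp _
    convert le_iSup (history Y) k _ (hind.measurable_history (measurableSet_singleton 1)) using 1
    ext ω
    exact (Set.indicator_eq_one_iff_mem ℝ).symm
  rw [show staysNear s p Y δ n
      = ⋂ k, ⋂ (_ : n ≤ k), {ω | occupation s (fun n => Y n ω) k ∈ Metric.ball p δ} by
    ext ω
    simp only [staysNear, Set.mem_ofPred_eq, Set.mem_iInter]]
  exact @MeasurableSet.iInter _ _ (⨆ n, history Y n) _ _ fun k =>
    @MeasurableSet.iInter _ _ (⨆ n, history Y n) _ _ fun _ => hball k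

theorem exists_measure_staysNear_ne_zero {Ω : Type*} [MeasurableSpace Ω] {μ : Measure Ω}
    {Y : ℕ → Ω → Fin d} (hδ : 0 < δ)
    (h : μ {ω | Tendsto (fun n => occupation s (fun k => Y k ω) n) atTop (𝓝 p)}
      ≠ 0) :
    ∃ n, μ (staysNear s p Y δ n) ≠ 0 := by
  contrapose! h
  refine measure_mono_null (fun ω hω => ?_) (measure_iUnion_null h)
  obtain ⟨n, hn⟩ := eventually_atTop.1 (hω.eventually (Metric.ball_mem_nhds p hδ))
  exact Set.mem_iUnion.2 ⟨n, hn⟩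

theorem sum_sq_inv_growth_mul_stepSize_le {κ : ℝ} (hs : 0 < ∑ j, s j) (hκ : 0 ≤ κ) (hm : n ≤ m) :
    ∑ l ∈ Finset.Ico n m, ((growth κ (stepSize s) n (l + 1))⁻¹ * stepSize s l) ^ 2
      ≤ 1 / (∑ j, s j + n) :=
  sum_sq_mul_stepSize_le hs hm fun l _ => by
    have h := one_le_growth hκ (fun k => (stepSize_pos hs k).le) n (l + 1)
    rw [abs_of_nonneg (inv_nonneg.2 (zero_le_one.trans h))]
    exact inv_le_one_of_one_le₀ h

theorem IsNoise.mul_sq_le_integral_prod_sub_sq {ξ : ℕ → Ω → ℝ} {α : ℕ → ℝ}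
    (hξ : IsNoise μ Y ξ C) (hY : ∀ n, Measurable (Y n)) (hF : MeasurableSet F)
    (hFE : F ⊆ atom Y n ω₀) (hm : n ≤ m) (hc : 0 < c) (hτ : 0 < τ)
    (hE : 0 < μ.real (atom Y n ω₀)) (hθ : 0 ≤ θ) (hθ1 : θ ≤ 1 / 4)
    (hθc : θ * (16 * (44 * C ^ 4 / c + 1 + C ^ 2)) ≤ c)
    (hα : ∑ l ∈ Finset.Ico n m, α l ^ 2 ≤ 1 / τ)
    (hEF : μ.real (atom Y n ω₀ \ F) ≤ θ * μ.real (atom Y n ω₀))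
    (hvar : c * μ.real F / τ ≤
      ∫ ω in atom Y n ω₀, (∑ l ∈ Finset.Ico n m, α l * ξ l ω) ^ 2 ∂μ) :
    c / 2 * (μ.real (atom Y n ω₀) ^ 2 / τ) ≤
      ∫ x, (∑ l ∈ Finset.Ico n m, α l * ξ l x.1 - ∑ l ∈ Finset.Ico n m, α l * ξ l x.2) ^ 2
        ∂((μ.restrict F).prod (μ.restrict F)) := by
  have hT : 0 < 44 * C ^ 4 / c + 1 := by positivity
  have hlarge : 3 / 4 * μ.real (atom Y n ω₀) ≤ μ.real F := by
    have hsplit := measureReal_sdiff_add_inter (μ := μ) (s := atom Y n ω₀) hF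
    rw [Set.inter_eq_right.2 hFE] at hsplit
    have hquarter := mul_le_mul_of_nonneg_right hθ1 hE.le
    linarith
  have hθC : θ * C ^ 2 ≤ c / 16 := by
    have hθT := mul_nonneg hθ hT.le
    linarith
  exact (le_noise_lower_bound hc hτ hE hlarge hθC
    (second_moment_error_le hc hτ rfl hθ hθc)).trans
    (hξ.le_integral_prod_sub_sq hY hF hFE hm (div_pos hT hτ) hα hEF hvar)

theorem IsReinforcedProcess.lt_measureReal_atom_sdiff_staysNear (hsymm : R.IsSymm)
    (hnonneg : ∀ i j, 0 ≤ R i j) (hcol : ∀ j, 0 < ∑ i, R i j)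
    (hY : IsReinforcedProcess R s y₀ μ Y) (hs : ∀ i, 0 < s i) (hp : IsInteriorCritical R p)
    (hℓ : IsEigenframe (jacobianForm R p) p κ ℓ) (hj₀ : 0 < κ j₀) (hε : 0 ≤ ε) (hε1 : ε ≤ 1)
    (hσ : 0 < σ) (hloc : LocalEstimates R p (ℓ j₀) C σ i₀ ε δ) (hB : ∀ j, ∑ i, |ℓ j i| ≤ B)
    (hK : ∀ j, |κ j| ≤ K) (hL : ∀ j, 1 ≤ L * |κ j|)
    (hc : c = (Real.exp (2 * κ j₀))⁻¹ ^ 2 * σ * p i₀ / 64)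
    (hone : 2 * (B * ε) ^ 2 * (8 * (L ^ 2 * d)) ≤ 1)
    (hsmall : 2 * (B * ε) ^ 2 * (32 * (L ^ 2 * d) * (2 * C * B) ^ 2) ≤ c / 16)
    (hθ : 0 ≤ θ) (hθ1 : θ ≤ 1 / 4)
    (hθc : θ * (16 * (44 * (2 * C * B) ^ 4 / c + 1 + (2 * C * B) ^ 2)) ≤ c) (hn : 1 ≤ n)
    (hKn : K < n) (hsn : ∑ j, s j ≤ n)
    (hDn : 64 * L ^ 2 * (2 * (B * C * (6 + 2 * K)) ^ 2) / c ≤ ∑ j, s j + n)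
    (hE : 0 < μ.real (atom Y n ω₀)) :
    θ * μ.real (atom Y n ω₀) < μ.real (atom Y n ω₀ \ staysNear s p Y δ n) := by
  have hT := sum_pos_of_pos hs i₀
  have hτ : 0 < ∑ j, s j + (n : ℝ) := by positivity
  have hc0 : 0 < c := by
    have hpi := hp.pos i₀
    rw [hc]
    positivity
  by_contra! hEF
  set F := atom Y n ω₀ ∩ staysNear s p Y δ n
  have hF : MeasurableSet F := (measurableSet_atom hY.measurable n ω₀).inter
    (iSup_le (history_le hY.measurable) _ (measurableSet_staysNear s p Y δ n))
  have hFE : F ⊆ atom Y n ω₀ := Set.inter_subset_left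
  rw [← Set.sdiff_self_inter] at hEF
  have hgap : 0 < c / 8 * (μ.real (atom Y n ω₀) ^ 2 / (∑ j, s j + n)) := by positivity
  have hsys := hY.perronSystem hsymm hnonneg hcol hs hε hε1 hloc hp hℓ hB hK hL hF hFE
    (fun ω hω => hω.2) hKn
  obtain ⟨m, hupper, hm⟩ := ((hsys.eventually_noise_le (by positivity)
    (by rw [Fintype.card_fin]; linarith) hj₀ hgap).and
    (eventually_ge_atTop (2 * n + 1))).exists
  have hnm : n ≤ m := by omega
  have hvar := hY.le_integral_sum_noise_sq hsymm hnonneg hcol hs hj₀.le hσ.le hloc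
    (dependsOnPast_indicator_atom Y n ω₀) (indicator_atom_nonneg Y n ω₀) hF
    (fun ω hω => Set.indicator_of_mem hω.1 _) (fun ω hω => hω.2) hn hsn hm
  rw [← setIntegral_eq_integral_indicator_mul (measurableSet_atom hY.measurable n ω₀), ← hc]
    at hvar
  have hlower := (hY.isNoise hsymm hnonneg hcol hs hloc (hB j₀)).mul_sq_le_integral_prod_sub_sq
    hY.measurable hF hFE hnm hc0 hτ hE hθ hθ1 hθc
    (sum_sq_inv_growth_mul_stepSize_le hT hj₀.le hnm) hEF hvar
  have herror := noise_upper_bound_le (e := μ.real (atom Y n ω₀)) hc0 hτ (by positivity) hDn hone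
    hsmall
  simp only [Fintype.card_fin, mul_sub, Finset.sum_sub_distrib] at hupper
  linarith

theorem IsReinforcedProcess.exists_lt_measureReal_atom_sdiff_staysNear (hsymm : R.IsSymm)
    (hnonneg : ∀ i j, 0 ≤ R i j) (hcol : ∀ j, 0 < ∑ i, R i j) (hdet : R.det ≠ 0)
    (hp : IsInteriorCritical R p) (herg : IsErgodicAt R p) (hdir : HasPositiveDirection R)
    (hY : IsReinforcedProcess R s y₀ μ Y) (hs : ∀ i, 0 < s i) :
    ∃ δ > 0, ∃ θ > 0, ∀ᶠ n in atTop, ∀ ω₀, 0 < μ.real (atom Y n ω₀) →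
      θ * μ.real (atom Y n ω₀) < μ.real (atom Y n ω₀ \ staysNear s p Y δ n) := by
  obtain ⟨κ, ℓ, hℓ⟩ := hp.exists_isEigenframe hsymm
  obtain ⟨j₀, hj₀⟩ := hdir.exists_pos hp hℓ
  have hκ := hℓ.ne_zero_of_det_ne_zero hsymm hdet hp
  have hj₁ : κ j₀ ≠ -1 := by linarith
  obtain ⟨i₀, hi₀⟩ := hp.exists_stepVariance_fundamental_pos hsymm hnonneg herg hj₀
    (hp.dotProduct_eigenframe_eq_zero hsymm hℓ hj₁) (hℓ.sum_mul_sq j₀)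
    (hp.transition_mulVec_eigenframe hsymm hℓ hj₁)
  obtain ⟨C, σ, hσ, hloc⟩ := hp.exists_localEstimates hsymm herg hi₀
  obtain ⟨B, hB⟩ := Finite.exists_le fun j => ∑ i, |ℓ j i|
  obtain ⟨K, hK⟩ := Finite.exists_le fun j => |κ j|
  obtain ⟨L, hL⟩ := Finite.exists_le fun j => 1 / |κ j|
  have hpi := hp.pos i₀
  obtain ⟨c, hc⟩ : ∃ c, c = (Real.exp (2 * κ j₀))⁻¹ ^ 2 * σ * p i₀ / 64 := ⟨_, rfl⟩
  have hc0 : 0 < c := by rw [hc]; positivity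
  obtain ⟨ε, hε, hε1, hone, hsmall⟩ := exists_small_coupling B (8 * (L ^ 2 * d))
    (32 * (L ^ 2 * d) * (2 * C * B) ^ 2) (show 0 < c / 16 by positivity)
  obtain ⟨δ, hlocδ⟩ := hloc ε hε
  have hnat := tendsto_natCast_atTop_atTop (R := ℝ)
  refine ⟨δ, hlocδ.pos,
    min (1 / 4) (c / (16 * (44 * (2 * C * B) ^ 4 / c + 1 + (2 * C * B) ^ 2))), by positivity, ?_⟩
  filter_upwards [eventually_ge_atTop 1, hnat.eventually_gt_atTop K,
    hnat.eventually_ge_atTop (∑ j, s j), hnat.eventually_ge_atTop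
      (64 * L ^ 2 * (2 * (B * C * (6 + 2 * K)) ^ 2) / c - ∑ j, s j)] with n hn hKn hsn hDn ω₀ hE
  exact hY.lt_measureReal_atom_sdiff_staysNear hsymm hnonneg hcol hs hp hℓ hj₀ hε.le hε1 hσ hlocδ
    hB hK (fun j => (div_le_iff₀ (abs_pos.2 (hκ j))).1 (hL j)) hc hone hsmall (by positivity)
    (min_le_left _ _) ((le_div_iff₀ (by positivity)).1 (min_le_right _ _)) hn hKn hsn
    (sub_le_iff_le_add'.1 hDn) hE

theorem IsReinforcedProcess.measure_tendsto_eq_zero (hsymm : R.IsSymm)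
    (hnonneg : ∀ i j, 0 ≤ R i j) (hcol : ∀ j, 0 < ∑ i, R i j) (hdet : R.det ≠ 0)
    (hp : IsInteriorCritical R p) (hdir : HasPositiveDirection R)
    (hY : IsReinforcedProcess R s y₀ μ Y) (hs : ∀ i, 0 < s i) :
    μ {ω | Tendsto (fun n => occupation s (fun k => Y k ω) n) atTop (𝓝 p)} = 0 := by
  by_cases herg : IsErgodicAt R p
  swap
  · exact hY.measure_tendsto_of_not_isErgodicAt hsymm hnonneg hp hs herg
  obtain ⟨δ, hδ, θ, hθ, hleave⟩ :=
    hY.exists_lt_measureReal_atom_sdiff_staysNear hsymm hnonneg hcol hdet hp herg hdir hs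
  by_contra hne
  obtain ⟨n₀, hn₀⟩ := exists_measure_staysNear_ne_zero hδ hne
  obtain ⟨N, hN⟩ := eventually_atTop.1 hleave
  obtain ⟨n, hn, ω₀, hE, hstay⟩ := exists_atom_measureReal_sdiff_le hY.measurable
    (measurableSet_staysNear s p Y δ n₀) hn₀ hθ (max n₀ N)
  have hmono : μ.real (atom Y n ω₀ \ staysNear s p Y δ n) ≤
      μ.real (atom Y n ω₀ \ staysNear s p Y δ n₀) :=
    measureReal_mono (Set.sdiff_subset_sdiff_right
      (staysNear_mono s p Y δ ((le_max_left _ _).trans hn)))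
  exact absurd (hmono.trans hstay) (hN n ((le_max_right _ _).trans hn) ω₀ hE).not_ge

end Nonconvergence

end VRRW

theorem theorem2 {d : ℕ} (R : Matrix (Fin d) (Fin d) ℝ) (hsymm : R.IsSymm)
    (hnonneg : ∀ i j, 0 ≤ R i j) (hcol : ∀ j, 0 < ∑ i, R i j) (hdet : R.det ≠ 0)
    (p : Fin d → ℝ) (hp : VRRW.IsInteriorCritical R p) :
    (∀ q, VRRW.IsInteriorCritical R q → q = p) ∧
    (¬ IsMaxOn (VRRW.H R) (stdSimplex ℝ (Fin d)) p →
      ∀ {Ω : Type*} [MeasurableSpace Ω] (μ : MeasureTheory.Measure Ω)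
        [MeasureTheory.IsProbabilityMeasure μ] (s : Fin d → ℝ) (y₀ : Fin d) (Y : ℕ → Ω → Fin d),
        (∀ i, 0 < s i) → VRRW.IsReinforcedProcess R s y₀ μ Y →
        μ {ω | Filter.Tendsto (fun n => VRRW.occupation s (fun k => Y k ω) n)
          Filter.atTop (𝓝 p)} = 0) ∧
    (¬ IsMaxOn (VRRW.H R) (stdSimplex ℝ (Fin d)) p ↔ 1 < VRRW.numPosEigenvalues R) ∧
    DifferentiableAt ℝ (VRRW.drift R) p ∧
    ∃ hW : ∀ w ∈ VRRW.directions d, (fderiv ℝ (VRRW.drift R) p).toLinearMap w ∈ VRRW.directions d,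
      (1 < VRRW.numPosEigenvalues R ↔
        ∃ c : ℝ, 0 < c ∧ Module.End.HasEigenvalue
          ((fderiv ℝ (VRRW.drift R) p).toLinearMap.restrict hW) c) := by
  have hmax := hp.not_isMaxOn_iff hsymm
  have hnum := hp.one_lt_numPosEigenvalues_iff hsymm
  refine ⟨fun q hq => hp.eq_of_det_ne_zero hdet hq, ?_, hmax.trans hnum.symm,
    (hp.hasStrictFDerivAt_drift hsymm).hasFDerivAt.differentiableAt,
    hp.fderiv_drift_mem_directions hsymm,
    hnum.trans (hp.hasPositiveDirection_iff_hasEigenvalue hsymm _)⟩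
  intro hnot Ω _ μ _ s y₀ Y hs hY
  exact hY.measure_tendsto_eq_zero hsymm hnonneg hcol hdet hp (hmax.1 hnot) hs
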